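/- Let $P$ be a finite set of points of the Euclidean plane, no three of which are collinear, with a designated point $r\in P$, the root. A geometric graph on $P$ is a finite simple graph with vertex set $P$ whose edges are drawn as straight line segments; its cost is the sum of the Euclidean lengths of its edges. For a direction (a nonzero vector) $u\in\mathbb R^2$, a path $(w_0,\dots,w_l)$ is $u$-monotone if the sequence $\langle u,w_0\rangle,\dots,\langle u,w_l\rangle$ is (weakly) increasing or (weakly) decreasing. A geometric graph on $P$ is rooted $u$-monotone if it contains, for every $p\in P$, a $u$-monotone path from $r$ to $p$, and it is rooted uniform monotone if it is rooted $u$-monotone for some direction $u$. A rooted uniform monotone minimum spanning tree (rooted UMMST) of $P$ is a tree on $P$ that is rooted uniform monotone and has minimum cost among all rooted uniform monotone geometric graphs on $P$ (the direction of monotonicity is not prescribed). Theorem. A rooted UMMST of $P$, together with a direction in which it is rooted monotone, can be computed in $O(|P|^2\log|P|)$ time. That is, there are a constant $C$ and a single program for the real RAM which, given the list of the coordinates of the points of any such $P$ and the position of the root in the list, halts with such a direction and such a tree (as the list of the parents of the vertices other than the root), after at most $C\,|P|^2\log|P|$ steps if $|P|\ge 2$. Here a real RAM has memory cells for real numbers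 and for natural numbers (used as indices and addresses), and performs in one step each memory access, each addition, subtraction, multiplication or square root of real numbers, each addition or subtraction of indices, each comparison of two real numbers or of two indices, and each elementary control step. -/

import Mathlib

/-! Rooted uniform monotone spanning graphs of a point set, and a real random access machine. -/

namespace Geo

/-- The Euclidean plane. -/
abbrev Plane : Type := EuclideanSpace ℝ (Fin 2)

variable {V : Type*}

/-- A finite family of points is in general position: no three of them are collinear. -/
def GeneralPosition (p : V → Plane) : Prop :=
  ∀ i j k : V, i ≠ j → i ≠ k → j ≠ k → ¬ Collinear ℝ {p i, p j, p k}

/-- The coordinate of the point `q` on the axis directed by `u` (up to the positive factor `‖u‖`,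
which plays no role for monotonicity). -/
noncomputable def coord (u q : Plane) : ℝ := inner ℝ u q

/-- The sequence of points `p w₀, p w₁, …` is monotone in the direction `u`: its coordinates on the
axis are (weakly) increasing or (weakly) decreasing. -/
def MonotoneAlong (p : V → Plane) (u : Plane) (l : List V) : Prop :=
  (l.map fun v => coord u (p v)).IsChain (· ≤ ·) ∨ (l.map fun v => coord u (p v)).IsChain (· ≥ ·)

/-- The geometric graph with vertices `p v`, `v : V`, and with the segments given by the edges of
`G`, is rooted monotone in the direction `u`: every vertex is joined to the root by a path
of `G` that is monotone in the direction `u`. -/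
def RootedMonotone (p : V → Plane) (r : V) (u : Plane) (G : SimpleGraph V) : Prop :=
  ∀ v : V, ∃ w : G.Walk r v, w.IsPath ∧ MonotoneAlong p u w.support

/-- Rooted uniform monotone: rooted monotone in some direction, the same for all vertices. -/
def RootedUniformMonotone (p : V → Plane) (r : V) (G : SimpleGraph V) : Prop :=
  ∃ u : Plane, u ≠ 0 ∧ RootedMonotone p r u G

/-- The Euclidean length of an edge. -/
noncomputable def edgeLength (p : V → Plane) (e : Sym2 V) : ℝ :=
  Sym2.lift ⟨fun a b => dist (p a) (p b), fun _ _ => dist_comm _ _⟩ e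

open Classical in
/-- The cost of a geometric graph: the sum of the Euclidean lengths of its edges. -/
noncomputable def cost [Fintype V] (p : V → Plane) (G : SimpleGraph V) : ℝ :=
  ∑ e ∈ G.edgeFinset, edgeLength p e

/-- `T` is a rooted uniform monotone minimum spanning tree, and `u` is a direction of monotonicity
for it. The competitors are all rooted uniform monotone spanning graphs, in all directions. -/
structure IsRootedUMMST [Fintype V] (p : V → Plane) (r : V) (u : Plane) (T : SimpleGraph V) :
    Prop where
  isTree : T.IsTree
  direction_ne_zero : u ≠ 0
  monotone : RootedMonotone p r u T
  minimal : ∀ G : SimpleGraph V, RootedUniformMonotone p r G → cost p T ≤ cost p G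

end Geo

namespace RealRAM

/-- The memory of the machine: registers and arrays (finitely many of which occur in a program)
that hold natural numbers (indices), and registers and arrays that hold real numbers. -/
structure State where
  nreg : ℕ → ℕ
  rreg : ℕ → ℝ
  narr : ℕ → ℕ → ℕ
  rarr : ℕ → ℕ → ℝ

/-- Index expressions: constants, registers, array cells, sum, truncated difference. -/
inductive NExp where
  | lit (k : ℕ)
  | reg (x : ℕ)
  | get (a : ℕ) (i : NExp)
  | add (e f : NExp)
  | sub (e f : NExp)

/-- Real expressions: integer constants, registers, array cells (addressed by an index
expression), sum, difference, product, square root. -/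
inductive RExp where
  | lit (k : ℤ)
  | reg (x : ℕ)
  | get (a : ℕ) (i : NExp)
  | add (e f : RExp)
  | sub (e f : RExp)
  | mul (e f : RExp)
  | sqrt (e : RExp)

/-- Tests: comparisons of indices and of real numbers, and their Boolean combinations. -/
inductive Test where
  | nlt (e f : NExp)
  | rlt (e f : RExp)
  | neg (b : Test)
  | conj (b c : Test)

/-- Programs. -/
inductive Prog where
  | skip
  | setN (x : ℕ) (e : NExp)
  | setR (x : ℕ) (e : RExp)
  | putN (a : ℕ) (i e : NExp)
  | putR (a : ℕ) (i : NExp) (e : RExp)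
  | seq (P Q : Prog)
  | ite (b : Test) (P Q : Prog)
  | while (b : Test) (P : Prog)

def NExp.eval (s : State) : NExp → ℕ
  | .lit k => k
  | .reg x => s.nreg x
  | .get a i => s.narr a (i.eval s)
  | .add e f => e.eval s + f.eval s
  | .sub e f => e.eval s - f.eval s

noncomputable def RExp.eval (s : State) : RExp → ℝ
  | .lit k => k
  | .reg x => s.rreg x
  | .get a i => s.rarr a (i.eval s)
  | .add e f => e.eval s + f.eval s
  | .sub e f => e.eval s - f.eval s
  | .mul e f => e.eval s * f.eval s
  | .sqrt e => Real.sqrt (e.eval s)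

def Test.Holds (s : State) : Test → Prop
  | .nlt e f => e.eval s < f.eval s
  | .rlt e f => e.eval s < f.eval s
  | .neg b => ¬ b.Holds s
  | .conj b c => b.Holds s ∧ c.Holds s

/-! The time of an evaluation: every operation, memory access and constant costs one unit. -/

def NExp.time : NExp → ℕ
  | .lit _ => 1
  | .reg _ => 1
  | .get _ i => i.time + 1
  | .add e f => e.time + f.time + 1
  | .sub e f => e.time + f.time + 1

def RExp.time : RExp → ℕ
  | .lit _ => 1
  | .reg _ => 1
  | .get _ i => i.time + 1
  | .add e f => e.time + f.time + 1
  | .sub e f => e.time + f.time + 1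
  | .mul e f => e.time + f.time + 1
  | .sqrt e => e.time + 1

def Test.time : Test → ℕ
  | .nlt e f => e.time + f.time + 1
  | .rlt e f => e.time + f.time + 1
  | .neg b => b.time + 1
  | .conj b c => b.time + c.time + 1

/-- `Exec P s t s'`: started in the state `s`, the program `P` halts after `t` units of time in the
state `s'`. -/
inductive Exec : Prog → State → ℕ → State → Prop where
  | skip (s : State) : Exec .skip s 1 s
  | setN (s : State) (x : ℕ) (e : NExp) :
      Exec (.setN x e) s (e.time + 1) { s with nreg := Function.update s.nreg x (e.eval s) }
  | setR (s : State) (x : ℕ) (e : RExp) :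
      Exec (.setR x e) s (e.time + 1) { s with rreg := Function.update s.rreg x (e.eval s) }
  | putN (s : State) (a : ℕ) (i e : NExp) :
      Exec (.putN a i e) s (i.time + e.time + 1)
        { s with narr := Function.update s.narr a
                   (Function.update (s.narr a) (i.eval s) (e.eval s)) }
  | putR (s : State) (a : ℕ) (i : NExp) (e : RExp) :
      Exec (.putR a i e) s (i.time + e.time + 1)
        { s with rarr := Function.update s.rarr a
                   (Function.update (s.rarr a) (i.eval s) (e.eval s)) }
  | seq {P Q : Prog} {s s₁ s₂ : State} {t₁ t₂ : ℕ} :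
      Exec P s t₁ s₁ → Exec Q s₁ t₂ s₂ → Exec (.seq P Q) s (t₁ + t₂) s₂
  | iteTrue {b : Test} {P Q : Prog} {s s' : State} {t : ℕ} :
      b.Holds s → Exec P s t s' → Exec (.ite b P Q) s (b.time + 1 + t) s'
  | iteFalse {b : Test} {P Q : Prog} {s s' : State} {t : ℕ} :
      ¬ b.Holds s → Exec Q s t s' → Exec (.ite b P Q) s (b.time + 1 + t) s'
  | whileTrue {b : Test} {P : Prog} {s s₁ s₂ : State} {t₁ t₂ : ℕ} :
      b.Holds s → Exec P s t₁ s₁ → Exec (.while b P) s₁ t₂ s₂ →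
        Exec (.while b P) s (b.time + 1 + t₁ + t₂) s₂
  | whileFalse {b : Test} {P : Prog} {s : State} :
      ¬ b.Holds s → Exec (.while b P) s (b.time + 1) s

/-- The machine is deterministic: the running time and the final state are functions of the
initial state. -/
theorem Exec.unique {P : Prog} {s s₁ s₂ : State} {t₁ t₂ : ℕ} (h₁ : Exec P s t₁ s₁)
    (h₂ : Exec P s t₂ s₂) : t₁ = t₂ ∧ s₁ = s₂ := by
  induction h₁ generalizing t₂ s₂ with
  | skip | setN | setR | putN | putR => cases h₂; exact ⟨rfl, rfl⟩
  | seq _ _ ih₁ ih₂ =>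
    cases h₂ with
    | seq a b =>
      obtain ⟨rfl, rfl⟩ := ih₁ a
      obtain ⟨rfl, rfl⟩ := ih₂ b
      exact ⟨rfl, rfl⟩
  | iteTrue hb _ ih =>
    cases h₂ with
    | iteTrue _ a => obtain ⟨rfl, rfl⟩ := ih a; exact ⟨rfl, rfl⟩
    | iteFalse hn _ => exact absurd hb hn
  | iteFalse hn _ ih =>
    cases h₂ with
    | iteTrue hb _ => exact absurd hb hn
    | iteFalse _ a => obtain ⟨rfl, rfl⟩ := ih a; exact ⟨rfl, rfl⟩
  | whileTrue hb _ _ ih₁ ih₂ =>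
    cases h₂ with
    | whileTrue _ a b =>
      obtain ⟨rfl, rfl⟩ := ih₁ a
      obtain ⟨rfl, rfl⟩ := ih₂ b
      exact ⟨rfl, rfl⟩
    | whileFalse hn => exact absurd hb hn
  | whileFalse hn =>
    cases h₂ with
    | whileTrue hb _ _ => exact absurd hb hn
    | whileFalse _ => exact ⟨rfl, rfl⟩

/-- The initial state for a rooted point set: index register 0 holds the number of points, index
register 1 holds the position of the root in the list, and the real arrays 0 and 1 hold the first
and second coordinates of the points. All other memory cells are zero. -/
noncomputable def input {n : ℕ} (p : Fin n → Geo.Plane) (r : Fin n) : State where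
  nreg := fun x => if x = 0 then n else if x = 1 then (r : ℕ) else 0
  rreg := fun _ => 0
  narr := fun _ _ => 0
  rarr := fun a i =>
    if h : i < n then (if a = 0 then p ⟨i, h⟩ 0 else if a = 1 then p ⟨i, h⟩ 1 else 0) else 0

/-- The direction found by a halted machine: the vector in the real registers 0 and 1. -/
noncomputable def outputDirection (s : State) : Geo.Plane := !₂[s.rreg 0, s.rreg 1]

/-- The graph found by a halted machine: index array 0 holds a parent for each vertex other than
the root, and the edges join these vertices to their parents. -/
def outputGraph {n : ℕ} (r : Fin n) (s : State) : SimpleGraph (Fin n) :=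
  SimpleGraph.fromRel fun i j => i ≠ r ∧ s.narr 0 i = (j : ℕ)

end RealRAM

/-! Fix a direction `u`. In a rooted `u`-monotone graph, let every vertex take as parent the next
vertex on a shortest monotone walk to the root. The parent lies weakly between the root and the
vertex on the axis, the walk lengths decrease from child to parent, and the parent edges are
distinct edges of the graph. Conversely, parents with decreasing labels and this betweenness form a
`u`-monotone tree whose cost is the sum of the parent distances
(`exists_isParent_of_rootedMonotone`, `IsParent.rootedMonotone`, `IsParent.isTree`,
`IsParent.cost_eq`). The optimum for `u` would thus be a sum of independent nearest-parent
distances, were it not for ties: two points at the same level, on one side of the root, may not be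
parents of each other.

General position makes the ties of a direction a matching. Breaking each tie by a sign (`Refines`)
turns the problem into independent minima again: `Refines.isParent` and `IsParent.exists_refines`
identify the optimum for `u` with the least `total` over all refinements. Reversing the tie of `i`
and `j` affects only the terms of `i` and `j`, and the gain does not depend on how the other ties
are broken (`Refines.total_flip_sub_eq`). So the least total is found by trying each reversal once
(`Refines.total_insert_ge`).

Weak monotonicity is a closed condition and is the same for `u` and `-u`. Hence only directions
orthogonal to some pair of points are needed (`IsParent.exists_evDir`), and they can be swept in a
half-plane in the order of their inverse slopes. When two non-root points change order, just one
candidate parent of each changes. When a point reaches or leaves the level of the root, its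
eligibility as a parent changes for all points. This gives quadratically many events with constantly
many updates, and linearly many events with linearly many updates. Tournament trees, one per point
for its candidates and one for the events, make each update logarithmic.

The sweep keeps three real values: the current total, the least total over the ties already reversed
in the current direction, and the best value so far. At its end (`Sweeping`) the last value is a
lower bound for every refinement in every event direction and is met by the recorded direction. The
signs for that direction are then recomputed and its ties improved one at a time, and the roots of
the candidate trees give the parents. -/

namespace Geo

open SimpleGraph

/-! ### Monotone graphs and choices of parents -/

section Parents

variable {V : Type*}

/-- On the axis directed by `u`, the point `q` lies (weakly) between the root and `v`. -/
def Between (p : V → Plane) (r : V) (u : Plane) (q v : V) : Prop :=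
  0 ≤ (coord u (p q) - coord u (p r)) * (coord u (p v) - coord u (p q))

/-- A choice of parents that describes a tree, rooted monotone in the direction `u`. -/
def IsParent (p : V → Plane) (r : V) (u : Plane) (par : V → V) : Prop :=
  ∃ l : V → ℕ, ∀ v, v ≠ r → l (par v) < l v ∧ Between p r u (par v) v

theorem MonotoneAlong.reverse {p : V → Plane} {u : Plane} {l : List V}
    (h : MonotoneAlong p u l) : MonotoneAlong p u l.reverse := by
  unfold MonotoneAlong at *
  rw [List.map_reverse, List.isChain_reverse, List.isChain_reverse]
  exact h.symm

theorem MonotoneAlong.tail {p : V → Plane} {u : Plane} {a : V} {l : List V}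
    (h : MonotoneAlong p u (a :: l)) : MonotoneAlong p u l := by
  unfold MonotoneAlong at *
  simp only [List.map_cons] at h
  exact h.imp List.IsChain.of_cons List.IsChain.of_cons

/-- If a monotone sequence starts with `v, q` and contains `r`, then `q` is between `r` and `v`. -/
theorem MonotoneAlong.between {p : V → Plane} {u : Plane} {v q r : V} {l : List V}
    (h : MonotoneAlong p u (v :: q :: l)) (hr : r ∈ q :: l) : Between p r u q v := by
  unfold MonotoneAlong at h
  simp only [List.map_cons, List.isChain_cons_cons] at h
  unfold Between
  rcases h with ⟨h1, h2⟩ | ⟨h1, h2⟩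
  · have h3 : coord u (p q) ≤ coord u (p r) := by
      rw [← List.map_cons (f := fun v => coord u (p v)), List.isChain_iff_pairwise,
        List.map_cons, List.pairwise_cons] at h2
      rcases List.mem_cons.1 hr with rfl | hr
      · exact le_rfl
      · exact h2.1 _ (List.mem_map_of_mem hr)
    exact mul_nonneg_of_nonpos_of_nonpos (by linarith) (by linarith)
  · have h3 : coord u (p r) ≤ coord u (p q) := by
      rw [← List.map_cons (f := fun v => coord u (p v)), List.isChain_iff_pairwise,
        List.map_cons, List.pairwise_cons] at h2
      rcases List.mem_cons.1 hr with rfl | hr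
      · exact le_rfl
      · exact h2.1 _ (List.mem_map_of_mem hr)
    exact mul_nonneg (by linarith) (by linarith)

theorem edgeLength_nonneg (p : V → Plane) (e : Sym2 V) : 0 ≤ edgeLength p e := by
  induction e with
  | h a b => exact dist_nonneg (x := p a) (y := p b)

/-- The edges of a choice of parents with decreasing labels are different. -/
theorem parent_edge_injOn {r : V} {par : V → V} {l : V → ℕ}
    (h : ∀ v, v ≠ r → l (par v) < l v) :
    Set.InjOn (fun v => s(v, par v)) {v | v ≠ r} := by
  intro v hv w hw e
  simp only [Sym2.eq, Sym2.rel_iff', Prod.mk.injEq, Prod.swap_prod_mk] at e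
  rcases e with ⟨e, -⟩ | ⟨e1, e2⟩
  · exact e
  · have a := h v hv
    have b := h w hw
    rw [e2] at a
    rw [← e1] at b
    omega

/-- The graph whose edges join the vertices other than the root to their parents. -/
def parentGraph (r : V) (par : V → V) : SimpleGraph V :=
  SimpleGraph.fromRel fun i j => i ≠ r ∧ par i = j

theorem parentGraph_adj {r : V} {par : V → V} {v : V} (hv : v ≠ r) (h : par v ≠ v) :
    (parentGraph r par).Adj v (par v) := by
  rw [parentGraph, SimpleGraph.fromRel_adj]
  exact ⟨h.symm, Or.inl ⟨hv, rfl⟩⟩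

/-- Betweenness keeps a parent on the same side of the root as its child, and no farther out, so
following parents approaches the root's level monotonically. The decreasing labels make the
recursion terminate, and the bound on the labels of the support shows that no vertex repeats. -/
theorem exists_walk_parentGraph {p : V → Plane} {r : V} {u : Plane} {par : V → V} {l : V → ℕ}
    (h : ∀ v, v ≠ r → l (par v) < l v ∧ Between p r u (par v) v) (k : ℕ) (v : V) (hk : l v ≤ k) :
    ∃ w : (parentGraph r par).Walk v r, w.IsPath ∧ (∀ x ∈ w.support, l x ≤ l v) ∧
      (coord u (p r) ≤ coord u (p v) →
        (w.support.map fun v => coord u (p v)).IsChain (· ≥ ·)) ∧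
      (coord u (p v) ≤ coord u (p r) →
        (w.support.map fun v => coord u (p v)).IsChain (· ≤ ·)) := by
  induction k using Nat.strong_induction_on generalizing v with
  | _ k ih =>
    by_cases hv : v = r
    · subst hv
      exact ⟨Walk.nil, by simp, by simp, by simp, by simp⟩
    obtain ⟨h1, h2⟩ := h v hv
    obtain ⟨w, wp, wl, wu, wd⟩ := ih (l (par v)) (by omega) (par v) le_rfl
    have ha : (parentGraph r par).Adj v (par v) :=
      parentGraph_adj hv fun e => by rw [e] at h1; omega
    refine ⟨Walk.cons ha w, ?_, ?_, ?_, ?_⟩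
    · rw [Walk.cons_isPath_iff]
      exact ⟨wp, fun hm => by have := wl v hm; omega⟩
    · intro x hx
      rw [Walk.support_cons, List.mem_cons] at hx
      rcases hx with rfl | hx
      · exact le_rfl
      · exact (wl x hx).trans h1.le
    · intro hc
      have h3 : coord u (p r) ≤ coord u (p (par v)) ∧ coord u (p (par v)) ≤ coord u (p v) := by
        unfold Between at h2
        constructor <;> by_contra! hlt
        · nlinarith
        · nlinarith
      have := wu h3.1
      rw [Walk.support_cons, ← w.cons_tail_support, List.map_cons, List.map_cons,
        List.isChain_cons_cons]
      rw [← w.cons_tail_support] at this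
      exact ⟨h3.2, this⟩
    · intro hc
      have h3 : coord u (p (par v)) ≤ coord u (p r) ∧ coord u (p v) ≤ coord u (p (par v)) := by
        unfold Between at h2
        constructor <;> by_contra! hlt
        · nlinarith
        · nlinarith
      have := wd h3.1
      rw [Walk.support_cons, ← w.cons_tail_support, List.map_cons, List.map_cons,
        List.isChain_cons_cons]
      rw [← w.cons_tail_support] at this
      exact ⟨h3.2, this⟩

theorem IsParent.rootedMonotone {p : V → Plane} {r : V} {u : Plane} {par : V → V}
    (h : IsParent p r u par) : RootedMonotone p r u (parentGraph r par) := by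
  obtain ⟨l, h⟩ := h
  intro v
  obtain ⟨w, wp, -, wu, wd⟩ := exists_walk_parentGraph h (l v) v le_rfl
  refine ⟨w.reverse, wp.reverse, ?_⟩
  rw [Walk.support_reverse]
  refine MonotoneAlong.reverse ?_
  rcases le_total (coord u (p r)) (coord u (p v)) with hc | hc
  · exact Or.inr (wu hc)
  · exact Or.inl (wd hc)

theorem IsParent.ne_self {p : V → Plane} {r : V} {u : Plane} {par : V → V}
    (h : IsParent p r u par) : ∀ v, v ≠ r → par v ≠ v := by
  obtain ⟨l, h⟩ := h
  intro v hv e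
  have := (h v hv).1
  rw [e] at this
  omega

variable [Fintype V] [DecidableEq V]

/-- The parent of a vertex is its successor on a shortest monotone walk to the root: the tail of
that walk is again monotone, so the parent has a smaller label. The parent edges are distinct edges
of the graph, whence the bound on the cost. -/
theorem exists_isParent_of_rootedMonotone {p : V → Plane} {r : V} {u : Plane} {G : SimpleGraph V}
    (hG : RootedMonotone p r u G) :
    ∃ par, IsParent p r u par ∧ ∑ v ∈ Finset.univ.erase r, dist (p v) (p (par v)) ≤ cost p G := by
  classical
  have hex : ∀ v, ∃ k, ∃ w : G.Walk v r, MonotoneAlong p u w.support ∧ w.length = k := fun v => by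
    obtain ⟨w, -, hw⟩ := hG v
    refine ⟨_, w.reverse, ?_, rfl⟩
    rw [Walk.support_reverse]
    exact hw.reverse
  -- Walks suffice for the minimum; that the monotone routes in the hypothesis are paths plays no
  -- role for the labels.
  let l : V → ℕ := fun v => Nat.find (hex v)
  have key : ∀ v, v ≠ r → ∃ q, G.Adj v q ∧ l q < l v ∧ Between p r u q v := fun v hv => by
    obtain ⟨w, hw, hl⟩ := Nat.find_spec (hex v)
    change w.length = l v at hl
    cases w with
    | nil => exact absurd rfl hv
    | @cons _ q _ a w =>
      refine ⟨q, a, ?_, ?_⟩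
      · rw [Walk.support_cons] at hw
        have : l q ≤ w.length := Nat.find_min' (hex q) ⟨w, hw.tail, rfl⟩
        rw [Walk.length_cons] at hl
        omega
      · rw [Walk.support_cons] at hw
        have hr : r ∈ w.support := w.end_mem_support
        rw [← w.cons_tail_support] at hw hr
        exact hw.between hr
  choose! par hpar using key
  refine ⟨par, ⟨l, fun v hv => (hpar v hv).2⟩, ?_⟩
  have hinj := parent_edge_injOn (r := r) (par := par) (l := l) fun v hv => (hpar v hv).2.1
  calc ∑ v ∈ Finset.univ.erase r, dist (p v) (p (par v))
      = ∑ v ∈ Finset.univ.erase r, edgeLength p s(v, par v) := rfl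
    _ = ∑ e ∈ (Finset.univ.erase r).image fun v => s(v, par v), edgeLength p e := by
        rw [Finset.sum_image]
        intro v hv w hw e
        exact hinj (by simpa using hv) (by simpa using hw) e
    _ ≤ cost p G := by
        unfold cost
        refine Finset.sum_le_sum_of_subset_of_nonneg ?_ fun e _ _ => edgeLength_nonneg p e
        intro e he
        obtain ⟨v, hv, rfl⟩ := Finset.mem_image.1 he
        rw [SimpleGraph.mem_edgeFinset, SimpleGraph.mem_edgeSet]
        exact (hpar v (Finset.ne_of_mem_erase hv)).1

open Classical in
theorem parentGraph_edgeFinset {r : V} {par : V → V} (h : ∀ v, v ≠ r → par v ≠ v) :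
    (parentGraph r par).edgeFinset = (Finset.univ.erase r).image fun v => s(v, par v) := by
  ext e
  induction e with
  | h a b =>
    rw [SimpleGraph.mem_edgeFinset, SimpleGraph.mem_edgeSet, parentGraph, SimpleGraph.fromRel_adj]
    simp only [Finset.mem_image, Finset.mem_erase, Finset.mem_univ, and_true, Sym2.eq,
      Sym2.rel_iff', Prod.mk.injEq, Prod.swap_prod_mk]
    constructor
    · rintro ⟨-, ⟨ha, rfl⟩ | ⟨hb, rfl⟩⟩
      · exact ⟨a, ha, Or.inl ⟨rfl, rfl⟩⟩
      · exact ⟨b, hb, Or.inr ⟨rfl, rfl⟩⟩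
    · rintro ⟨x, hx, ⟨rfl, rfl⟩ | ⟨rfl, rfl⟩⟩
      · exact ⟨(h x hx).symm, Or.inl ⟨hx, rfl⟩⟩
      · exact ⟨h x hx, Or.inr ⟨hx, rfl⟩⟩

theorem IsParent.cost_eq {p : V → Plane} {r : V} {u : Plane} {par : V → V}
    (h : IsParent p r u par) :
    cost p (parentGraph r par) = ∑ v ∈ Finset.univ.erase r, dist (p v) (p (par v)) := by
  classical
  unfold cost
  have hs := h.ne_self
  obtain ⟨l, h⟩ := h
  have hinj := parent_edge_injOn (r := r) (par := par) (l := l) fun v hv => (h v hv).1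
  rw [parentGraph_edgeFinset hs, Finset.sum_image]
  · rfl
  · intro v hv w hw e
    exact hinj (by simpa using hv) (by simpa using hw) e

/-- Connectedness comes from the monotone paths, and the parent edges, being distinct, number one
less than the vertices. -/
theorem IsParent.isTree {p : V → Plane} {r : V} {u : Plane} {par : V → V}
    (h : IsParent p r u par) : (parentGraph r par).IsTree := by
  classical
  have hm := h.rootedMonotone
  have hs := h.ne_self
  obtain ⟨l, h⟩ := h
  have hinj := parent_edge_injOn (r := r) (par := par) (l := l) fun v hv => (h v hv).1
  rw [SimpleGraph.isTree_iff_connected_and_card]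
  have : Nonempty V := ⟨r⟩
  refine ⟨?_, ?_⟩
  · rw [SimpleGraph.connected_iff]
    refine ⟨fun a b => ?_, this⟩
    obtain ⟨w, -⟩ := hm a
    obtain ⟨w', -⟩ := hm b
    exact ⟨w.reverse.append w'⟩
  · rw [Nat.card_eq_fintype_card, ← SimpleGraph.edgeFinset_card, parentGraph_edgeFinset hs,
      Finset.card_image_of_injOn, Nat.card_eq_fintype_card, Finset.card_erase_of_mem (by simp),
      Finset.card_univ]
    · have : 0 < Fintype.card V := Fintype.card_pos
      omega
    · intro v hv w hw e
      exact hinj (by simpa using hv) (by simpa using hw) e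

end Parents

end Geo

namespace Geo

/-! ### Broken ties and the total of the nearest parents -/

section Config

variable {V : Type*}

/-- The signs of the differences of the coordinates in the direction `u`. -/
noncomputable def dirSign (p : V → Plane) (u : Plane) : V → V → ℝ := fun i j =>
  Real.sign (coord u (p i) - coord u (p j))

theorem dirSign_swap (p : V → Plane) (u : Plane) (i j : V) :
    dirSign p u j i = -dirSign p u i j := by
  unfold dirSign
  rw [← Real.sign_neg, neg_sub]

theorem dirSign_eq_zero {p : V → Plane} {u : Plane} {i j : V} :
    dirSign p u i j = 0 ↔ coord u (p i) = coord u (p j) := by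
  unfold dirSign
  rw [Real.sign_eq_zero_iff, sub_eq_zero]

variable [LinearOrder V]

/-- The parent that the signs `s` offer to `v` for the candidate `q`: the candidate itself if it
lies between the root and `v` according to `s`, and the root otherwise. -/
noncomputable def choice (s : V → V → ℝ) (r v q : V) : V :=
  if q ≠ v ∧ 0 ≤ s q r * s v q then q else r

theorem choice_root (s : V → V → ℝ) (r v : V) : choice s r v r = r := by
  unfold choice
  split_ifs <;> rfl

/-- Reversal of the order of `i` and `j`. -/
def flipTie (s : V → V → ℝ) (i j : V) : V → V → ℝ := fun a b =>
  if a = i ∧ b = j ∨ a = j ∧ b = i then -s a b else s a b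

theorem flip_flip (s : V → V → ℝ) (i j : V) : flipTie (flipTie s i j) i j = s := by
  funext a b
  unfold flipTie
  split_ifs <;> simp

/-- The signs `s` refine the signs `g` of a direction: ties are broken, except those with the root;
a tie that does not belong to `Q` is broken as `b` says. -/
structure Refines (r : V) (g b : V → V → ℝ) (Q : Set (V × V)) (s : V → V → ℝ) : Prop where
  root : ∀ i, i ≠ r → s i r = g i r
  sep : ∀ i j, i ≠ r → j ≠ r → g i j ≠ 0 → s i j = g i j
  tie : ∀ i j, i ≠ r → j ≠ r → i < j → g i j = 0 → (s i j = 1 ∨ s i j = -1) ∧ s j i = -s i j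
  base : ∀ i j, i ≠ r → j ≠ r → i < j → g i j = 0 → (i, j) ∉ Q → s i j = b i j

/-- The base signs matter only on ties that stay fixed, so the free set and the base may be
exchanged together. This also covers changes of the free set by pairs that are not ties. -/
theorem Refines.mono {r : V} {g b b' : V → V → ℝ} {Q Q' : Set (V × V)} {s : V → V → ℝ}
    (h : Refines r g b Q s) (hQ : ∀ i j, i ≠ r → j ≠ r → i < j → g i j = 0 → (i, j) ∉ Q' →
      (i, j) ∉ Q ∧ b i j = b' i j) : Refines r g b' Q' s where
  root := h.root
  sep := h.sep
  tie := h.tie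
  base i j hi hj hij hg hq := by
    obtain ⟨h1, h2⟩ := hQ i j hi hj hij hg hq
    rw [← h2]
    exact h.base i j hi hj hij hg h1

theorem flip_of_ne {s : V → V → ℝ} {i j a b : V} (h : ¬ (a = i ∧ b = j ∨ a = j ∧ b = i)) :
    flipTie s i j a b = s a b := by
  unfold flipTie
  rw [if_neg h]

theorem flip_left (s : V → V → ℝ) (i j : V) : flipTie s i j i j = -s i j := by simp [flipTie]

theorem flip_right (s : V → V → ℝ) (i j : V) : flipTie s i j j i = -s j i := by simp [flipTie]

/-- Reversing a tie keeps the refinement, if that tie is free. -/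
theorem Refines.flip {r : V} {g b : V → V → ℝ} {Q : Set (V × V)} {s : V → V → ℝ}
    (h : Refines r g b Q s) (hg : ∀ i j, g j i = -g i j) {i j : V} (hi : i ≠ r) (hj : j ≠ r)
    (hij : i < j) (h0 : g i j = 0) (hQ : (i, j) ∈ Q) : Refines r g b Q (flipTie s i j) where
  root a ha := by
    rw [flip_of_ne (by rintro (⟨-, rfl⟩ | ⟨-, rfl⟩) <;> contradiction), h.root a ha]
  sep a c ha hc hac := by
    rw [flip_of_ne, h.sep a c ha hc hac]
    rintro (⟨rfl, rfl⟩ | ⟨rfl, rfl⟩)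
    · exact hac h0
    · rw [hg, h0, neg_zero] at hac
      exact hac rfl
  tie a c ha hc hac h1 := by
    obtain ⟨t1, t2⟩ := h.tie a c ha hc hac h1
    by_cases e : a = i ∧ c = j
    · obtain ⟨rfl, rfl⟩ := e
      rw [flip_left, flip_right, t2]
      refine ⟨?_, rfl⟩
      rcases t1 with t1 | t1 <;> simp [t1]
    · have e' : ¬ (a = j ∧ c = i) := by
        rintro ⟨rfl, rfl⟩
        exact lt_asymm hac hij
      rw [flip_of_ne (by tauto), flip_of_ne (by tauto)]
      exact ⟨t1, t2⟩
  base a c ha hc hac h1 hq := by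
    have e : ¬ (a = i ∧ c = j) := by
      rintro ⟨rfl, rfl⟩
      exact hq hQ
    have e' : ¬ (a = j ∧ c = i) := by
      rintro ⟨rfl, rfl⟩
      exact lt_asymm hac hij
    rw [flip_of_ne (by tauto), h.base a c ha hc hac h1 hq]

/-- A newly freed tie has only two states: it agrees with the base, or it does after one reversal.
-/
theorem refines_insert {r : V} {g b : V → V → ℝ} {Q : Set (V × V)} {s : V → V → ℝ}
    (hg : ∀ i j, g j i = -g i j) {i j : V} (hi : i ≠ r) (hj : j ≠ r)
    (hij : i < j) (h0 : g i j = 0) (hb : b i j = 1 ∨ b i j = -1) :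
    Refines r g b (insert (i, j) Q) s →
      Refines r g b Q s ∨ Refines r g b Q (flipTie s i j) := by
  intro h
  by_cases e : s i j = b i j
  · left
    refine ⟨h.root, h.sep, h.tie, fun a c ha hc hac h1 hq => ?_⟩
    by_cases e' : (a, c) = (i, j)
    · obtain ⟨rfl, rfl⟩ := Prod.mk.inj e'
      exact e
    · exact h.base a c ha hc hac h1 (by simp [Set.mem_insert_iff, hq, e'])
  · right
    have h' := h.flip hg hi hj hij h0 (Set.mem_insert _ _)
    refine ⟨h'.root, h'.sep, h'.tie, fun a c ha hc hac h1 hq => ?_⟩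
    by_cases e' : (a, c) = (i, j)
    · obtain ⟨rfl, rfl⟩ := Prod.mk.inj e'
      rw [flip_left]
      rcases (h.tie a c hi hj hij h0).1 with t | t <;> rcases hb with t' | t' <;>
        rw [t, t'] at e ⊢ <;> simp at e ⊢
    · exact h'.base a c ha hc hac h1 (by simp [Set.mem_insert_iff, hq, e'])

variable [Fintype V]

/-- The distance from `v` to the nearest parent that the signs `s` offer. -/
noncomputable def near (p : V → Plane) (r : V) (s : V → V → ℝ) (v : V) : ℝ :=
  Finset.univ.inf' ⟨r, Finset.mem_univ r⟩ fun q => dist (p v) (p (choice s r v q))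

/-- The total length of the edges to the nearest parents. -/
noncomputable def total (p : V → Plane) (r : V) (s : V → V → ℝ) : ℝ := ∑ v, near p r s v

theorem exists_near_eq (p : V → Plane) (r : V) (s : V → V → ℝ) (v : V) :
    ∃ q, near p r s v = dist (p v) (p (choice s r v q)) := by
  obtain ⟨q, -, hq⟩ := Finset.exists_mem_eq_inf' (s := (Finset.univ : Finset V))
    ⟨r, Finset.mem_univ r⟩ fun q => dist (p v) (p (choice s r v q))
  exact ⟨q, hq⟩

theorem near_le (p : V → Plane) (r : V) (s : V → V → ℝ) (v q : V) :
    near p r s v ≤ dist (p v) (p (choice s r v q)) :=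
  Finset.inf'_le _ (Finset.mem_univ q)

theorem near_eq_of_forall {p : V → Plane} {r : V} {s : V → V → ℝ} {v : V} {x : ℝ}
    (h : ∃ q, x = dist (p v) (p (choice s r v q)))
    (h' : ∀ q, x ≤ dist (p v) (p (choice s r v q))) : x = near p r s v := by
  refine le_antisymm (Finset.le_inf' _ _ fun q _ => h' q) ?_
  obtain ⟨q, rfl⟩ := h
  exact near_le p r s v q

theorem near_nonneg (p : V → Plane) (r : V) (s : V → V → ℝ) (v : V) : 0 ≤ near p r s v := by
  obtain ⟨q, hq⟩ := exists_near_eq p r s v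
  rw [hq]
  exact dist_nonneg

theorem near_le_star (p : V → Plane) (r : V) (s : V → V → ℝ) (v : V) :
    near p r s v ≤ dist (p v) (p r) := by
  have := near_le p r s v r
  rwa [choice_root] at this

theorem near_root (p : V → Plane) (r : V) (s : V → V → ℝ) : near p r s r = 0 := by
  refine le_antisymm ?_ (near_nonneg p r s r)
  have := near_le_star p r s r
  rwa [dist_self] at this

theorem total_eq_erase (p : V → Plane) (r : V) (s : V → V → ℝ) :
    total p r s = ∑ v ∈ Finset.univ.erase r, near p r s v := by
  unfold total
  rw [← Finset.add_sum_erase _ _ (Finset.mem_univ r), near_root, zero_add]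

/-- The candidates offered to `v` read only the column of the root and the row of `v`. All locality
of the updates rests on this. -/
theorem near_congr {p : V → Plane} {r : V} {s s' : V → V → ℝ} {v : V}
    (h : ∀ q, q ≠ r → q ≠ v → s q r = s' q r ∧ s v q = s' v q) :
    near p r s v = near p r s' v := by
  have : ∀ q, choice s r v q = choice s' r v q := fun q => by
    by_cases hq : q = r
    · subst hq
      rw [choice_root, choice_root]
    · unfold choice
      by_cases hv : q = v
      · simp [hv]
      · rw [(h q hq hv).1, (h q hq hv).2]
  unfold near
  simp_rw [this]

theorem total_flip_sub {p : V → Plane} {r : V} (s : V → V → ℝ) {i j : V} (hi : i ≠ r) (hj : j ≠ r)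
    (hij : i ≠ j) : total p r (flipTie s i j) - total p r s =
      (near p r (flipTie s i j) i + near p r (flipTie s i j) j) - (near p r s i + near p r s j) := by
  unfold total
  rw [← Finset.sum_sub_distrib, ← Finset.sum_subset (Finset.subset_univ {i, j}),
    Finset.sum_pair hij]
  · ring
  · intro v _ hv
    simp only [Finset.mem_insert, Finset.mem_singleton, not_or] at hv
    rw [sub_eq_zero]
    refine near_congr fun q hq _ => ⟨flip_of_ne ?_, flip_of_ne ?_⟩
    · rintro (⟨-, rfl⟩ | ⟨-, rfl⟩) <;> contradiction
    · rintro (⟨rfl, -⟩ | ⟨rfl, -⟩)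
      · exact hv.1 rfl
      · exact hv.2 rfl

/-- Since `i` and `j` are tied with no other point, their rows are determined by the direction and
by the fixed tie between them. Other ties therefore cannot influence the gain. -/
theorem Refines.total_flip_sub_eq {p : V → Plane} {r : V} {g b : V → V → ℝ} {Q : Set (V × V)}
    {s s' : V → V → ℝ} (h : Refines r g b Q s) (h' : Refines r g b Q s')
    {i j : V} (hi : i ≠ r) (hj : j ≠ r)
    (hij : i < j) (h0 : g i j = 0) (hQ : (i, j) ∉ Q)
    (hi' : ∀ q, q ≠ i → q ≠ j → g i q ≠ 0) (hj' : ∀ q, q ≠ i → q ≠ j → g j q ≠ 0) :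
    total p r (flipTie s i j) - total p r s = total p r (flipTie s' i j) - total p r s' := by
  have hs : s i j = s' i j := by
    rw [h.base i j hi hj hij h0 hQ, h'.base i j hi hj hij h0 hQ]
  have hs' : s j i = s' j i := by
    rw [(h.tie i j hi hj hij h0).2, (h'.tie i j hi hj hij h0).2, hs]
  have hroot : ∀ q, q ≠ r → s q r = s' q r := fun q hq => by rw [h.root q hq, h'.root q hq]
  have hrow : ∀ q, q ≠ r → q ≠ i → s i q = s' i q := fun q hq hqi => by
    by_cases hqj : q = j
    · rw [hqj, hs]
    · rw [h.sep i q hi hq (hi' q hqi hqj), h'.sep i q hi hq (hi' q hqi hqj)]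
  have hrow' : ∀ q, q ≠ r → q ≠ j → s j q = s' j q := fun q hq hqj => by
    by_cases hqi : q = i
    · rw [hqi, hs']
    · rw [h.sep j q hj hq (hj' q hqi hqj), h'.sep j q hj hq (hj' q hqi hqj)]
  have hf : ∀ a c, s a c = s' a c → flipTie s i j a c = flipTie s' i j a c := fun a c e => by
    unfold flipTie
    rw [e]
  rw [total_flip_sub s hi hj hij.ne, total_flip_sub s' hi hj hij.ne,
    near_congr (v := i) (s := s) (s' := s') fun q hq hqi => ⟨hroot q hq, hrow q hq hqi⟩,
    near_congr (v := j) (s := s) (s' := s') fun q hq hqj => ⟨hroot q hq, hrow' q hq hqj⟩,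
    near_congr (v := i) (s := flipTie s i j) (s' := flipTie s' i j)
      fun q hq hqi => ⟨hf _ _ (hroot q hq), hf _ _ (hrow q hq hqi)⟩,
    near_congr (v := j) (s := flipTie s i j) (s' := flipTie s' i j)
      fun q hq hqj => ⟨hf _ _ (hroot q hq), hf _ _ (hrow' q hq hqj)⟩]

/-- When a tie becomes free, the least total changes by the gain of reversing it, if negative. -/
theorem Refines.total_insert_ge {p : V → Plane} {r : V} {g b : V → V → ℝ} {Q : Set (V × V)}
    {s : V → V → ℝ} (h : Refines r g b Q s) {A : ℝ}
    (hA : ∀ s', Refines r g b Q s' → A ≤ total p r s')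
    (hg : ∀ i j, g j i = -g i j) {i j : V} (hi : i ≠ r) (hj : j ≠ r)
    (hij : i < j) (h0 : g i j = 0) (hQ : (i, j) ∉ Q) (hb : b i j = 1 ∨ b i j = -1)
    (hi' : ∀ q, q ≠ i → q ≠ j → g i q ≠ 0) (hj' : ∀ q, q ≠ i → q ≠ j → g j q ≠ 0)
    (s' : V → V → ℝ) (hs' : Refines r g b (insert (i, j) Q) s') :
    A + min 0 (total p r (flipTie s i j) - total p r s) ≤ total p r s' := by
  rcases refines_insert hg hi hj hij h0 hb hs' with h1 | h1
  · have := hA s' h1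
    have := min_le_left 0 (total p r (flipTie s i j) - total p r s)
    linarith
  · have h2 := hA _ h1
    have h3 := h.total_flip_sub_eq h1 (p := p) hi hj hij h0 hQ hi' hj'
    rw [flip_flip] at h3
    have := min_le_right 0 (total p r (flipTie s i j) - total p r s)
    linarith

/-- With no free tie, all the signs that the total depends on are determined. -/
theorem Refines.total_eq {p : V → Plane} {r : V} {g b : V → V → ℝ} {Q : Set (V × V)}
    {s s' : V → V → ℝ} (h : Refines r g b Q s) (h' : Refines r g b Q s')
    (hg : ∀ i j, g j i = -g i j)
    (hQ : ∀ i j, i ≠ r → j ≠ r → i < j → g i j = 0 → (i, j) ∉ Q) :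
    total p r s = total p r s' := by
  rw [total_eq_erase, total_eq_erase]
  refine Finset.sum_congr rfl fun v hv => near_congr fun q hq hqv => ⟨?_, ?_⟩
  · rw [h.root q hq, h'.root q hq]
  · have hv := Finset.ne_of_mem_erase hv
    by_cases h0 : g v q = 0
    · rcases lt_or_gt_of_ne hqv with e | e
      · have h0' : g q v = 0 := by rw [hg, h0, neg_zero]
        have hn := hQ q v hq hv e h0'
        rw [(h.tie q v hq hv e h0').2, (h'.tie q v hq hv e h0').2,
          h.base q v hq hv e h0' hn, h'.base q v hq hv e h0' hn]
      · have hn := hQ v q hv hq e h0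
        rw [h.base v q hv hq e h0 hn, h'.base v q hv hq e h0 hn]
    · rw [h.sep v q hv hq h0, h'.sep v q hv hq h0]

end Config

end Geo

namespace Geo

/-! ### Refinements of a direction and its monotone trees -/

section Directions

variable {V : Type*}

theorem coord_eq (u q : Plane) : coord u q = u 0 * q 0 + u 1 * q 1 := by
  simp [coord, PiLp.inner_apply, Fin.sum_univ_two, mul_comm]

theorem collinear_of_coord_eq {u a b c : Plane} (hu : u ≠ 0) (hb : coord u b = coord u a)
    (hc : coord u c = coord u a) : Collinear ℝ {a, b, c} := by
  have hn : u 0 ^ 2 + u 1 ^ 2 ≠ 0 := by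
    intro h
    apply hu
    have h0 : u 0 = 0 := by nlinarith [sq_nonneg (u 0), sq_nonneg (u 1)]
    have h1 : u 1 = 0 := by nlinarith [sq_nonneg (u 0), sq_nonneg (u 1)]
    ext i
    fin_cases i
    · simpa using h0
    · simpa using h1
  have key : ∀ q : Plane, coord u q = coord u a →
      ∃ t : ℝ, q = t • (!₂[-u 1, u 0] : Plane) +ᵥ a := fun q hq => by
    rw [coord_eq, coord_eq] at hq
    refine ⟨(u 0 * (q 1 - a 1) - u 1 * (q 0 - a 0)) / (u 0 ^ 2 + u 1 ^ 2), ?_⟩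
    ext i
    fin_cases i
    · simp
      field_simp
      linear_combination (u 0) * hq
    · simp
      field_simp
      linear_combination (u 1) * hq
  rw [collinear_iff_of_mem (p₀ := a) (by simp)]
  refine ⟨!₂[-u 1, u 0], ?_⟩
  intro q hq
  simp only [Set.mem_insert_iff, Set.mem_singleton_iff] at hq
  rcases hq with rfl | rfl | rfl
  · exact key _ rfl
  · exact key _ hb
  · exact key _ hc

/-- The ties of a direction form a matching: three points at one level would be collinear. -/
theorem GeneralPosition.dirSign_ne_zero {p : V → Plane} (h : GeneralPosition p) {u : Plane}
    (hu : u ≠ 0) {i j : V} (h0 : dirSign p u i j = 0) (hij : i ≠ j) (k : V) (hk : k ≠ i)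
    (hk' : k ≠ j) : dirSign p u i k ≠ 0 := by
  intro hn
  rw [dirSign_eq_zero] at h0 hn
  exact h i j k hij hk.symm hk'.symm (collinear_of_coord_eq hu h0.symm hn.symm)

theorem sign_mul_sign_nonneg {x y : ℝ} : 0 ≤ Real.sign x * Real.sign y ↔ 0 ≤ x * y := by
  rcases lt_trichotomy x 0 with hx | rfl | hx <;> rcases lt_trichotomy y 0 with hy | rfl | hy <;>
    simp [Real.sign_of_neg, Real.sign_of_pos, *, mul_nonneg_iff, le_of_lt, not_le_of_gt]

theorem between_iff {p : V → Plane} {r : V} {u : Plane} {q v : V} :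
    Between p r u q v ↔ 0 ≤ dirSign p u q r * dirSign p u v q := by
  unfold Between dirSign
  rw [sign_mul_sign_nonneg]

theorem dirSign_eq_or (p : V → Plane) (u : Plane) (i j : V) :
    dirSign p u i j = 0 ∨ dirSign p u i j = 1 ∨ dirSign p u i j = -1 := by
  unfold dirSign
  rcases Real.sign_apply_eq (coord u (p i) - coord u (p j)) with h | h | h <;> simp [h]

theorem dirSign_congr_left {p : V → Plane} {u : Plane} {i j : V} (h : dirSign p u i j = 0) (k : V) :
    dirSign p u i k = dirSign p u j k := by
  rw [dirSign_eq_zero] at h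
  unfold dirSign
  rw [h]

variable [LinearOrder V] [Fintype V]

/-- Parents offered by a refinement of the signs of a direction describe a monotone tree. -/
theorem Refines.isParent {p : V → Plane} {r : V} {u : Plane} {b s : V → V → ℝ} {Q : Set (V × V)}
    (hp : GeneralPosition p) (hu : u ≠ 0) (h : Refines r (dirSign p u) b Q s) {par : V → V}
    (hpar : ∀ v, v ≠ r → ∃ q, par v = choice s r v q) : IsParent p r u par := by
  classical
  let c : V → ℝ := fun v => coord u (p v) - coord u (p r)
  -- The label counts the points strictly closer to the root's level. Doubling leaves room for one
  -- extra unit that orders the two points of a tie.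
  let B : V → Finset V := fun v => Finset.univ.filter fun x => |c x| < |c v|
  let late : V → Prop := fun v =>
    ∃ q, q ≠ v ∧ dirSign p u v q = 0 ∧ (q = r ∨ 0 ≤ s q r * s v q)
  let l : V → ℕ := fun v => if v = r then 0 else 2 * (B v).card + if late v then 1 else 0
  have hcr : c r = 0 := sub_self _
  have hsr : ∀ v, dirSign p u v r = Real.sign (c v) := fun v => rfl
  have hvr : ∀ v, v ≠ r → l r < l v := fun v hv => by
    simp only [l, if_true, if_neg hv]
    by_cases h0 : c v = 0
    · have : late v := ⟨r, hv.symm, by rw [hsr, h0, Real.sign_zero], Or.inl rfl⟩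
      rw [if_pos this]
      omega
    · have : 0 < (B v).card := Finset.card_pos.2 ⟨r, by simp [B, hcr, h0]⟩
      omega
  have hlt : ∀ q v, v ≠ r → |c q| < |c v| → l q < l v := fun q v hv hqv => by
    by_cases hq : q = r
    · rw [hq]
      exact hvr v hv
    · have : (B q).card < (B v).card := by
        refine Finset.card_lt_card (Finset.ssubset_iff_of_subset ?_ |>.2 ⟨q, ?_, ?_⟩)
        · intro x hx
          simp only [B, Finset.mem_filter, Finset.mem_univ, true_and] at hx ⊢
          exact hx.trans hqv
        · simpa [B] using hqv
        · simp [B]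
      simp only [l, if_neg hv, if_neg hq]
      split_ifs <;> omega
  refine ⟨l, fun v hv => ?_⟩
  have hroot : Between p r u r v := by
    unfold Between
    simp
  obtain ⟨q, hq⟩ := hpar v hv
  rw [hq]
  by_cases hc : q ≠ v ∧ 0 ≤ s q r * s v q
  swap
  · have e : choice s r v q = r := if_neg hc
    rw [e]
    exact ⟨hvr v hv, hroot⟩
  have e : choice s r v q = q := if_pos hc
  rw [e]
  obtain ⟨hqv, hs⟩ := hc
  by_cases hqr : q = r
  · rw [hqr]
    exact ⟨hvr v hv, hroot⟩
  by_cases h0 : dirSign p u q r = 0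
  -- A point at the level of the root has sign zero and is offered to everybody. By general position
  -- no third point shares that level, so the child is strictly farther out.
  · have hv0 : dirSign p u q v ≠ 0 := hp.dirSign_ne_zero hu h0 hqr v hqv.symm hv
    have hcq : c q = 0 := by
      rw [dirSign_eq_zero] at h0
      exact sub_eq_zero.2 h0
    have hcv : c v ≠ 0 := fun e' => hv0 (by
      rw [dirSign_eq_zero]
      have h1 : coord u (p v) = coord u (p r) := sub_eq_zero.1 e'
      have h2 : coord u (p q) = coord u (p r) := sub_eq_zero.1 hcq
      rw [h1, h2])
    refine ⟨hlt q v hv ?_, ?_⟩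
    · rw [hcq, abs_zero]
      exact abs_pos.2 hcv
    · rw [between_iff, h0, zero_mul]
  rw [h.root q hqr] at hs
  by_cases ht : dirSign p u v q = 0
  · have hvq : dirSign p u v r = dirSign p u q r := dirSign_congr_left ht r
    have ht' : dirSign p u q v = 0 := by rw [dirSign_swap, ht, neg_zero]
    refine ⟨?_, by rw [between_iff, ht, mul_zero]⟩
    have hceq : c v = c q := by
      rw [dirSign_eq_zero] at ht
      change _ - _ = _ - _
      rw [ht]
    have hB : B v = B q := by simp only [B, hceq]
    have hlv : late v := ⟨q, hqv, ht, Or.inr (by rwa [h.root q hqr])⟩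
    -- A broken tie is antisymmetric and nonzero, so when `q` is offered to `v` the reverse offer
    -- fails. Hence `v` is late and `q` is not, which decides between equal counts.
    have hanti : s q v = -s v q ∧ s v q ≠ 0 := by
      rcases lt_or_gt_of_ne hqv with hl | hl
      · obtain ⟨t1, t2⟩ := h.tie q v hqr hv hl ht'
        rw [t2]
        refine ⟨by ring, ?_⟩
        rcases t1 with t1 | t1 <;> simp [t1]
      · obtain ⟨t1, t2⟩ := h.tie v q hv hqr hl ht
        refine ⟨t2, ?_⟩
        rcases t1 with t1 | t1 <;> simp [t1]
    have hlq : ¬ late q := by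
      rintro ⟨x, hx, hx0, hx'⟩
      have hxv : x = v := by
        by_contra hxv
        exact hp.dirSign_ne_zero hu ht' hqv x hx hxv hx0
      subst hxv
      rcases hx' with rfl | hx'
      · exact hv rfl
      · rw [h.root x hv, hvq, hanti.1] at hx'
        have : dirSign p u q r * s x q = 0 := by linarith
        rcases mul_eq_zero.1 this with h1 | h1
        · exact h0 h1
        · exact hanti.2 h1
    simp only [l, if_neg hv, if_neg hqr, if_pos hlv, if_neg hlq, hB]
    omega
  · rw [h.sep v q hv hqr ht] at hs
    have hb : Between p r u q v := between_iff.2 hs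
    refine ⟨hlt q v hv ?_, hb⟩
    unfold Between at hb
    rw [dirSign_eq_zero] at ht h0
    have h1 : coord u (p q) - coord u (p r) ≠ 0 := sub_ne_zero.2 h0
    have h2 : coord u (p v) - coord u (p q) ≠ 0 := sub_ne_zero.2 ht
    have h3 : 0 < (coord u (p q) - coord u (p r)) * (coord u (p v) - coord u (p q)) :=
      lt_of_le_of_ne hb (mul_ne_zero h1 h2).symm
    have h4 : 0 < (coord u (p v) - coord u (p q)) ^ 2 := by positivity
    change |coord u (p q) - coord u (p r)| < |coord u (p v) - coord u (p r)|
    rw [← sq_lt_sq]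
    nlinarith

/-- Each monotone tree is described by parents that some refinement of the signs offers. -/
theorem IsParent.exists_refines {p : V → Plane} {r : V} {u : Plane} (hp : GeneralPosition p)
    (hu : u ≠ 0) {par : V → V} (h : IsParent p r u par) (b : V → V → ℝ) :
    ∃ s, Refines r (dirSign p u) b Set.univ s ∧
      total p r s ≤ ∑ v ∈ Finset.univ.erase r, dist (p v) (p (par v)) := by
  classical
  have hne := h.ne_self
  obtain ⟨l, h⟩ := h
  -- A tie is broken so that the point with the smaller label counts as the one nearer to the root,
  -- with the order of the indices deciding between equal labels. Tied parents are then offered to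
  -- their children.
  let s : V → V → ℝ := fun a c =>
    if dirSign p u a c ≠ 0 then dirSign p u a c else if c = r then 0 else
      if l c < l a ∨ l c = l a ∧ c < a then dirSign p u a r else -dirSign p u a r
  have hr : ∀ a, s a r = dirSign p u a r := fun a => by
    simp only [s, if_true]
    split_ifs with e
    · rfl
    · exact (not_not.1 e).symm
  refine ⟨s, ⟨fun i _ => hr i, ?_, ?_, ?_⟩, ?_⟩
  · intro i j _ _ hg
    simp only [s, if_pos hg]
  · intro i j hi hj hij h0
    have h0' : dirSign p u j i = 0 := by rw [dirSign_swap, h0, neg_zero]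
    have hir : dirSign p u i r = 1 ∨ dirSign p u i r = -1 :=
      (dirSign_eq_or p u i r).resolve_left
        (hp.dirSign_ne_zero hu h0 hij.ne r hi.symm hj.symm)
    have hjr : dirSign p u j r = dirSign p u i r := (dirSign_congr_left h0 r).symm
    simp only [s, h0, h0', ne_eq, not_true, if_false, if_neg hi, if_neg hj, hjr]
    rcases lt_trichotomy (l i) (l j) with e | e | e
    · rw [if_neg (by omega), if_pos (by omega)]
      refine ⟨?_, by ring⟩
      rcases hir with e | e <;> simp [e]
    · rw [if_neg (by rintro (h' | ⟨-, h'⟩); omega; exact lt_asymm h' hij),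
        if_pos (Or.inr ⟨e, hij⟩)]
      refine ⟨?_, by ring⟩
      rcases hir with e | e <;> simp [e]
    · rw [if_pos (by omega), if_neg (by omega)]
      exact ⟨hir, by ring⟩
  · intro i j _ _ _ _ hq
    exact absurd (Set.mem_univ _) hq
  · rw [total_eq_erase]
    refine Finset.sum_le_sum fun v hv => ?_
    have hv := Finset.ne_of_mem_erase hv
    obtain ⟨h1, h2⟩ := h v hv
    by_cases hq : par v = r
    · rw [hq]
      exact near_le_star p r s v
    have e : choice s r v (par v) = par v := by
      refine if_pos ⟨hne v hv, ?_⟩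
      rw [hr]
      by_cases h0 : dirSign p u v (par v) = 0
      · simp only [s, h0, ne_eq, not_true, if_false, if_neg hq, if_pos (Or.inl h1)]
        rw [dirSign_congr_left h0 r]
        exact mul_self_nonneg _
      · simp only [s, ne_eq, h0, not_false_iff, if_true]
        exact between_iff.1 h2
    have := near_le p r s v (par v)
    rwa [e] at this

end Directions

/-! ### Event directions and the order of their inverse slopes -/

section Slopes

/-- A nonzero vector of the upper half-plane, or of its boundary half-line. -/
def Upper (x y : ℝ) : Prop := 0 < y ∨ y = 0 ∧ 0 < x

/-- Upper directions are ordered by their inverse slopes. -/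
noncomputable def invSlope (x y : ℝ) : WithTop ℝ := if y = 0 then ⊤ else ((x / y : ℝ) : WithTop ℝ)

/-- The order of slopes becomes a comparison of products, which the machine can evaluate without
division. -/
theorem invSlope_lt_invSlope {x y x' y' : ℝ} (h : Upper x y) (h' : Upper x' y') :
    invSlope x y < invSlope x' y' ↔ x * y' < y * x' := by
  unfold invSlope
  rcases h with h | ⟨rfl, h⟩ <;> rcases h' with h' | ⟨rfl, h'⟩
  · rw [if_neg h.ne', if_neg h'.ne', WithTop.coe_lt_coe, div_lt_div_iff₀ h h', mul_comm y]
  · simp [h.ne', h, h']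
  · simp only [if_true, not_top_lt, zero_mul, false_iff, not_lt]
    positivity
  · simp

variable {V : Type*}

/-- The sign of the difference of the coordinates of `p i` and `p j` in the upper directions
before the one in which these coordinates are equal. -/
noncomputable def sg (p : V → Plane) (i j : V) : ℝ :=
  if p i 0 < p j 0 ∨ ¬ p j 0 < p i 0 ∧ p j 1 < p i 1 then 1 else -1

/-- The upper direction in which the coordinates of `p i` and `p j` are equal. -/
noncomputable def evX (p : V → Plane) (i j : V) : ℝ := sg p i j * (p i 1 - p j 1)

/-- The second component of this direction. -/
noncomputable def evY (p : V → Plane) (i j : V) : ℝ := sg p i j * (p j 0 - p i 0)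

theorem sg_eq (p : V → Plane) (i j : V) : sg p i j = 1 ∨ sg p i j = -1 := by
  unfold sg
  split_ifs <;> simp

theorem plane_ext {a b : Plane} (h0 : a 0 = b 0) (h1 : a 1 = b 1) : a = b := by
  ext i
  fin_cases i
  · exact h0
  · exact h1

theorem sg_swap {p : V → Plane} (hp : Function.Injective p) {i j : V} (h : i ≠ j) :
    sg p j i = -sg p i j := by
  have hne : ¬ (p i 0 = p j 0 ∧ p i 1 = p j 1) := fun e => h (hp (plane_ext e.1 e.2))
  unfold sg
  rcases lt_trichotomy (p i 0) (p j 0) with e | e | e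
  · simp [e, not_lt_of_gt]
  · have e' : p i 1 ≠ p j 1 := fun e' => hne ⟨e, e'⟩
    rcases lt_or_gt_of_ne e' with e' | e' <;> simp [e, e', not_lt_of_gt]
  · simp [e, not_lt_of_gt]

theorem ev_swap {p : V → Plane} (hp : Function.Injective p) {i j : V} (h : i ≠ j) :
    evX p j i = evX p i j ∧ evY p j i = evY p i j := by
  unfold evX evY
  rw [sg_swap hp h]
  constructor <;> ring

theorem ev_upper {p : V → Plane} (hp : Function.Injective p) {i j : V} (h : i ≠ j) :
    Upper (evX p i j) (evY p i j) := by
  have hne : ¬ (p i 0 = p j 0 ∧ p i 1 = p j 1) := fun e => h (hp (plane_ext e.1 e.2))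
  unfold evX evY sg Upper
  rcases lt_trichotomy (p i 0) (p j 0) with e | e | e
  · simp [e]
  · have e' : p i 1 ≠ p j 1 := fun e' => hne ⟨e, e'⟩
    rcases lt_or_gt_of_ne e' with e' | e' <;> simp [e, e', not_lt_of_gt]
  · simp [e, not_lt_of_gt]

/-- The event direction is `p i - p j` turned by a right angle, with the sign that puts it in the
upper half-plane. Its cross product with `u` is therefore, up to `sg`, the difference of the
coordinates: the sign is `sg` before the event, zero at it and `-sg` after it. -/
theorem dirSign_of_upper {p : V → Plane} (hp : Function.Injective p) {u : Plane}
    (hu : Upper (u 0) (u 1)) {i j : V} (h : i ≠ j) :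
    dirSign p u i j =
      if invSlope (u 0) (u 1) < invSlope (evX p i j) (evY p i j) then sg p i j
      else if invSlope (evX p i j) (evY p i j) < invSlope (u 0) (u 1) then -sg p i j else 0 := by
  simp only [invSlope_lt_invSlope hu (ev_upper hp h), invSlope_lt_invSlope (ev_upper hp h) hu]
  unfold dirSign evX evY
  rw [coord_eq, coord_eq]
  rcases sg_eq p i j with e | e <;> rw [e]
  · split_ifs with h1 h2
    · rw [Real.sign_of_pos (by linarith)]
    · rw [Real.sign_of_neg (by linarith)]
    · rw [Real.sign_eq_zero_iff]
      linarith
  · split_ifs with h1 h2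
    · rw [Real.sign_of_neg (by linarith)]
    · rw [Real.sign_of_pos (by linarith), neg_neg]
    · rw [Real.sign_eq_zero_iff]
      linarith

theorem dirSign_congr {p : V → Plane} (hp : Function.Injective p) {u u' : Plane}
    (hu : Upper (u 0) (u 1)) (hu' : Upper (u' 0) (u' 1))
    (h : invSlope (u 0) (u 1) = invSlope (u' 0) (u' 1)) : dirSign p u = dirSign p u' := by
  funext i j
  by_cases hij : i = j
  · subst hij
    rw [dirSign_eq_zero.2 rfl, dirSign_eq_zero.2 rfl]
  · rw [dirSign_of_upper hp hu hij, dirSign_of_upper hp hu' hij, h]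

/-- The direction of the event of the pair `i`, `j`. -/
noncomputable def evDir (p : V → Plane) (i j : V) : Plane := !₂[evX p i j, evY p i j]

theorem Upper.ne_zero {u : Plane} (hu : Upper (u 0) (u 1)) : u ≠ 0 := by
  rintro rfl
  simp [Upper] at hu

theorem upper_or_neg {u : Plane} (hu : u ≠ 0) :
    Upper (u 0) (u 1) ∨ Upper ((-u) 0) ((-u) 1) := by
  have hne : ¬ (u 0 = 0 ∧ u 1 = 0) := fun e =>
    hu (plane_ext (by simpa using e.1) (by simpa using e.2))
  unfold Upper
  simp only [PiLp.neg_apply, Left.neg_pos_iff, neg_eq_zero]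
  rcases lt_trichotomy (u 1) 0 with h | h | h
  · simp [h]
  · rcases lt_trichotomy (u 0) 0 with h' | h' | h'
    · simp [h, h']
    · exact absurd ⟨h', h⟩ hne
    · simp [h, h']
  · simp [h]

theorem IsParent.neg {p : V → Plane} {r : V} {u : Plane} {par : V → V} (h : IsParent p r u par) :
    IsParent p r (-u) par := by
  obtain ⟨l, h⟩ := h
  refine ⟨l, fun v hv => ⟨(h v hv).1, ?_⟩⟩
  have := (h v hv).2
  unfold Between coord at *
  simp only [inner_neg_left]
  linarith

/-- Betweenness is a weak inequality between signs, so it survives when some of the signs become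
zero. -/
theorem IsParent.of_dirSign {p : V → Plane} {r : V} {u u' : Plane} {par : V → V}
    (h : IsParent p r u par)
    (hu : ∀ i j, dirSign p u' i j = 0 ∨ dirSign p u' i j = dirSign p u i j) :
    IsParent p r u' par := by
  obtain ⟨l, h⟩ := h
  refine ⟨l, fun v hv => ⟨(h v hv).1, ?_⟩⟩
  have := (h v hv).2
  rw [between_iff] at this ⊢
  rcases hu (par v) r with e | e
  · rw [e, zero_mul]
  rcases hu v (par v) with e' | e'
  · rw [e', mul_zero]
  rwa [e, e']

/-- A direction of monotonicity can be moved to the direction of an event. -/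
theorem IsParent.exists_evDir [Finite V] {p : V → Plane} (hp : Function.Injective p) {r : V}
    {u : Plane} (hu : u ≠ 0) {par : V → V} (h : IsParent p r u par) {a b : V} (hab : a ≠ b) :
    ∃ i j, i ≠ j ∧ IsParent p r (evDir p i j) par := by
  wlog hup : Upper (u 0) (u 1) generalizing u
  · exact this (neg_ne_zero.2 hu) h.neg ((upper_or_neg hu).resolve_left hup)
  let f : V × V → WithTop ℝ := fun e => invSlope (evX p e.1 e.2) (evY p e.1 e.2)
  have key : ∀ i j, i ≠ j → (∀ k l, k ≠ l → f (i, j) ≠ f (k, l) →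
      (f (i, j) < f (k, l) ↔ invSlope (u 0) (u 1) < f (k, l)) ∧
      (f (k, l) < f (i, j) ↔ f (k, l) < invSlope (u 0) (u 1))) →
      IsParent p r (evDir p i j) par := fun i j hij hf => by
    refine h.of_dirSign fun k l => ?_
    by_cases hkl : k = l
    · subst hkl
      left
      rw [dirSign_eq_zero]
    · have hup' : Upper ((evDir p i j) 0) ((evDir p i j) 1) := ev_upper hp hij
      rw [dirSign_of_upper hp hup hkl, dirSign_of_upper hp hup' hkl]
      change (if f (i, j) < f (k, l) then _ else if f (k, l) < f (i, j) then _ else _) = (0 : ℝ) ∨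
        (if f (i, j) < f (k, l) then _ else if f (k, l) < f (i, j) then _ else _) =
          if invSlope (u 0) (u 1) < f (k, l) then _
          else if f (k, l) < invSlope (u 0) (u 1) then _ else _
      by_cases e : f (i, j) = f (k, l)
      · left
        rw [e, if_neg (lt_irrefl _), if_neg (lt_irrefl _)]
      · right
        obtain ⟨h1, h2⟩ := hf k l hkl e
        simp only [h1, h2]
  -- Rotate forward to the first event at or after `u`; if there is none, rotate back to the last
  -- event. No pair reverses its order strictly on the way.
  by_cases hex : ∃ e : V × V, e.1 ≠ e.2 ∧ invSlope (u 0) (u 1) ≤ f e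
  · obtain ⟨e, ⟨he, he'⟩, hmin⟩ := Set.exists_min_image
      {e : V × V | e.1 ≠ e.2 ∧ invSlope (u 0) (u 1) ≤ f e} f (Set.toFinite _) hex
    refine ⟨e.1, e.2, he, key _ _ he fun k l hkl hne => ⟨⟨fun h1 => he'.trans_lt h1, fun h1 =>
      lt_of_le_of_ne (hmin (k, l) ⟨hkl, h1.le⟩) hne⟩, ⟨fun h1 => ?_, fun h1 => h1.trans_le he'⟩⟩⟩
    by_contra! h2
    exact absurd (hmin (k, l) ⟨hkl, h2⟩) (not_le_of_gt h1)
  · push Not at hex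
    obtain ⟨e, he, hmax⟩ := Set.exists_max_image
      {e : V × V | e.1 ≠ e.2} f (Set.toFinite _) ⟨(a, b), hab⟩
    refine ⟨e.1, e.2, he, key _ _ he fun k l hkl hne => ⟨⟨fun h1 => ?_, fun h1 => ?_⟩,
      ⟨fun _ => hex (k, l) hkl, fun _ => lt_of_le_of_ne (hmax (k, l) hkl) hne.symm⟩⟩⟩
    · exact absurd (hmax (k, l) hkl) (not_le_of_gt h1)
    · exact absurd (hex (k, l) hkl) (lt_asymm h1)

end Slopes

end Geo

/-! ### Program logic with time bounds, and tournament trees -/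

namespace RealRAM

/-- `Ends P s k Q`: started in `s`, the program `P` halts within `k` units of time in a state with
the property `Q`. -/
def Ends (P : Prog) (s : State) (k : ℕ) (Q : State → Prop) : Prop :=
  ∃ t s', Exec P s t s' ∧ t ≤ k ∧ Q s'

/-- Sequential composition of a list of programs. -/
def Prog.block : List Prog → Prog
  | [] => .skip
  | P :: l => .seq P (Prog.block l)

/-- The loop in which register `x` runs through the numbers below a bound. -/
def Prog.forN (x : ℕ) (bound : NExp) (body : Prog) : Prog :=
  .seq (.setN x (.lit 0))
    (.while (.nlt (.reg x) bound) (.seq body (.setN x (.add (.reg x) (.lit 1)))))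

theorem Ends.mono {P : Prog} {s : State} {k k' : ℕ} {Q Q' : State → Prop} (h : Ends P s k Q)
    (hk : k ≤ k') (hQ : ∀ s', Q s' → Q' s') : Ends P s k' Q' := by
  obtain ⟨t, s', h1, h2, h3⟩ := h
  exact ⟨t, s', h1, h2.trans hk, hQ _ h3⟩

theorem Ends.within {P : Prog} {s : State} {k k' : ℕ} {Q : State → Prop} (h : Ends P s k Q)
    (hk : k ≤ k') : Ends P s k' Q := h.mono hk fun _ => id

theorem Ends.imp {P : Prog} {s : State} {k : ℕ} {Q Q' : State → Prop} (h : Ends P s k Q)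
    (hQ : ∀ s', Q s' → Q' s') : Ends P s k Q' := h.mono le_rfl hQ

theorem Ends.nil {s : State} {Q : State → Prop} (h : Q s) : Ends (.block []) s 1 Q :=
  ⟨_, _, .skip s, le_rfl, h⟩

theorem Ends.seq {P P' : Prog} {s : State} {k k' : ℕ} {Q : State → Prop}
    (h : Ends P s k fun s' => Ends P' s' k' Q) : Ends (.seq P P') s (k + k') Q := by
  obtain ⟨t, s', h1, h2, t', s'', h3, h4, h5⟩ := h
  exact ⟨_, _, .seq h1 h3, by omega, h5⟩

theorem Ends.cons {P : Prog} {l : List Prog} {s : State} {k k' : ℕ} {Q : State → Prop}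
    (h : Ends P s k fun s' => Ends (.block l) s' k' Q) : Ends (.block (P :: l)) s (k + k') Q :=
  Ends.seq h

theorem Ends.skip {s : State} {Q : State → Prop} (h : Q s) : Ends .skip s 1 Q :=
  ⟨_, _, .skip s, le_rfl, h⟩

theorem Ends.setN {s : State} {x : ℕ} {e : NExp} {Q : State → Prop}
    (h : Q { s with nreg := Function.update s.nreg x (e.eval s) }) :
    Ends (.setN x e) s (e.time + 1) Q := ⟨_, _, .setN s x e, le_rfl, h⟩

theorem Ends.setR {s : State} {x : ℕ} {e : RExp} {Q : State → Prop}
    (h : Q { s with rreg := Function.update s.rreg x (e.eval s) }) :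
    Ends (.setR x e) s (e.time + 1) Q := ⟨_, _, .setR s x e, le_rfl, h⟩

theorem Ends.putN {s : State} {a : ℕ} {i e : NExp} {Q : State → Prop}
    (h : Q { s with narr := Function.update s.narr a
                      (Function.update (s.narr a) (i.eval s) (e.eval s)) }) :
    Ends (.putN a i e) s (i.time + e.time + 1) Q := ⟨_, _, .putN s a i e, le_rfl, h⟩

theorem Ends.putR {s : State} {a : ℕ} {i : NExp} {e : RExp} {Q : State → Prop}
    (h : Q { s with rarr := Function.update s.rarr a
                      (Function.update (s.rarr a) (i.eval s) (e.eval s)) }) :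
    Ends (.putR a i e) s (i.time + e.time + 1) Q := ⟨_, _, .putR s a i e, le_rfl, h⟩

theorem Ends.ite {b : Test} {P P' : Prog} {s : State} {k k' : ℕ} {Q : State → Prop}
    (h : b.Holds s → Ends P s k Q) (h' : ¬ b.Holds s → Ends P' s k' Q) :
    Ends (.ite b P P') s (b.time + 1 + (k + k')) Q := by
  by_cases hb : b.Holds s
  · obtain ⟨t, s', h1, h2, h3⟩ := h hb
    exact ⟨_, _, .iteTrue hb h1, by omega, h3⟩
  · obtain ⟨t, s', h1, h2, h3⟩ := h' hb
    exact ⟨_, _, .iteFalse hb h1, by omega, h3⟩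

theorem Ends.ite_pos {b : Test} {P P' : Prog} {s : State} {k : ℕ} {Q : State → Prop}
    (hb : b.Holds s) (h : Ends P s k Q) : Ends (.ite b P P') s (b.time + 1 + k) Q := by
  obtain ⟨t, s', h1, h2, h3⟩ := h
  exact ⟨_, _, .iteTrue hb h1, by omega, h3⟩

theorem Ends.ite_neg {b : Test} {P P' : Prog} {s : State} {k : ℕ} {Q : State → Prop}
    (hb : ¬ b.Holds s) (h : Ends P' s k Q) : Ends (.ite b P P') s (b.time + 1 + k) Q := by
  obtain ⟨t, s', h1, h2, h3⟩ := h
  exact ⟨_, _, .iteFalse hb h1, by omega, h3⟩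

/-- A loop with an invariant that bounds the remaining time. -/
theorem Ends.while {b : Test} {P : Prog} (Inv : ℕ → State → Prop)
    (step : ∀ k s, Inv k s → b.Holds s →
      ∃ t k', b.time + 1 + t + k' ≤ k ∧ Ends P s t (Inv k')) :
    ∀ k s, Inv k s →
      Ends (.while b P) s (k + (b.time + 1)) fun s' => (∃ k', Inv k' s') ∧ ¬ b.Holds s' := by
  intro k
  induction k using Nat.strong_induction_on with
  | _ k ih =>
    intro s hs
    by_cases hb : b.Holds s
    · obtain ⟨t, k', hk, t1, s1, e1, ht, hi⟩ := step k s hs hb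
      obtain ⟨t2, s2, e2, ht2, hq⟩ := ih k' (by omega) s1 hi
      exact ⟨_, _, .whileTrue hb e1 e2, by omega, hq⟩
    · exact ⟨_, _, .whileFalse hb, by omega, ⟨k, hs⟩, hb⟩

theorem Ends.forN {x : ℕ} {bound : NExp} {body : Prog} {s : State} {m tb : ℕ}
    (Inv : ℕ → State → Prop)
    (h0 : Inv 0 { s with nreg := Function.update s.nreg x 0 })
    (hbound : ∀ k s, Inv k s → bound.eval s = m)
    (step : ∀ k s, k < m → Inv k s → s.nreg x = k → Ends body s tb fun s' =>
      s'.nreg x = k ∧ Inv (k + 1) { s' with nreg := Function.update s'.nreg x (k + 1) }) :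
    Ends (.forN x bound body) s ((m + 1) * (tb + bound.time + 8)) (Inv m) := by
  have key := Ends.while (b := .nlt (.reg x) bound)
    (P := .seq body (.setN x (.add (.reg x) (.lit 1))))
    -- The invariant of the `while` loop carries the time left for the remaining `m - k` rounds.
    (fun T s => ∃ k, k ≤ m ∧ T = (m - k) * (tb + bound.time + 8) ∧ s.nreg x = k ∧ Inv k s) ?_
    (m * (tb + bound.time + 8)) _ ⟨0, by omega, by simp, by simp, h0⟩
  · refine (Ends.seq (Ends.setN (key.imp ?_))).within ?_
    · rintro s' ⟨⟨T, k, hk, -, hx, hI⟩, hb⟩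
      simp only [Test.Holds, NExp.eval, hbound k s' hI, hx, not_lt] at hb
      obtain rfl : k = m := by omega
      exact hI
    · simp only [NExp.time, Test.time]
      nlinarith
  · rintro T s ⟨k, hk, rfl, hx, hI⟩ hb
    simp only [Test.Holds, NExp.eval, hbound k s hI, hx] at hb
    refine ⟨tb + 4, (m - (k + 1)) * (tb + bound.time + 8), ?_,
      (Ends.seq ((step k s hb hI hx).imp ?_)).within (k := tb + 4) le_rfl⟩
    · obtain ⟨d, hd⟩ : ∃ d, m - k = d + 1 := ⟨m - k - 1, by omega⟩
      have hd' : m - (k + 1) = d := by omega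
      rw [hd, hd']
      simp only [NExp.time, Test.time]
      nlinarith
    · rintro s' ⟨hx', hI'⟩
      refine Ends.setN ⟨k + 1, hb, rfl, ?_, ?_⟩
      · simp [NExp.eval, hx']
      · simpa [NExp.eval, hx'] using hI'

/-! Tournament trees. -/

/-- The comparison of the keys of two items: first the slopes, then the ranks. -/
def State.Before (s : State) (a b : ℕ) : Prop :=
  s.rarr 2 a * s.rarr 3 b < s.rarr 3 a * s.rarr 2 b ∨
    ¬ s.rarr 2 b * s.rarr 3 a < s.rarr 3 b * s.rarr 2 a ∧ s.narr 5 a < s.narr 5 b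

/-- The test for this comparison. -/
def beforeTest (a b : NExp) : Test :=
  .neg (.conj (.neg (.rlt (.mul (.get 2 a) (.get 3 b)) (.mul (.get 3 a) (.get 2 b))))
    (.neg (.conj (.neg (.rlt (.mul (.get 2 b) (.get 3 a)) (.mul (.get 3 b) (.get 2 a))))
      (.nlt (.get 5 a) (.get 5 b)))))

theorem beforeTest_holds (s : State) (a b : NExp) :
    (beforeTest a b).Holds s ↔ s.Before (a.eval s) (b.eval s) := by
  simp only [beforeTest, Test.Holds, RExp.eval, NExp.eval, State.Before]
  tauto

/-- In the cells `b + 1, …` of `T`, a binary tree with `m` leaves `b + m, …, b + 2 m - 1` is stored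
in which each inner node holds the smaller one of the items at its children. -/
def IsTournament (lt : ℕ → ℕ → Prop) (T : ℕ → ℕ) (b m : ℕ) (except : ℕ) : Prop :=
  ∀ k, 1 ≤ k → k < m → k ≠ except →
    lt (T (b + (k + k) + 1)) (T (b + (k + k))) ∧ T (b + k) = T (b + (k + k) + 1) ∨
      ¬ lt (T (b + (k + k) + 1)) (T (b + (k + k))) ∧ T (b + k) = T (b + (k + k))

/-- Recomputation of the inner nodes above a node of a tournament tree. -/
def repair : Prog :=
  .while (.nlt (.lit 1) (.reg 41))
    (.seq (.setN 41 (.get 1 (.reg 41)))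
      (.ite (beforeTest (.get 3 (.add (.add (.reg 40) (.add (.reg 41) (.reg 41))) (.lit 1)))
          (.get 3 (.add (.reg 40) (.add (.reg 41) (.reg 41)))))
        (.putN 3 (.add (.reg 40) (.reg 41))
          (.get 3 (.add (.add (.reg 40) (.add (.reg 41) (.reg 41))) (.lit 1))))
        (.putN 3 (.add (.reg 40) (.reg 41))
          (.get 3 (.add (.reg 40) (.add (.reg 41) (.reg 41)))))))

/-- Replacement of the item at the node `reg 41` of the tree with base `reg 40` by `reg 42`. -/
def update : Prog :=
  .seq (.putN 3 (.add (.reg 40) (.reg 41)) (.reg 42)) repair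

/-- Once node `i` is consistent with its children, only its parent `i / 2` can be wrong. At the top
the exception becomes 0, which is no node. -/
theorem IsTournament.set_node {lt : ℕ → ℕ → Prop} {T : ℕ → ℕ} {b m i v : ℕ} (hi : 1 ≤ i)
    (h : IsTournament lt T b m i)
    (hv : i < m → lt (T (b + (i + i) + 1)) (T (b + (i + i))) ∧ v = T (b + (i + i) + 1) ∨
      ¬ lt (T (b + (i + i) + 1)) (T (b + (i + i))) ∧ v = T (b + (i + i))) :
    IsTournament lt (Function.update T (b + i) v) b m (i / 2) := by
  intro k hk hkm hki
  have h1 : b + (k + k) + 1 ≠ b + i := by omega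
  have h2 : b + (k + k) ≠ b + i := by omega
  rw [Function.update_of_ne h1, Function.update_of_ne h2]
  by_cases e : k = i
  · subst e
    rw [Function.update_self]
    exact hv hkm
  · have h3 : b + k ≠ b + i := by omega
    rw [Function.update_of_ne h3]
    exact h k hk hkm e

/-- Each round halves the node number, so a node below `2 ^ (L + 1)` needs at most `L` rounds. The
halves are read from a table because index arithmetic has no division. -/
theorem repair_ends {lt : ℕ → ℕ → Prop} {b m : ℕ} (L : ℕ) : ∀ (s : State) (i : ℕ),
    s.nreg 40 = b → s.nreg 41 = i → 1 ≤ i → i < 2 ^ (L + 1) → i < 2 * m →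
    (∀ k < 2 * m, s.narr 1 k = k / 2) → (∀ x y, s.Before x y ↔ lt x y) →
    IsTournament lt (s.narr 3) b m (i / 2) →
    Ends repair s (200 * (L + 1)) fun s' => ∃ nr T,
      s' = { s with nreg := nr, narr := Function.update s.narr 3 T } ∧
      (∀ x, x ≠ 41 → nr x = s.nreg x) ∧ IsTournament lt T b m 0 ∧
      ∀ x, x < b + 1 ∨ b + m ≤ x → T x = s.narr 3 x := by
  induction L with
  | zero =>
    intro s i hb hi h1 h2 hm hH hlt hT
    obtain rfl : i = 1 := by omega
    refine ⟨_, _, .whileFalse (by simp [Test.Holds, NExp.eval, hi]), by simp [Test.time, NExp.time],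
      s.nreg, s.narr 3, ?_, fun _ _ => rfl, hT, fun _ _ => rfl⟩
    simp
  | succ L ih =>
    intro s i hb hi h1 h2 hm hH hlt hT
    by_cases hi1 : i = 1
    · subst hi1
      refine ⟨_, _, .whileFalse (by simp [Test.Holds, NExp.eval, hi]),
        by simp [Test.time, NExp.time]; omega, s.nreg, s.narr 3, ?_, fun _ _ => rfl, hT,
        fun _ _ => rfl⟩
      simp
    have hj : i / 2 < m := by omega
    have hstep : ∀ v, (lt (s.narr 3 (b + (i / 2 + i / 2) + 1)) (s.narr 3 (b + (i / 2 + i / 2))) ∧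
        v = s.narr 3 (b + (i / 2 + i / 2) + 1) ∨
        ¬ lt (s.narr 3 (b + (i / 2 + i / 2) + 1)) (s.narr 3 (b + (i / 2 + i / 2))) ∧
        v = s.narr 3 (b + (i / 2 + i / 2))) →
        Ends repair { s with
          nreg := Function.update s.nreg 41 (i / 2)
          narr := Function.update s.narr 3 (Function.update (s.narr 3) (b + i / 2) v) }
        (200 * (L + 1)) fun s' => ∃ nr T,
          s' = { s with nreg := nr, narr := Function.update s.narr 3 T } ∧
          (∀ x, x ≠ 41 → nr x = s.nreg x) ∧ IsTournament lt T b m 0 ∧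
          ∀ x, x < b + 1 ∨ b + m ≤ x → T x = s.narr 3 x := fun v hv => by
      refine (ih _ (i / 2) ?_ ?_ (by omega) (by omega) (by omega) ?_ ?_ ?_).imp ?_
      · simpa using hb
      · simp
      · simpa using hH
      · simpa [State.Before] using hlt
      · simpa using hT.set_node (by omega) fun _ => hv
      · rintro s' ⟨nr, T, rfl, h3, h4, h5⟩
        refine ⟨nr, T, by simp, fun x hx => ?_, h4, fun x hx => ?_⟩
        · rw [h3 x hx]
          simp [hx]
        · rw [h5 x hx]
          have : x ≠ b + i / 2 := by omega
          simp [this]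
    have h41 : s.narr 1 i = i / 2 := hH i hm
    have hbody : Ends (.seq (.setN 41 (.get 1 (.reg 41)))
      (.ite (beforeTest (.get 3 (.add (.add (.reg 40) (.add (.reg 41) (.reg 41))) (.lit 1)))
          (.get 3 (.add (.reg 40) (.add (.reg 41) (.reg 41)))))
        (.putN 3 (.add (.reg 40) (.reg 41))
          (.get 3 (.add (.add (.reg 40) (.add (.reg 41) (.reg 41))) (.lit 1))))
        (.putN 3 (.add (.reg 40) (.reg 41))
          (.get 3 (.add (.reg 40) (.add (.reg 41) (.reg 41))))))) s 190 fun s' =>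
        Ends repair s' (200 * (L + 1)) fun s' => ∃ nr T,
          s' = { s with nreg := nr, narr := Function.update s.narr 3 T } ∧
          (∀ x, x ≠ 41 → nr x = s.nreg x) ∧ IsTournament lt T b m 0 ∧
          ∀ x, x < b + 1 ∨ b + m ≤ x → T x = s.narr 3 x := by
      refine (Ends.seq (Ends.setN (Ends.ite (fun hc => Ends.putN ?_)
        (fun hc => Ends.putN ?_)))).within ?_
      · rw [beforeTest_holds] at hc
        simp only [NExp.eval, hi, hb, h41, Function.update_self, State.Before,
          Function.update_of_ne (show (40 : ℕ) ≠ 41 by decide)] at hc ⊢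
        exact hstep _ (Or.inl ⟨(hlt _ _).1 hc, rfl⟩)
      · rw [beforeTest_holds] at hc
        simp only [NExp.eval, hi, hb, h41, Function.update_self, State.Before,
          Function.update_of_ne (show (40 : ℕ) ≠ 41 by decide)] at hc ⊢
        exact hstep _ (Or.inr ⟨fun h => hc ((hlt _ _).2 h), rfl⟩)
      · simp [beforeTest, NExp.time, RExp.time, Test.time]
    obtain ⟨t1, s1, e1, ht1, t2, s2, e2, ht2, hq⟩ := hbody
    refine ⟨_, _, .whileTrue (by simp [Test.Holds, NExp.eval, hi]; omega) e1 e2, ?_, hq⟩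
    simp only [Test.time, NExp.time]
    omega

theorem update_ends {lt : ℕ → ℕ → Prop} {b m i v L : ℕ} {s : State} (hb : s.nreg 40 = b)
    (hi : s.nreg 41 = i) (hv : s.nreg 42 = v) (hm : m ≤ i) (hm' : i < 2 * m)
    (hL : i < 2 ^ (L + 1)) (hH : ∀ k < 2 * m, s.narr 1 k = k / 2)
    (hlt : ∀ x y, s.Before x y ↔ lt x y) (hT : IsTournament lt (s.narr 3) b m 0) :
    Ends update s (200 * (L + 1) + 10) fun s' => ∃ nr T,
      s' = { s with nreg := nr, narr := Function.update s.narr 3 T } ∧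
      (∀ x, x ≠ 41 → nr x = s.nreg x) ∧ IsTournament lt T b m 0 ∧ T (b + i) = v ∧
      ∀ x, x < b + 1 ∨ b + m ≤ x → x ≠ b + i → T x = s.narr 3 x := by
  refine (Ends.seq (Ends.putN ((repair_ends (lt := lt) (b := b) (m := m) L _ i ?_ ?_ (by omega) hL
    hm' ?_ ?_ ?_).imp ?_))).within ?_
  · simpa using hb
  · simpa using hi
  · simpa using hH
  · simpa [State.Before] using hlt
  · simp only [NExp.eval, Function.update_self, hb, hi, hv]
    refine IsTournament.set_node (by omega) (fun k h1 h2 h3 => hT k h1 h2 (by omega)) fun h => ?_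
    omega
  · rintro s' ⟨nr, T, rfl, h3, h4, h5⟩
    refine ⟨nr, T, by simp, h3, h4, ?_, fun x hx hxi => ?_⟩
    · rw [h5 _ (by omega)]
      simp [NExp.eval, hb, hi, hv]
    · rw [h5 x hx]
      simp [NExp.eval, hb, hi, hxi]
  · simp only [NExp.time]
    omega

/-- Every inner node copies the item of one of its children, so following the copied items downward
ends at a leaf. -/
theorem IsTournament.exists_leaf {lt : ℕ → ℕ → Prop} {T : ℕ → ℕ} {b m : ℕ}
    (h : IsTournament lt T b m 0) (d : ℕ) : ∀ k, 1 ≤ k → k < 2 * m → 2 * m - k ≤ d →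
    ∃ j, m ≤ j ∧ j < 2 * m ∧ T (b + k) = T (b + j) := by
  induction d with
  | zero => intro k h1 h2 h3; omega
  | succ d ih =>
    intro k h1 h2 h3
    by_cases hk : m ≤ k
    · exact ⟨k, hk, h2, rfl⟩
    · rcases h k h1 (by omega) (by omega) with ⟨-, e⟩ | ⟨-, e⟩
      · obtain ⟨j, a1, a2, a3⟩ := ih (k + k + 1) (by omega) (by omega) (by omega)
        exact ⟨j, a1, a2, e.trans a3⟩
      · obtain ⟨j, a1, a2, a3⟩ := ih (k + k) (by omega) (by omega) (by omega)
        exact ⟨j, a1, a2, e.trans a3⟩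

/-- The item at the root of a tournament tree is the least one, if keys compare consistently. -/
theorem IsTournament.root_le {α : Type*} [LinearOrder α] {lt : ℕ → ℕ → Prop} {T : ℕ → ℕ} {b m : ℕ}
    (h : IsTournament lt T b m 0) (key : ℕ → α) (ok : ℕ → Prop)
    (hkey : ∀ x y, ok x → ok y → (lt x y ↔ key x < key y))
    (hok : ∀ j, m ≤ j → j < 2 * m → ok (T (b + j))) (k : ℕ) (hk : 1 ≤ k) (hk' : k < 2 * m) :
    key (T (b + 1)) ≤ key (T (b + k)) := by
  have hok' : ∀ k, 1 ≤ k → k < 2 * m → ok (T (b + k)) := fun k h1 h2 => by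
    obtain ⟨j, a1, a2, a3⟩ := h.exists_leaf _ k h1 h2 le_rfl
    rw [a3]
    exact hok j a1 a2
  induction k using Nat.strong_induction_on with
  | _ k ih =>
    by_cases h1 : k = 1
    · rw [h1]
    refine (ih (k / 2) (by omega) (by omega) (by omega)).trans ?_
    have hl := hok' (k / 2 + k / 2) (by omega) (by omega)
    have hr := hok' (k / 2 + k / 2 + 1) (by omega) (by omega)
    have hc := hkey _ _ hr hl
    have e := h (k / 2) (by omega) (by omega) (by omega)
    rw [add_assoc] at e
    rw [hc] at e
    rcases Nat.mod_two_eq_zero_or_one k with hmod | hmod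
    · have : k = k / 2 + k / 2 := by omega
      rcases e with ⟨e1, e2⟩ | ⟨e1, e2⟩
      · rw [e2]
        conv_rhs => rw [this]
        exact e1.le
      · rw [e2]
        conv_rhs => rw [this]
    · have : k = k / 2 + k / 2 + 1 := by omega
      rcases e with ⟨e1, e2⟩ | ⟨e1, e2⟩
      · rw [e2]
        conv_rhs => rw [this]
      · rw [e2]
        conv_rhs => rw [this]
        exact not_lt.1 e1

end RealRAM

/-! ### Memory layout and the recomputation of one candidate -/

namespace RealRAM

open Geo

variable {n : ℕ}

/-- The index of the pair `i`, `j` in an array of pairs. -/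
def cell (i j : Fin n) : ℕ := (i : ℕ) * n + j

theorem mul_add_le_of_lt {a b : ℕ} (m : ℕ) (h : a < b) : a * m + m ≤ b * m := by
  have := Nat.mul_le_mul_right m h
  rwa [Nat.succ_mul] at this

theorem cell_lt (i j : Fin n) : cell i j < n * n := by
  have := mul_add_le_of_lt n i.2
  have := j.2
  unfold cell
  omega

theorem cell_inj {i j i' j' : Fin n} : cell i j = cell i' j' ↔ i = i' ∧ j = j' := by
  refine ⟨fun h => ?_, fun h => by rw [h.1, h.2]⟩
  unfold cell at h
  have := j.2
  have := j'.2
  rcases lt_trichotomy (i : ℕ) i' with e | e | e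
  · have := mul_add_le_of_lt n e
    omega
  · rw [e] at h
    exact ⟨Fin.ext e, Fin.ext (by omega)⟩
  · have := mul_add_le_of_lt n e
    omega

/-- The pairs that give an event of the sweep: a pair `r, j` (the point `j` reaches the level of
the root), `i, r` (the point `i` leaves it), or a pair `i < j` of other points. -/
def IsEvent (r i j : Fin n) : Prop := i ≠ j ∧ (i = r ∨ j = r ∨ i < j)

/-- The position of an event among the events with the same direction. -/
def evRank (r i j : Fin n) : ℕ := if i = r then 0 else if j = r then 2 else 1

/-- The part of the memory that does not change during the sweep. -/
structure Const (p : Fin n → Plane) (r : Fin n) (s : State) : Prop where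
  size : s.nreg 0 = n
  root : s.nreg 1 = r
  sq : s.nreg 2 = n * n
  row : ∀ i : Fin n, s.narr 2 i = i * n
  half : ∀ k < 2 * (n * n), s.narr 1 k = k / 2
  distX : ∀ i j, s.rarr 2 (cell i j) = dist (p i) (p j)
  distY : ∀ i j : Fin n, s.rarr 3 (cell i j) = 1
  distT : ∀ i j : Fin n, s.narr 5 (cell i j) = 0
  eventX : ∀ i j, IsEvent r i j → s.rarr 2 (n * n + cell i j) = evX p i j
  eventY : ∀ i j, IsEvent r i j → s.rarr 3 (n * n + cell i j) = evY p i j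
  eventT : ∀ i j, IsEvent r i j → s.narr 5 (n * n + cell i j) = evRank r i j
  deadX : ∀ i j, ¬ IsEvent r i j → s.rarr 2 (n * n + cell i j) = 1
  deadY : ∀ i j, ¬ IsEvent r i j → s.rarr 3 (n * n + cell i j) = 0
  deadT : ∀ i j, ¬ IsEvent r i j → s.narr 5 (n * n + cell i j) = 3
  fst : ∀ i j : Fin n, s.narr 6 (cell i j) = i
  snd : ∀ i j : Fin n, s.narr 7 (cell i j) = j
  x : ∀ i : Fin n, s.rarr 0 i = p i 0
  y : ∀ i : Fin n, s.rarr 1 i = p i 1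

/-- From `s` to `s'`, only the tournament trees, the signs, the total, and index registers from
`k` on have changed. -/
structure Keeps (k : ℕ) (s s' : State) : Prop where
  nreg : ∀ x, x < k → s'.nreg x = s.nreg x
  rreg : ∀ x, x ≠ 2 → s'.rreg x = s.rreg x
  narr : ∀ a, a ≠ 3 → s'.narr a = s.narr a
  rarr : ∀ a, a ≠ 4 → s'.rarr a = s.rarr a

theorem Keeps.trans {k : ℕ} {s s' s'' : State} (h : Keeps k s s') (h' : Keeps k s' s'') :
    Keeps k s s'' :=
  ⟨fun x hx => (h'.nreg x hx).trans (h.nreg x hx), fun x hx => (h'.rreg x hx).trans (h.rreg x hx),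
    fun x hx => (h'.narr x hx).trans (h.narr x hx), fun x hx => (h'.rarr x hx).trans (h.rarr x hx)⟩

theorem Keeps.of_le {k k' : ℕ} {s s' : State} (h : Keeps k s s') (hk : k' ≤ k) : Keeps k' s s' :=
  ⟨fun x hx => h.nreg x (by omega), h.rreg, h.narr, h.rarr⟩

theorem Keeps.before {k : ℕ} {s s' : State} (h : Keeps k s s') : s'.Before = s.Before := by
  unfold State.Before
  rw [h.rarr 2 (by decide), h.rarr 3 (by decide), h.narr 5 (by decide)]

/-- The constant part reads neither the trees (index array 3), nor the output (index array 0), nor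
the signs (real array 4), and only the first three index registers. -/
theorem Const.of_arrays {p : Fin n → Plane} {r : Fin n} {s s' : State} (h : Const p r s)
    (h1 : ∀ x, x < 3 → s'.nreg x = s.nreg x) (h2 : ∀ a, a ≠ 3 → a ≠ 0 → s'.narr a = s.narr a)
    (h3 : ∀ a, a ≠ 4 → s'.rarr a = s.rarr a) : Const p r s' := by
  constructor
  · rw [h1 0 (by decide)]; exact h.size
  · rw [h1 1 (by decide)]; exact h.root
  · rw [h1 2 (by decide)]; exact h.sq
  · rw [h2 2 (by decide) (by decide)]; exact h.row
  · rw [h2 1 (by decide) (by decide)]; exact h.half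
  · rw [h3 2 (by decide)]; exact h.distX
  · rw [h3 3 (by decide)]; exact h.distY
  · rw [h2 5 (by decide) (by decide)]; exact h.distT
  · rw [h3 2 (by decide)]; exact h.eventX
  · rw [h3 3 (by decide)]; exact h.eventY
  · rw [h2 5 (by decide) (by decide)]; exact h.eventT
  · rw [h3 2 (by decide)]; exact h.deadX
  · rw [h3 3 (by decide)]; exact h.deadY
  · rw [h2 5 (by decide) (by decide)]; exact h.deadT
  · rw [h2 6 (by decide) (by decide)]; exact h.fst
  · rw [h2 7 (by decide) (by decide)]; exact h.snd
  · rw [h3 0 (by decide)]; exact h.x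
  · rw [h3 1 (by decide)]; exact h.y

theorem Const.of_keeps {p : Fin n → Plane} {r : Fin n} {k : ℕ} {s s' : State} (h : Const p r s)
    (hk : Keeps k s s') (h3 : 3 ≤ k) : Const p r s' :=
  h.of_arrays (fun x hx => hk.nreg x (by omega)) (fun a ha _ => hk.narr a ha) hk.rarr

/-- The tournament trees of the candidate parents of the points. -/
structure Forest (lt : ℕ → ℕ → Prop) (T : ℕ → ℕ) (M : Fin n → Fin n → ℕ) : Prop where
  leaf : ∀ a q : Fin n, T (a * n + a * n + (n + q)) = M a q
  tour : ∀ a : Fin n, IsTournament lt T (a * n + a * n) n 0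

/-- The tournament tree of the events. -/
structure Queue (lt : ℕ → ℕ → Prop) (T : ℕ → ℕ) (E : Fin n → Fin n → ℕ) : Prop where
  leaf : ∀ i j : Fin n, T (n * n + n * n + (n * n + cell i j)) = E i j
  tour : IsTournament lt T (n * n + n * n) (n * n) 0

/-- Replacement of one entry of a matrix. -/
def setEntry {α : Type*} (M : Fin n → Fin n → α) (a q : Fin n) (v : α) : Fin n → Fin n → α :=
  fun a' q' => if a' = a ∧ q' = q then v else M a' q'

theorem IsTournament.congr {lt : ℕ → ℕ → Prop} {T T' : ℕ → ℕ} {b m e : ℕ}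
    (h : IsTournament lt T b m e) (hT : ∀ k, 1 ≤ k → k < 2 * m → T' (b + k) = T (b + k)) :
    IsTournament lt T' b m e := by
  intro k h1 h2 h3
  have := h k h1 h2 h3
  rw [add_assoc] at this ⊢
  rwa [hT k h1 (by omega), hT (k + k) (by omega) (by omega),
    hT (k + k + 1) (by omega) (by omega)]

section Layout

variable {lt : ℕ → ℕ → Prop} {T T' : ℕ → ℕ} {M E : Fin n → Fin n → ℕ} {a q : Fin n} {v : ℕ}

/-- The tree of point `a` uses cells from `2an` to below `2(a + 1)n`, and the tree of the events has
base `2n²`. So an update of the latter leaves the forest alone; the next lemma is the converse. -/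
theorem Forest.outside (h : Forest lt T M) {b m i : ℕ} (hT : ∀ x, x < b + 1 ∨ b + m ≤ x →
      x ≠ b + i → T' x = T x) (hb : n * n + n * n ≤ b) (hi : 1 ≤ i) : Forest lt T' M := by
  have key : ∀ (a : Fin n) (k : ℕ), k < 2 * n → T' (a * n + a * n + k) = T (a * n + a * n + k) :=
    fun a k hk => by
      have := mul_add_le_of_lt n a.2
      exact hT _ (by omega) (by omega)
  refine ⟨fun a q => ?_, fun a => (h.tour a).congr fun k _ hk => key a k hk⟩
  rw [key a _ (by have := q.2; omega)]
  exact h.leaf a q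

theorem Queue.outside (h : Queue lt T E) (hT : ∀ x, x < a * n + a * n + 1 ∨ a * n + a * n + n ≤ x →
      x ≠ a * n + a * n + (n + q) → T' x = T x) : Queue lt T' E := by
  have key : ∀ k, 1 ≤ k → T' (n * n + n * n + k) = T (n * n + n * n + k) :=
    fun k hk => by
      have := mul_add_le_of_lt n a.2
      have := q.2
      exact hT _ (by omega) (by omega)
  refine ⟨fun i j => ?_, h.tour.congr fun k hk _ => key k hk⟩
  rw [key _ (by have := cell_lt i j; omega)]
  exact h.leaf i j

theorem Forest.set (h : Forest lt T M) (hT : ∀ x, x < a * n + a * n + 1 ∨ a * n + a * n + n ≤ x →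
      x ≠ a * n + a * n + (n + q) → T' x = T x) (hv : T' (a * n + a * n + (n + q)) = v)
    (ht : IsTournament lt T' (a * n + a * n) n 0) : Forest lt T' (setEntry M a q v) := by
  have key : ∀ a' : Fin n, a' ≠ a → ∀ k, 1 ≤ k → k < 2 * n →
      T' (a' * n + a' * n + k) = T (a' * n + a' * n + k) := fun a' ha k hk hk' => by
    have hq := q.2
    rcases lt_or_gt_of_ne (fun e => ha (Fin.ext e) : (a' : ℕ) ≠ a) with e | e
    · have := mul_add_le_of_lt n e
      exact hT _ (by omega) (by omega)
    · have := mul_add_le_of_lt n e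
      exact hT _ (by omega) (by omega)
  refine ⟨fun a' q' => ?_, fun a' => ?_⟩
  · unfold setEntry
    split_ifs with e
    · rw [e.1, e.2, hv]
    · by_cases ha : a' = a
      · subst ha
        rw [hT _ (by omega), h.leaf]
        intro e'
        exact e ⟨rfl, Fin.ext (by omega)⟩
      · rw [key a' ha _ (by have := q'.2; omega) (by have := q'.2; omega), h.leaf]
  · by_cases ha : a' = a
    · rw [ha]
      exact ht
    · exact (h.tour a').congr (key a' ha)

theorem Queue.set {i j : Fin n} (h : Queue lt T E)
    (hT : ∀ x, x < n * n + n * n + 1 ∨ n * n + n * n + n * n ≤ x →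
      x ≠ n * n + n * n + (n * n + cell i j) → T' x = T x)
    (hv : T' (n * n + n * n + (n * n + cell i j)) = v)
    (ht : IsTournament lt T' (n * n + n * n) (n * n) 0) : Queue lt T' (setEntry E i j v) := by
  refine ⟨fun i' j' => ?_, ht⟩
  unfold setEntry
  split_ifs with e
  · rw [e.1, e.2, hv]
  · rw [hT _ (by omega), h.leaf]
    intro e'
    exact e (cell_inj.1 (by omega))

end Layout

/-- The sum of the first key components of the items at the roots of the trees of the points. -/
def rootSum (n : ℕ) (s : State) : ℝ :=
  ∑ a : Fin n, s.rarr 2 (s.narr 3 (a * n + a * n + 1))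

/-- The state of the machine during the sweep: `σ` are the signs, `M` and `E` the leaves of the
tournament trees. -/
structure Ready (p : Fin n → Plane) (r : Fin n) (s : State) (σ : Fin n → Fin n → ℝ)
    (M E : Fin n → Fin n → ℕ) : Prop where
  const : Const p r s
  signs : ∀ i j, s.rarr 4 (cell i j) = σ i j
  forest : Forest s.Before (s.narr 3) M
  queue : Queue s.Before (s.narr 3) E
  sum : s.rreg 2 = rootSum n s

theorem Ready.of_eq {p : Fin n → Plane} {r : Fin n} {s s' : State} {σ : Fin n → Fin n → ℝ}
    {M E : Fin n → Fin n → ℕ} (h : Ready p r s σ M E)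
    (h1 : ∀ x, x < 3 → s'.nreg x = s.nreg x) (h2 : ∀ a, a ≠ 0 → s'.narr a = s.narr a)
    (h3 : s'.rarr = s.rarr) (h4 : s'.rreg 2 = s.rreg 2) : Ready p r s' σ M E := by
  have hb : s'.Before = s.Before := by
    unfold State.Before
    rw [h3, h2 5 (by decide)]
  refine ⟨h.const.of_arrays h1 (fun a _ => h2 a) fun a _ => by rw [h3], ?_, ?_, ?_, ?_⟩
  · rw [h3]; exact h.signs
  · rw [hb, h2 3 (by decide)]; exact h.forest
  · rw [hb, h2 3 (by decide)]; exact h.queue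
  · rw [h4, h.sum]
    unfold rootSum
    rw [h3, h2 3 (by decide)]

theorem Ready.setSign {p : Fin n → Plane} {r : Fin n} {s : State} {σ : Fin n → Fin n → ℝ}
    {M E : Fin n → Fin n → ℕ} (h : Ready p r s σ M E) (i j : Fin n) (v : ℝ) :
    Ready p r
      { s with rarr := Function.update s.rarr 4 (Function.update (s.rarr 4) (cell i j) v) }
      (setEntry σ i j v) M E := by
  have hk : Keeps 3 s
      { s with rarr := Function.update s.rarr 4 (Function.update (s.rarr 4) (cell i j) v) } :=
    ⟨fun _ _ => rfl, fun _ _ => rfl, fun _ _ => rfl, fun a ha => by simp [ha]⟩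
  refine ⟨h.const.of_keeps hk le_rfl, ?_, by rw [hk.before]; exact h.forest,
    by rw [hk.before]; exact h.queue, by simpa [rootSum] using h.sum⟩
  intro i' j'
  simp only [Function.update_self, setEntry, Function.update_apply, cell_inj, h.signs]

/-- The array index of the pair of points in two registers. -/
def pairAt (x y : ℕ) : NExp := .add (.get 2 (.reg x)) (.reg y)

/-- Recomputation of the candidate `reg y` for a parent of the point `reg x`. -/
def refresh (x y : ℕ) : Prog := .block [
  .setN 40 (.add (.get 2 (.reg x)) (.get 2 (.reg x))),
  .setN 41 (.add (.reg 0) (.reg y)),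
  .setR 2 (.sub (.reg 2) (.get 2 (.get 3 (.add (.reg 40) (.lit 1))))),
  .ite (.conj (.neg (.conj (.neg (.nlt (.reg x) (.reg y))) (.neg (.nlt (.reg y) (.reg x)))))
      (.neg (.rlt (.mul (.get 4 (pairAt y 1)) (.get 4 (pairAt x y))) (.lit 0))))
    (.setN 42 (pairAt x y)) (.setN 42 (pairAt x 1)),
  update,
  .setR 2 (.add (.reg 2) (.get 2 (.get 3 (.add (.reg 40) (.lit 1)))))]

variable {p : Fin n → Plane} {r : Fin n} {s : State} {σ : Fin n → Fin n → ℝ}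
  {M E : Fin n → Fin n → ℕ} {L : ℕ}

/-- The item for the candidate `q` for a parent of `a`. -/
noncomputable def item (σ : Fin n → Fin n → ℝ) (r a q : Fin n) : ℕ := cell a (choice σ r a q)

/-- Only the tree of `a` changes, so subtracting its old root distance and adding the new one
maintains the sum. A rejected candidate is replaced by the root of the point set, so every leaf
holds an admissible parent. -/
theorem refresh_ends (h : Ready p r s σ M E) (hL : 2 * (n * n) ≤ 2 ^ (L + 1)) {x y : ℕ}
    (hx : x < 30) (hy : y < 30) {a q : Fin n} (ha : s.nreg x = a) (hq : s.nreg y = q) :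
    Ends (refresh x y) s (200 * (L + 1) + 100) fun s' =>
      Keeps 30 s s' ∧ Ready p r s' σ (setEntry M a q (item σ r a q)) E := by
  have hn : 1 ≤ n := by have := a.2; omega
  have hnn : n ≤ n * n := Nat.le_mul_of_pos_left n hn
  have hq2 := q.2
  have hx40 : x ≠ 40 := by omega
  have hx41 : x ≠ 41 := by omega
  have hy40 : y ≠ 40 := by omega
  have hy41 : y ≠ 41 := by omega
  have hsize := h.const.size
  have hrow := h.const.row
  have hroot := h.const.root
  have hupd : Ends (.block [update,
      .setR 2 (.add (.reg 2) (.get 2 (.get 3 (.add (.reg 40) (.lit 1)))))])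
      { s with
        nreg := Function.update (Function.update (Function.update s.nreg 40 (a * n + a * n))
          41 (n + q)) 42 (item σ r a q)
        rreg := Function.update s.rreg 2
          (s.rreg 2 - s.rarr 2 (s.narr 3 (a * n + a * n + 1))) } (200 * (L + 1) + 20) fun s' =>
      Keeps 30 s s' ∧ Ready p r s' σ (setEntry M a q (item σ r a q)) E := by
    refine (Ends.cons (k' := 10) ((update_ends (lt := s.Before) (b := a * n + a * n) (m := n)
      (i := n + q)
      (v := item σ r a q) (L := L) ?_ ?_ ?_ (by omega) (by omega) (by omega) ?_ ?_ ?_).imp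
      ?_)).within ?_
    · simp
    · simp
    · simp
    · intro k hk
      exact h.const.half k (by omega)
    · intro x y
      rfl
    · exact h.forest.tour a
    · rintro s' ⟨nr, T, rfl, h1, h2, h3, h4⟩
      refine (Ends.cons (Ends.setR (Ends.nil ?_))).within (by simp [RExp.time, NExp.time])
      have hk : Keeps 30 s { s with
          nreg := nr
          narr := Function.update s.narr 3 T
          rreg := Function.update s.rreg 2 (s.rreg 2 - s.rarr 2 (s.narr 3 (a * n + a * n + 1)) +
            s.rarr 2 (T (a * n + a * n + 1))) } := by
        refine ⟨fun x hx => ?_, fun x hx => ?_, fun x hx => ?_, fun _ _ => rfl⟩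
        · change nr x = _
          rw [h1 x (by omega)]
          simp [show x ≠ 40 by omega, show x ≠ 41 by omega, show x ≠ 42 by omega]
        · simp [hx]
        · simp [hx]
      have hr40 : nr 40 = a * n + a * n := by rw [h1 40 (by decide)]; simp
      have e : ∀ s', s' = { s with
          nreg := nr
          narr := Function.update s.narr 3 T
          rreg := Function.update s.rreg 2 (s.rreg 2 - s.rarr 2 (s.narr 3 (a * n + a * n + 1)) +
            s.rarr 2 (T (a * n + a * n + 1))) } → Keeps 30 s s' ∧
            Ready p r s' σ (setEntry M a q (item σ r a q)) E := by
        rintro s' rfl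
        refine ⟨hk, h.const.of_keeps hk (by decide), h.signs, ?_, ?_, ?_⟩
        · rw [hk.before]
          simp only [Function.update_self]
          exact h.forest.set h4 h3 h2
        · rw [hk.before]
          simp only [Function.update_self]
          exact h.queue.outside h4
        · have hs := h.sum
          simp only [rootSum, Function.update_self] at hs ⊢
          -- The summand of `a` is split off both sums; the other trees occupy disjoint cells.
          rw [hs, ← Finset.add_sum_erase _ _ (Finset.mem_univ a),
            ← Finset.add_sum_erase (Finset.univ : Finset (Fin n)) _ (Finset.mem_univ a),
            Finset.sum_congr rfl (g := fun a' : Fin n => s.rarr 2 (T (a' * n + a' * n + 1)))]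
          · ring
          · intro a' ha'
            have ha' : (a' : ℕ) ≠ a := fun e => Finset.ne_of_mem_erase ha' (Fin.ext e)
            rw [h4]
            · rcases lt_or_gt_of_ne ha' with e | e
              · have := mul_add_le_of_lt n e
                omega
              · have := mul_add_le_of_lt n e
                omega
            · rcases lt_or_gt_of_ne ha' with e | e
              · have := mul_add_le_of_lt n e
                omega
              · have := mul_add_le_of_lt n e
                omega
      refine e _ ?_
      simp [RExp.eval, NExp.eval, hr40]
    · omega
  refine (Ends.cons (Ends.setN (Ends.cons (Ends.setN (Ends.cons (Ends.setR (Ends.cons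
    (k' := 200 * (L + 1) + 20) (Ends.ite (fun hc => Ends.setN ?_)
      (fun hc => Ends.setN ?_))))))))).within ?_
  rotate_left 2
  · simp [RExp.time, NExp.time, Test.time, pairAt]
    omega
  all_goals
    simp only [Test.Holds, NExp.eval, RExp.eval, pairAt, Function.update_self, ha, hq, hx40, hx41,
      hy40, hy41, Function.update_of_ne, ne_eq, not_false_eq_true, hsize, hrow, hroot,
      show (1 : ℕ) ≠ 41 by decide, show (1 : ℕ) ≠ 40 by decide, show (0 : ℕ) ≠ 40 by decide,
      show (40 : ℕ) ≠ 41 by decide] at hc ⊢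
    have hcell : ∀ i j : Fin n, s.rarr 4 (i * n + j) = σ i j := h.signs
    rw [hcell, hcell] at hc
    have hcase : (¬(¬(a : ℕ) < q ∧ ¬(q : ℕ) < a) ∧ ¬σ q r * σ a q < ((0 : ℤ) : ℝ)) ↔
        (q ≠ a ∧ 0 ≤ σ q r * σ a q) := by
      rw [Int.cast_zero, ne_eq, Fin.ext_iff]
      exact and_congr (by omega) not_lt
    rw [hcase] at hc
  · have e : (a * n + q : ℕ) = item σ r a q := by
      unfold item choice
      rw [if_pos hc]
      rfl
    rw [e]
    exact hupd
  · have e : (a * n + r : ℕ) = item σ r a q := by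
      unfold item choice
      rw [if_neg hc]
      rfl
    rw [e]
    exact hupd

end RealRAM

/-! ### Updates after a change of signs, and the meaning of the tree roots -/

namespace RealRAM

open Geo

variable {n : ℕ}

variable {p : Fin n → Plane} {r : Fin n} {s : State} {σ : Fin n → Fin n → ℝ}
  {M E : Fin n → Fin n → ℕ} {L : ℕ}

/-- Reversal of the order of the points in two registers. -/
def flipProg (x y : ℕ) : Prog := .block [
  .putR 4 (pairAt x y) (.sub (.lit 0) (.get 4 (pairAt x y))),
  .putR 4 (pairAt y x) (.sub (.lit 0) (.get 4 (pairAt y x))),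
  refresh x y,
  refresh y x]

theorem flipTie_eq_setEntry (i j : Fin n) :
    setEntry (setEntry σ i j (-σ i j)) j i (-σ j i) = flipTie σ i j := by
  funext a b
  unfold setEntry flipTie
  by_cases h1 : a = j ∧ b = i
  · rw [if_pos h1, if_pos (Or.inr h1), h1.1, h1.2]
  · by_cases h2 : a = i ∧ b = j
    · rw [if_neg h1, if_pos h2, if_pos (Or.inl h2), h2.1, h2.2]
    · rw [if_neg h1, if_neg h2, if_neg (by tauto)]

/-- Neither point is the root, so the column of the root is untouched: only `j` as a candidate for
`i`, and `i` as one for `j`, can change. -/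
theorem item_flipTie_of_ne {i j : Fin n} (hi : i ≠ r) (hj : j ≠ r) {a q : Fin n}
    (h : ¬ (a = i ∧ q = j)) (h' : ¬ (a = j ∧ q = i)) :
    item (flipTie σ i j) r a q = item σ r a q := by
  unfold item choice
  rw [flip_of_ne (a := q) (b := r), flip_of_ne (a := a) (b := q)]
  · tauto
  · rintro (⟨-, e⟩ | ⟨-, e⟩)
    · exact hj e.symm
    · exact hi e.symm

theorem flipProg_ends (h : Ready p r s σ (item σ r) E) (hL : 2 * (n * n) ≤ 2 ^ (L + 1)) {x y : ℕ}
    (hx : x < 30) (hy : y < 30) {i j : Fin n} (hsx : s.nreg x = i) (hsy : s.nreg y = j)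
    (hij : i ≠ j) (hi : i ≠ r) (hj : j ≠ r) :
    Ends (flipProg x y) s (400 * (L + 1) + 300) fun s' =>
      Keeps 30 s s' ∧ Ready p r s' (flipTie σ i j) (item (flipTie σ i j) r) E := by
  have hrow := h.const.row
  have hcell : ∀ i j : Fin n, s.rarr 4 (i * n + j) = σ i j := h.signs
  have h1 := (h.setSign i j (-σ i j)).setSign j i (-σ j i)
  rw [flipTie_eq_setEntry i j] at h1
  have hne : ¬ (j = i ∧ i = j) := fun e => hij e.2
  have hne' : (j * n + i : ℕ) ≠ i * n + j := fun e => hne (cell_inj.1 e)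
  refine (Ends.cons (Ends.putR (Ends.cons (Ends.putR (Ends.cons (k' := 200 * (L + 1) + 110)
    ((refresh_ends (p := p) (r := r) (M := item σ r) (E := E) (L := L) (σ := flipTie σ i j) ?_ hL hx hy
      (a := i) (q := j) ?_ ?_).imp ?_)))))).within ?_
  · simp only [pairAt, NExp.eval, RExp.eval, hsx, hsy, hrow, hcell, Function.update_self,
      Function.update_of_ne hne', Int.cast_zero, zero_sub]
    simpa [cell] using h1
  · simpa using hsx
  · simpa using hsy
  · rintro s1 ⟨k1, r1⟩
    have hk : Keeps 30 s s1 := ⟨fun x hx => k1.nreg x hx, fun x hx => k1.rreg x hx,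
      fun x hx => k1.narr x hx, fun x hx => by rw [k1.rarr x hx]; simp [hx]⟩
    refine (Ends.cons (k' := 1) ((refresh_ends r1 hL hy hx (a := j) (q := i) ?_ ?_).imp
      ?_)).within (by omega)
    · rw [hk.nreg y hy, hsy]
    · rw [hk.nreg x hx, hsx]
    · rintro s2 ⟨k2, r2⟩
      refine Ends.nil ⟨hk.trans k2, ?_⟩
      convert r2 using 1
      funext a q
      unfold setEntry
      split_ifs with e1 e2
      · rw [e1.1, e1.2]
      · rw [e2.1, e2.2]
      · exact item_flipTie_of_ne hi hj e2 e1
  · simp [RExp.time, NExp.time, pairAt]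
    omega

/-- Recomputation of the candidate `reg y` for all points. -/
def column (y : ℕ) : Prog := .forN 20 (.reg 0) (refresh 20 y)

/-- This serves the events at the root's level: the sign of `q` against the root enters the test of
`q` as a candidate for every point. -/
theorem column_ends (h : Ready p r s σ M E) (hL : 2 * (n * n) ≤ 2 ^ (L + 1)) {y : ℕ}
    (hy : y < 20) {q : Fin n} (hsy : s.nreg y = q) :
    Ends (column y) s ((n + 1) * (200 * (L + 1) + 110)) fun s' =>
      Keeps 20 s s' ∧ Ready p r s' σ (fun a q' => if q' = q then item σ r a q' else M a q') E := by
  refine (Ends.forN (m := n) (tb := 200 * (L + 1) + 100)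
    (fun k s' => Keeps 20 s s' ∧
      Ready p r s' σ (fun a q' => if q' = q ∧ (a : ℕ) < k then item σ r a q' else M a q') E)
    ?_ ?_ ?_).mono ?_ ?_
  · refine ⟨⟨fun x hx => ?_, fun _ _ => rfl, fun _ _ => rfl, fun _ _ => rfl⟩, ?_⟩
    · simp [show x ≠ 20 by omega]
    · simp only [Nat.not_lt_zero, and_false, if_false]
      exact h.of_eq (fun x hx => by simp [show x ≠ 20 by omega]) (fun _ _ => rfl) rfl rfl
  · rintro k s' ⟨hk, -⟩
    simpa [NExp.eval] using (hk.nreg 0 (by decide)).trans h.const.size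
  · rintro k s1 hkn ⟨hk, hr⟩ h20
    refine (refresh_ends hr hL (x := 20) (y := y) (by decide) (by omega) (a := ⟨k, hkn⟩) (q := q)
      h20 ?_).imp ?_
    · rw [hk.nreg y hy, hsy]
    · rintro s2 ⟨k2, r2⟩
      refine ⟨(k2.nreg 20 (by decide)).trans h20, ?_, ?_⟩
      · have := hk.trans (k2.of_le (by decide : 20 ≤ 30))
        exact ⟨fun x hx => by simpa [show x ≠ 20 by omega] using this.nreg x hx, this.rreg,
          this.narr, this.rarr⟩
      · refine Ready.of_eq (s := s2) ?_ (fun x hx => by simp [show x ≠ 20 by omega])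
          (fun _ _ => rfl) rfl rfl
        convert r2 using 1
        funext a q'
        unfold setEntry
        by_cases e : a = ⟨k, hkn⟩ ∧ q' = q
        · rw [if_pos e, e.1, e.2]
          simp
        · rw [if_neg e]
          refine if_congr ⟨fun h => ⟨h.1, ?_⟩, fun h => ⟨h.1, by omega⟩⟩ rfl rfl
          have : (a : ℕ) ≠ k := fun e' => e ⟨Fin.ext e', h.1⟩
          have := h.2
          omega
  · simp only [NExp.time]
    refine Nat.mul_le_mul_left _ ?_
    omega
  · rintro s' ⟨hk, hr⟩
    refine ⟨hk, ?_⟩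
    convert hr using 1
    funext a q'
    simp only [a.2, and_true]

/-- Recomputation of all candidates. -/
def refreshAll : Prog := .forN 16 (.reg 0) (column 16)

theorem refreshAll_ends (h : Ready p r s σ M E) (hL : 2 * (n * n) ≤ 2 ^ (L + 1)) :
    Ends refreshAll s ((n + 1) * ((n + 1) * (200 * (L + 1) + 110) + 9)) fun s' =>
      Keeps 16 s s' ∧ Ready p r s' σ (item σ r) E := by
  refine (Ends.forN (m := n) (tb := (n + 1) * (200 * (L + 1) + 110))
    (fun k s' => Keeps 16 s s' ∧
      Ready p r s' σ (fun a q => if (q : ℕ) < k then item σ r a q else M a q) E)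
    ?_ ?_ ?_).mono ?_ ?_
  · refine ⟨⟨fun x hx => ?_, fun _ _ => rfl, fun _ _ => rfl, fun _ _ => rfl⟩, ?_⟩
    · simp [show x ≠ 16 by omega]
    · simp only [Nat.not_lt_zero, if_false]
      exact h.of_eq (fun x hx => by simp [show x ≠ 16 by omega]) (fun _ _ => rfl) rfl rfl
  · rintro k s' ⟨hk, -⟩
    simpa [NExp.eval] using (hk.nreg 0 (by decide)).trans h.const.size
  · rintro k s1 hkn ⟨hk, hr⟩ h16
    refine (column_ends hr hL (y := 16) (by decide) (q := ⟨k, hkn⟩) h16).imp ?_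
    rintro s2 ⟨k2, r2⟩
    refine ⟨(k2.nreg 16 (by decide)).trans h16, ?_, ?_⟩
    · have := hk.trans (k2.of_le (by decide : 16 ≤ 20))
      exact ⟨fun x hx => by simpa [show x ≠ 16 by omega] using this.nreg x hx, this.rreg,
        this.narr, this.rarr⟩
    · refine Ready.of_eq (s := s2) ?_ (fun x hx => by simp [show x ≠ 16 by omega])
        (fun _ _ => rfl) rfl rfl
      convert r2 using 1
      funext a q
      by_cases e : q = ⟨k, hkn⟩
      · simp [e]
      · rw [if_neg e]
        have : (q : ℕ) ≠ k := fun e' => e (Fin.ext e')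
        refine if_congr ?_ rfl rfl
        omega
  · simp only [NExp.time]
    rfl
  · rintro s' ⟨hk, hr⟩
    refine ⟨hk, ?_⟩
    convert hr using 1
    funext a q
    simp only [q.2, if_true]

/-- The keys of the items, in the order in which the machine compares them. -/
noncomputable def State.key (s : State) (a : ℕ) : WithTop ℝ ×ₗ ℕ :=
  toLex (invSlope (s.rarr 2 a) (s.rarr 3 a), s.narr 5 a)

/-- On items with upper key vectors, the comparison by products is the lexicographic order.
Distances are stored with second component 1, so the same test compares them. -/
theorem State.before_iff {a b : ℕ} (ha : Upper (s.rarr 2 a) (s.rarr 3 a))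
    (hb : Upper (s.rarr 2 b) (s.rarr 3 b)) : s.Before a b ↔ s.key a < s.key b := by
  unfold State.Before State.key
  rw [Prod.Lex.toLex_lt_toLex, ← invSlope_lt_invSlope ha hb, ← invSlope_lt_invSlope hb ha]
  simp only
  -- Once the first strict comparison fails, the failure of the opposite one means equal slopes.
  refine or_congr_right' fun h => and_congr_left fun _ => ?_
  rw [not_lt] at h ⊢
  exact ⟨fun h' => le_antisymm h' h, fun h' => h'.le⟩

/-- The root of the tree of a point holds its nearest candidate. -/
theorem Ready.root (h : Ready p r s σ (item σ r) E) (a : Fin n) :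
    ∃ q, s.narr 3 (a * n + a * n + 1) = cell a (choice σ r a q) ∧
      near p r σ a = dist (p a) (p (choice σ r a q)) := by
  have hn : 1 ≤ n := by have := a.2; omega
  have hkey : ∀ i j : Fin n, s.key (cell i j) = toLex (((dist (p i) (p j) : ℝ) : WithTop ℝ), 0) :=
    fun i j => by
      unfold State.key invSlope
      rw [h.const.distX, h.const.distY, h.const.distT, if_neg one_ne_zero, div_one]
  have hleaf : ∀ j, n ≤ j → j < 2 * n → ∃ q : Fin n, j = n + q := fun j h1 h2 =>
    ⟨⟨j - n, by omega⟩, by simp; omega⟩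
  obtain ⟨j, h1, h2, h3⟩ := (h.forest.tour a).exists_leaf _ 1 le_rfl (by omega) le_rfl
  obtain ⟨q, rfl⟩ := hleaf j h1 h2
  rw [h.forest.leaf] at h3
  refine ⟨q, h3, (near_eq_of_forall ⟨q, rfl⟩ fun q' => ?_).symm⟩
  have := (h.forest.tour a).root_le s.key (fun x => Upper (s.rarr 2 x) (s.rarr 3 x))
    (fun x y hx hy => s.before_iff hx hy) (fun j h1 h2 => ?_) (n + q') (by omega)
    (by have := q'.2; omega)
  · rw [h3, h.forest.leaf, item, item, hkey, hkey, Prod.Lex.toLex_le_toLex] at this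
    rcases this with this | this
    · exact (WithTop.coe_lt_coe.1 this).le
    · exact (WithTop.coe_eq_coe.1 this.1).le
  · obtain ⟨q'', rfl⟩ := hleaf j h1 h2
    rw [h.forest.leaf, item, h.const.distX, h.const.distY]
    exact Or.inl one_pos

/-- The maintained total is the total of the nearest candidates. -/
theorem Ready.total (h : Ready p r s σ (item σ r) E) : s.rreg 2 = total p r σ := by
  rw [h.sum]
  refine Finset.sum_congr rfl fun a _ => ?_
  obtain ⟨q, h1, h2⟩ := h.root a
  rw [h1, h2, h.const.distX]

end RealRAM

/-! ### Signs and least totals during the sweep -/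

namespace RealRAM

open Geo

variable {n : ℕ} {p : Fin n → Plane} {r : Fin n} {D : Finset (Fin n × Fin n)}

/-- The inverse slope of the direction of an event. -/
noncomputable def evSlope (p : Fin n → Plane) (i j : Fin n) : WithTop ℝ :=
  invSlope (evX p i j) (evY p i j)

/-- The key of an event. -/
noncomputable def evKey (p : Fin n → Plane) (r i j : Fin n) : WithTop ℝ ×ₗ ℕ :=
  toLex (evSlope p i j, evRank r i j)

theorem evKey_le {i j i' j' : Fin n} : evKey p r i j ≤ evKey p r i' j' ↔
    evSlope p i j < evSlope p i' j' ∨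
      evSlope p i j = evSlope p i' j' ∧ evRank r i j ≤ evRank r i' j' :=
  Prod.Lex.toLex_le_toLex

theorem evSlope_le_of_evKey_le {i j i' j' : Fin n} (h : evKey p r i j ≤ evKey p r i' j') :
    evSlope p i j ≤ evSlope p i' j' := by
  rcases evKey_le.1 h with h | h
  · exact h.le
  · exact h.1.le

/-- The signs when the events in `D` have been processed. -/
noncomputable def curSigns (p : Fin n → Plane) (r : Fin n) (D : Finset (Fin n × Fin n)) :
    Fin n → Fin n → ℝ := fun i j =>
  if j = r then if (i, r) ∈ D then sg p r i else if (r, i) ∈ D then 0 else sg p i r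
  else if i = r then sg p i j
  else if (i, j) ∈ D ∨ (j, i) ∈ D then -sg p i j else sg p i j

theorem evDir_upper (hp : Function.Injective p) {i j : Fin n} (h : i ≠ j) :
    Upper ((evDir p i j) 0) ((evDir p i j) 1) := ev_upper hp h

theorem dirSign_evDir (hp : Function.Injective p) {i j a b : Fin n} (h : i ≠ j) (hab : a ≠ b) :
    dirSign p (evDir p i j) a b =
      if evSlope p i j < evSlope p a b then sg p a b
      else if evSlope p a b < evSlope p i j then -sg p a b else 0 :=
  dirSign_of_upper hp (evDir_upper hp h) hab

theorem dirSign_evDir_eq_zero (hp : Function.Injective p) {i j a b : Fin n} (h : i ≠ j)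
    (hab : a ≠ b) : dirSign p (evDir p i j) a b = 0 ↔ evSlope p a b = evSlope p i j := by
  rw [dirSign_evDir hp h hab]
  have hne : sg p a b ≠ 0 := by rcases sg_eq p a b with e | e <;> simp [e]
  rcases lt_trichotomy (evSlope p i j) (evSlope p a b) with e | e | e
  · simp [e, hne, e.ne']
  · simp [e]
  · simp [e, not_lt_of_gt e, hne, e.ne]

theorem evSlope_swap (hp : Function.Injective p) {i j : Fin n} (h : i ≠ j) :
    evSlope p j i = evSlope p i j := by
  unfold evSlope
  rw [(ev_swap hp h).1, (ev_swap hp h).2]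

/-- In general position, events with the same direction do not share points. -/
theorem eq_of_evSlope_eq (hp : Function.Injective p) (hg : GeneralPosition p) {i j k : Fin n}
    (hij : i ≠ j) (hik : i ≠ k) (h : evSlope p i j = evSlope p i k) : j = k := by
  by_contra hjk
  have h1 := (dirSign_evDir_eq_zero hp hij hij).2 rfl
  have h2 := (dirSign_evDir_eq_zero hp hij hik).2 h.symm
  exact hg.dirSign_ne_zero (evDir_upper hp hij).ne_zero h1 hij k (Ne.symm hik) (Ne.symm hjk) h2

/-- Off the given slope, the hypotheses say that exactly the earlier events are processed. At that
slope, a point at the level of the root has arrived there but not yet left, so its sign against the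
root is zero; ties between other points may have been reversed or not. -/
theorem curSigns_refines (hp : Function.Injective p) (hD : ∀ e ∈ D, IsEvent r e.1 e.2)
    {i j : Fin n} (hij : i ≠ j)
    (hlt : ∀ a b, IsEvent r a b → evSlope p a b < evSlope p i j → (a, b) ∈ D)
    (hgt : ∀ a b, evSlope p i j < evSlope p a b → (a, b) ∉ D)
    (hopen : ∀ q, q ≠ r → evSlope p r q = evSlope p i j → (r, q) ∈ D)
    (hclose : ∀ q, q ≠ r → evSlope p q r = evSlope p i j → (q, r) ∉ D) :
    Refines r (dirSign p (evDir p i j)) (sg p) D (curSigns p r D) where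
  root q hq := by
    unfold curSigns
    rw [if_pos rfl, dirSign_evDir hp hij hq]
    have hs := evSlope_swap hp hq
    rcases lt_trichotomy (evSlope p i j) (evSlope p q r) with e | e | e
    · rw [if_pos e, if_neg (hgt _ _ e), if_neg (hgt _ _ (by rwa [hs]))]
    · rw [← e, if_neg (lt_irrefl _), if_neg (lt_irrefl _), if_neg (hclose q hq e.symm),
        if_pos (hopen q hq (by rw [hs, e]))]
    · rw [if_neg (not_lt_of_gt e), if_pos e, if_pos (hlt q r ⟨hq, Or.inr (Or.inl rfl)⟩ e),
        sg_swap hp hq]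
  sep a b ha hb hab := by
    have hne : a ≠ b := by
      rintro rfl
      exact hab (dirSign_eq_zero.2 rfl)
    unfold curSigns
    rw [if_neg hb, if_neg ha]
    rw [Ne, dirSign_evDir_eq_zero hp hij hne] at hab
    rw [dirSign_evDir hp hij hne]
    have hs := evSlope_swap hp hne
    rcases lt_or_gt_of_ne hab with e | e
    · rw [if_neg (not_lt_of_gt e), if_pos e, if_pos]
      rcases lt_or_gt_of_ne hne with e' | e'
      · exact Or.inl (hlt a b ⟨hne, Or.inr (Or.inr e')⟩ e)
      · exact Or.inr (hlt b a ⟨hne.symm, Or.inr (Or.inr e')⟩ (by rwa [hs]))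
    · rw [if_pos e, if_neg]
      rintro (h | h)
      · exact hgt _ _ e h
      · exact hgt _ _ (by rwa [hs]) h
  tie a b ha hb hab _ := by
    unfold curSigns
    rw [if_neg hb, if_neg ha, if_neg ha, if_neg hb, sg_swap hp hab.ne]
    by_cases h : (a, b) ∈ D ∨ (b, a) ∈ D
    · rw [if_pos h, if_pos h.symm]
      refine ⟨?_, rfl⟩
      rcases sg_eq p a b with e | e <;> simp [e]
    · rw [if_neg h, if_neg fun h' => h h'.symm]
      exact ⟨sg_eq p a b, rfl⟩
  base a b ha hb hab _ hn := by
    unfold curSigns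
    rw [if_neg hb, if_neg ha, if_neg]
    rintro (h | h)
    · exact hn h
    · rcases hD _ h with ⟨-, h | h | h⟩
      · exact hb h
      · exact ha h
      · exact lt_asymm hab h

/-- The processed events come before the others. -/
structure IsPrefix (p : Fin n → Plane) (r : Fin n) (D : Finset (Fin n × Fin n)) : Prop where
  event : ∀ e ∈ D, IsEvent r e.1 e.2
  down : ∀ e ∈ D, ∀ i j, IsEvent r i j → (i, j) ∉ D → evKey p r e.1 e.2 ≤ evKey p r i j

/-- A next event. -/
structure IsNext (p : Fin n → Plane) (r : Fin n) (D : Finset (Fin n × Fin n)) (i j : Fin n) :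
    Prop where
  event : IsEvent r i j
  notMem : (i, j) ∉ D
  le : ∀ a b, IsEvent r a b → (a, b) ∉ D → evKey p r i j ≤ evKey p r a b

theorem IsPrefix.extend (h : IsPrefix p r D) {i j : Fin n} (hn : IsNext p r D i j) :
    IsPrefix p r (insert (i, j) D) where
  event e he := by
    rcases Finset.mem_insert.1 he with rfl | he
    · exact hn.event
    · exact h.event e he
  down e he a b hab hn' := by
    rw [Finset.mem_insert, not_or] at hn'
    rcases Finset.mem_insert.1 he with rfl | he
    · exact hn.le a b hab hn'.2
    · exact h.down e he a b hab hn'.2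

theorem IsNext.mem_of_slope_lt {i j : Fin n} (hn : IsNext p r D i j) {a b : Fin n}
    (hab : IsEvent r a b) (h : evSlope p a b < evSlope p i j) : (a, b) ∈ D := by
  by_contra hD
  have := evSlope_le_of_evKey_le (hn.le a b hab hD)
  exact absurd h (not_lt_of_ge this)

theorem IsPrefix.slope_le (h : IsPrefix p r D) {i j : Fin n} (hn : IsNext p r D i j) {a b : Fin n}
    (hab : (a, b) ∈ D) : evSlope p a b ≤ evSlope p i j :=
  evSlope_le_of_evKey_le (h.down _ hab i j hn.event hn.notMem)

/-- From rank 1 on, an arrival in this direction, having rank 0, has been processed. A departure,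
having rank 2, can have been processed before only if the next event is a departure too, and general
position would make the two equal. -/
theorem IsPrefix.refines (hp : Function.Injective p) (hg : GeneralPosition p)
    (h : IsPrefix p r D) {i j : Fin n} (hn : IsNext p r D i j) (hr : 1 ≤ evRank r i j) :
    Refines r (dirSign p (evDir p i j)) (sg p) D (curSigns p r D) := by
  refine curSigns_refines hp h.event hn.event.1 (fun a b hab => hn.mem_of_slope_lt hab)
    (fun a b hab hD => not_lt_of_ge (h.slope_le hn hD) hab) (fun q hq e => ?_) fun q hq e hD => ?_
  · by_contra hD
    rcases evKey_le.1 (hn.le r q ⟨hq.symm, Or.inl rfl⟩ hD) with e' | e'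
    · exact e'.ne e.symm
    · simp only [evRank, if_true] at e' hr
      omega
  · rcases evKey_le.1 (h.down _ hD i j hn.event hn.notMem) with e' | ⟨-, e'⟩
    · exact e'.ne e
    · have hj : j = r ∧ i ≠ r := by
        unfold evRank at e' hr
        rw [if_neg hq, if_pos rfl] at e'
        split_ifs at e' with h1 h2
        · omega
        · exact ⟨h2, h1⟩
        · omega
      obtain ⟨rfl, hi⟩ := hj
      rw [← evSlope_swap hp hq, ← evSlope_swap hp hi] at e
      have := eq_of_evSlope_eq hp hg hq.symm hi.symm e
      subst this
      exact hn.notMem hD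

/-- Before an arrival the current signs do not yet fit the new direction, since the arriving point
still has a nonzero sign against the root. They fit right after it. -/
theorem IsPrefix.refines_open (hp : Function.Injective p) (hg : GeneralPosition p)
    (h : IsPrefix p r D) {j : Fin n} (hn : IsNext p r D r j) :
    Refines r (dirSign p (evDir p r j)) (sg p) (insert (r, j) D : Finset _)
      (curSigns p r (insert (r, j) D)) := by
  have hj := hn.event.1
  refine curSigns_refines hp (h.extend hn).event hj (fun a b hab e =>
    Finset.mem_insert_of_mem (hn.mem_of_slope_lt hab e)) (fun a b hab hD => ?_) (fun q hq e => ?_)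
    fun q hq e hD => ?_
  · rcases Finset.mem_insert.1 hD with hD | hD
    · obtain ⟨rfl, rfl⟩ := Prod.mk.inj hD
      exact lt_irrefl _ hab
    · exact not_lt_of_ge (h.slope_le hn hD) hab
  · rw [eq_of_evSlope_eq hp hg hq.symm hj e]
    exact Finset.mem_insert_self _ _
  · rcases Finset.mem_insert.1 hD with hD | hD
    · exact hj (Prod.mk.inj hD).2
    · rcases evKey_le.1 (h.down _ hD r j hn.event hn.notMem) with e' | ⟨-, e'⟩
      · exact e'.ne e
      · simp only [evRank, if_neg hq, if_true] at e'
        omega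

/-- After the point `j` has reached the level of the root, no tie in this direction has been
reversed yet. -/
theorem IsPrefix.tie_notMem_open (hp : Function.Injective p) (h : IsPrefix p r D) {j : Fin n}
    (hn : IsNext p r D r j) (a b : Fin n) (ha : a ≠ r) (hb : b ≠ r) (hab : a < b)
    (h0 : dirSign p (evDir p r j) a b = 0) : (a, b) ∉ ((insert (r, j) D : Finset _) : Set _) := by
  intro hD
  rw [dirSign_evDir_eq_zero hp hn.event.1 hab.ne] at h0
  rcases Finset.mem_insert.1 (Finset.mem_coe.1 hD) with hD | hD
  · exact ha (Prod.mk.inj hD).1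
  · rcases evKey_le.1 (h.down _ hD r j hn.event hn.notMem) with e' | ⟨-, e'⟩
    · exact e'.ne h0
    · simp only [evRank, if_neg ha, if_neg hb, if_true] at e'
      omega

theorem curSigns_insert_pair {i j : Fin n} (hi : i ≠ r) (hj : j ≠ r) (hn : (i, j) ∉ D)
    (hn' : (j, i) ∉ D) : curSigns p r (insert (i, j) D) = flipTie (curSigns p r D) i j := by
  funext a b
  by_cases hb : b = r
  · subst hb
    rw [flip_of_ne (by rintro (⟨-, e⟩ | ⟨-, e⟩); exacts [hj e.symm, hi e.symm])]
    unfold curSigns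
    rw [if_pos rfl, if_pos rfl]
    have h1 : (a, b) ∈ insert (i, j) D ↔ (a, b) ∈ D := by
      simp [Finset.mem_insert, Ne.symm hj]
    have h2 : (b, a) ∈ insert (i, j) D ↔ (b, a) ∈ D := by
      simp [Finset.mem_insert, Ne.symm hi]
    simp only [h1, h2]
  · by_cases ha : a = r
    · subst ha
      rw [flip_of_ne (by rintro (⟨e, -⟩ | ⟨e, -⟩); exacts [hi e.symm, hj e.symm])]
      unfold curSigns
      rw [if_neg hb, if_pos rfl, if_neg hb, if_pos rfl]
    · unfold flipTie curSigns
      simp only [if_neg ha, if_neg hb]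
      by_cases e : a = i ∧ b = j ∨ a = j ∧ b = i
      · have h1 : (a, b) ∈ insert (i, j) D ∨ (b, a) ∈ insert (i, j) D := by
          rcases e with ⟨rfl, rfl⟩ | ⟨rfl, rfl⟩ <;> simp
        have h2 : ¬ ((a, b) ∈ D ∨ (b, a) ∈ D) := by
          rcases e with ⟨rfl, rfl⟩ | ⟨rfl, rfl⟩ <;> tauto
        rw [if_pos h1, if_pos e, if_neg h2]
      · rw [if_neg e]
        have h1 : ((a, b) ∈ insert (i, j) D ∨ (b, a) ∈ insert (i, j) D) ↔
            ((a, b) ∈ D ∨ (b, a) ∈ D) := by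
          simp only [Finset.mem_insert, Prod.mk.injEq]
          tauto
        simp only [h1]

/-- A departure would override the zero sign, hence the requirement that it has not been processed.
-/
theorem curSigns_insert_open (hD : ∀ e ∈ D, IsEvent r e.1 e.2) {j : Fin n} (hj : j ≠ r)
    (hn : (j, r) ∉ D) :
    curSigns p r (insert (r, j) D) = setEntry (curSigns p r D) j r 0 := by
  funext a b
  unfold setEntry
  by_cases e : a = j ∧ b = r
  · obtain ⟨rfl, rfl⟩ := e
    unfold curSigns
    simp [hn, hj]
  · rw [if_neg e]
    unfold curSigns
    by_cases hb : b = r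
    · subst hb
      have : a ≠ j := fun h => e ⟨h, rfl⟩
      simp [Finset.mem_insert, this, Ne.symm hj]
    · rw [if_neg hb, if_neg hb]
      by_cases ha : a = r
      · rw [if_pos ha, if_pos ha]
      · rw [if_neg ha, if_neg ha]
        simp [Finset.mem_insert, ha, hb]

/-- The row of the root never changes and keeps the sign that the departing point is to receive. The
machine just copies it. -/
theorem curSigns_insert_close {i : Fin n} (hi : i ≠ r) :
    curSigns p r (insert (i, r) D) = setEntry (curSigns p r D) i r (curSigns p r D r i) := by
  funext a b
  unfold setEntry
  by_cases e : a = i ∧ b = r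
  · obtain ⟨rfl, rfl⟩ := e
    unfold curSigns
    simp [hi]
  · rw [if_neg e]
    unfold curSigns
    by_cases hb : b = r
    · subst hb
      have : a ≠ i := fun h => e ⟨h, rfl⟩
      simp [Finset.mem_insert, this, Ne.symm hi]
    · rw [if_neg hb, if_neg hb]
      by_cases ha : a = r
      · rw [if_pos ha, if_pos ha]
      · rw [if_neg ha, if_neg ha]
        simp [Finset.mem_insert, ha, hb]

/-- `A` is the least total of the refinements of the signs of the direction `u` in which only the
ties in `D` are free. -/
structure IsBest (p : Fin n → Plane) (r : Fin n) (u : Plane) (D : Finset (Fin n × Fin n)) (A : ℝ) :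
    Prop where
  le : ∀ σ, Refines r (dirSign p u) (sg p) D σ → A ≤ total p r σ
  exists_le : ∃ σ, Refines r (dirSign p u) (sg p) D σ ∧ total p r σ ≤ A

theorem IsBest.of_refines {u : Plane} {σ : Fin n → Fin n → ℝ}
    (h : Refines r (dirSign p u) (sg p) D σ)
    (hD : ∀ a b, a ≠ r → b ≠ r → a < b → dirSign p u a b = 0 → (a, b) ∉ (D : Set (Fin n × Fin n))) :
    IsBest p r u D (total p r σ) :=
  ⟨fun _ hσ' => (h.total_eq hσ' (dirSign_swap p u) hD).le, σ, h, le_rfl⟩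

theorem IsBest.congr {u u' : Plane} {A : ℝ} (h : IsBest p r u D A)
    (hu : dirSign p u = dirSign p u') : IsBest p r u' D A := by
  obtain ⟨h1, h2⟩ := h
  rw [hu] at h1 h2
  exact ⟨h1, h2⟩

theorem dirSign_evDir_congr (hp : Function.Injective p) {i j a b : Fin n} (hij : i ≠ j)
    (hab : a ≠ b) (h : evSlope p i j = evSlope p a b) :
    dirSign p (evDir p i j) = dirSign p (evDir p a b) :=
  dirSign_congr hp (evDir_upper hp hij) (evDir_upper hp hab) h

/-- Reversing the tie `i`, `j`. -/
theorem IsBest.insert_pair (hp : Function.Injective p) (hg : GeneralPosition p) {i j : Fin n}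
    (hi : i ≠ r) (hj : j ≠ r) (hij : i < j) (hn : (i, j) ∉ D) {A : ℝ}
    {σ : Fin n → Fin n → ℝ} (hσ : Refines r (dirSign p (evDir p i j)) (sg p) D σ)
    (h : IsBest p r (evDir p i j) D A) :
    IsBest p r (evDir p i j) (insert (i, j) D)
      (A + min 0 (total p r (flipTie σ i j) - total p r σ)) := by
  have h0 : dirSign p (evDir p i j) i j = 0 := (dirSign_evDir_eq_zero hp hij.ne hij.ne).2 rfl
  have h0' : dirSign p (evDir p i j) j i = 0 := by rw [dirSign_swap, h0, neg_zero]
  have hu := (evDir_upper hp hij.ne).ne_zero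
  have h1 := fun q (hq : q ≠ i) (hq' : q ≠ j) => hg.dirSign_ne_zero hu h0 hij.ne q hq hq'
  have h2 := fun q (hq : q ≠ i) (hq' : q ≠ j) => hg.dirSign_ne_zero hu h0' hij.ne' q hq' hq
  have hsw := dirSign_swap p (evDir p i j)
  refine ⟨fun σ' hσ' => ?_, ?_⟩
  · rw [Finset.coe_insert] at hσ'
    exact hσ.total_insert_ge h.le hsw hi hj hij h0 (by simpa using hn) (sg_eq p i j) h1 h2 σ' hσ'
  · obtain ⟨σ', hσ', hA⟩ := h.exists_le
    have hm : Refines r (dirSign p (evDir p i j)) (sg p) (insert (i, j) D : Finset _) σ' :=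
      hσ'.mono fun a b _ _ _ _ hab => ⟨fun h' => hab (by simpa using Or.inr h'), rfl⟩
    -- A least refinement is kept as it is or has the new tie reversed, according to the sign of the
    -- gain.
    rcases min_cases 0 (total p r (flipTie σ i j) - total p r σ) with ⟨e, -⟩ | ⟨e, -⟩
    · exact ⟨σ', hm, by rw [e]; linarith⟩
    · refine ⟨flipTie σ' i j, hm.flip hsw hi hj hij h0 (by simp), ?_⟩
      have := hσ.total_flip_sub_eq hσ' (p := p) hi hj hij h0 (by simpa using hn) h1 h2
      rw [e]
      linarith

end RealRAM

/-! ### The queue of events and the processing of one event -/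

namespace RealRAM

open Geo

variable {n : ℕ} {p : Fin n → Plane} {r : Fin n} {D : Finset (Fin n × Fin n)} {s : State} {L : ℕ}

/-- The item at the root of the tournament tree of the events. -/
def nextItem : NExp := .get 3 (.add (.add (.reg 2) (.reg 2)) (.lit 1))

/-- The leaves of the tournament tree of the events when those in `D` have been processed. -/
def evItem (r : Fin n) (D : Finset (Fin n × Fin n)) : Fin n → Fin n → ℕ := fun i j =>
  if (i, j) ∈ D then n * n + cell r r else n * n + cell i j

theorem evItem_insert (i j : Fin n) :
    evItem r (insert (i, j) D) = setEntry (evItem r D) i j (n * n + cell r r) := by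
  funext a b
  unfold setEntry evItem
  by_cases e : a = i ∧ b = j
  · rw [if_pos e, e.1, e.2, if_pos (Finset.mem_insert_self _ _)]
  · rw [if_neg e]
    simp [Finset.mem_insert, e]

theorem not_isEvent_self (r : Fin n) : ¬ IsEvent r r r := fun h => h.1 rfl

theorem evRank_le (r i j : Fin n) : evRank r i j ≤ 2 := by
  unfold evRank
  split_ifs <;> omega

theorem Const.event_key (h : Const p r s) {i j : Fin n} (hij : IsEvent r i j) :
    s.key (n * n + cell i j) = evKey p r i j := by
  unfold State.key evKey evSlope
  rw [h.eventX i j hij, h.eventY i j hij, h.eventT i j hij]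

/-- Events may have slope `⊤` themselves, but their ranks are at most 2; rank 3 puts the dead items
after all of them. -/
theorem Const.dead_key (h : Const p r s) {i j : Fin n} (hij : ¬ IsEvent r i j) :
    s.key (n * n + cell i j) = toLex (⊤, 3) := by
  unfold State.key
  rw [h.deadX i j hij, h.deadY i j hij, h.deadT i j hij, invSlope, if_pos rfl]

theorem evItem_cases (r : Fin n) (D : Finset (Fin n × Fin n)) (i j : Fin n) :
    (IsEvent r i j ∧ (i, j) ∉ D ∧ evItem r D i j = n * n + cell i j) ∨
      ∃ a b, ¬ IsEvent r a b ∧ evItem r D i j = n * n + cell a b := by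
  unfold evItem
  by_cases h : (i, j) ∈ D
  · right
    exact ⟨r, r, not_isEvent_self r, by rw [if_pos h]⟩
  · rw [if_neg h]
    by_cases h' : IsEvent r i j
    · exact Or.inl ⟨h', h, rfl⟩
    · exact Or.inr ⟨i, j, h', rfl⟩

/-- The root of the tournament tree of the events holds a next event, if there is one. -/
theorem Ready.next (hp : Function.Injective p) {σ : Fin n → Fin n → ℝ} {M : Fin n → Fin n → ℕ}
    (h : Ready p r s σ M (evItem r D)) :
    (∃ i j, IsNext p r D i j ∧ s.narr 3 (n * n + n * n + 1) = n * n + cell i j) ∨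
      (¬ s.narr 5 (s.narr 3 (n * n + n * n + 1)) < 3 ∧ ∀ i j, IsEvent r i j → (i, j) ∈ D) := by
  have hn : 1 ≤ n := by have := r.2; omega
  have hnn : 1 ≤ n * n := Nat.mul_pos hn hn
  have hc := h.const
  have hleaf : ∀ k, n * n ≤ k → k < 2 * (n * n) → ∃ i j : Fin n, k = n * n + cell i j :=
    fun k h1 h2 => by
      have h3 : k - n * n < n * n := by omega
      refine ⟨⟨(k - n * n) / n, Nat.div_lt_of_lt_mul h3⟩, ⟨(k - n * n) % n, Nat.mod_lt _ hn⟩, ?_⟩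
      have := Nat.div_add_mod' (k - n * n) n
      simp only [cell]
      omega
  have hroot : ∀ i j : Fin n, s.key (s.narr 3 (n * n + n * n + 1)) ≤ s.key (evItem r D i j) :=
    fun i j => by
      have := h.queue.tour.root_le s.key (fun x => Upper (s.rarr 2 x) (s.rarr 3 x))
        (fun x y hx hy => s.before_iff hx hy) (fun k h1 h2 => ?_) (n * n + cell i j) (by omega)
        (by have := cell_lt i j; omega)
      · rwa [h.queue.leaf] at this
      · obtain ⟨i, j, rfl⟩ := hleaf k h1 h2
        rw [h.queue.leaf]
        rcases evItem_cases r D i j with ⟨h1, -, h2⟩ | ⟨a, b, h1, h2⟩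
        · rw [h2, hc.eventX i j h1, hc.eventY i j h1]
          exact ev_upper hp h1.1
        · rw [h2, hc.deadX a b h1, hc.deadY a b h1]
          exact Or.inr ⟨rfl, one_pos⟩
  obtain ⟨k, h1, h2, h3⟩ := h.queue.tour.exists_leaf _ 1 le_rfl (by omega) le_rfl
  obtain ⟨i, j, rfl⟩ := hleaf k h1 h2
  rw [h.queue.leaf] at h3
  rw [h3] at hroot ⊢
  have hev : ∀ a b, IsEvent r a b → (a, b) ∉ D → evItem r D a b = n * n + cell a b :=
    fun a b _ hD => if_neg hD
  rcases evItem_cases r D i j with ⟨e1, e2, e3⟩ | ⟨a, b, e1, e2⟩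
  · left
    refine ⟨i, j, ⟨e1, e2, fun a b hab hD => ?_⟩, e3⟩
    have := hroot a b
    rwa [hev a b hab hD, e3, hc.event_key e1, hc.event_key hab] at this
  · right
    rw [e2] at hroot ⊢
    refine ⟨by rw [hc.deadT a b e1]; omega, fun i' j' hij => ?_⟩
    by_contra hD
    have := hroot i' j'
    rw [hev i' j' hij hD, hc.event_key hij, hc.dead_key e1, evKey, Prod.Lex.toLex_le_toLex] at this
    have h2 := evRank_le r i' j'
    rcases this with this | this
    · exact not_top_lt this
    · have := this.2
      omega

/-- The processing of one event of the sweep, up to the change of the current least total. -/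
def handle : Prog :=
  .ite (.conj (.nlt (.lit 0) (.get 5 (.reg 6))) (.nlt (.get 5 (.reg 6)) (.lit 2)))
    (.block [
      .setR 5 (.reg 2),
      flipProg 7 8,
      .ite (.rlt (.reg 2) (.reg 5)) (.setR 3 (.add (.reg 3) (.sub (.reg 2) (.reg 5)))) .skip])
    (.ite (.nlt (.get 5 (.reg 6)) (.lit 1))
      (.block [.putR 4 (pairAt 8 1) (.lit 0), column 8, .setR 3 (.reg 2)])
      (.block [.putR 4 (pairAt 7 1) (.get 4 (pairAt 1 7)), column 7]))

/-- Recording of the current direction, if it is the best one so far. -/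
def record : Prog :=
  .ite (.rlt (.reg 3) (.reg 4))
    (.block [.setR 4 (.reg 3), .setR 0 (.get 2 (.reg 6)), .setR 1 (.get 3 (.reg 6))]) .skip

/-- Removal of the current event, and reset of the current least total if the next event has
another direction. -/
def advance : Prog := .block [
  .setN 40 (.add (.reg 2) (.reg 2)),
  .setN 41 (.reg 6),
  .setN 42 (.add (.reg 2) (pairAt 1 1)),
  update,
  .setN 9 nextItem,
  .ite (.rlt (.mul (.get 2 (.reg 6)) (.get 3 (.reg 9))) (.mul (.get 3 (.reg 6)) (.get 2 (.reg 9))))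
    (.setR 3 (.reg 2)) .skip]

/-- The sweep through the directions of all events. -/
def sweep : Prog :=
  .while (.nlt (.get 5 nextItem) (.lit 3)) (.block [
    .setN 6 nextItem,
    .setN 7 (.get 6 (.sub (.reg 6) (.reg 2))),
    .setN 8 (.get 7 (.sub (.reg 6) (.reg 2))),
    handle,
    record,
    advance])

/-- The invariant of the sweep. -/
structure Sweeping (p : Fin n → Plane) (r : Fin n) (D : Finset (Fin n × Fin n)) (s : State) :
    Prop where
  pre : IsPrefix p r D
  ready : Ready p r s (curSigns p r D) (item (curSigns p r D) r) (evItem r D)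
  cur : ∀ i j, IsNext p r D i j → 1 ≤ evRank r i j → IsBest p r (evDir p i j) D (s.rreg 3)
  lower : ∀ e ∈ D, ∀ σ, Refines r (dirSign p (evDir p e.1 e.2)) (sg p) D σ →
    s.rreg 4 ≤ total p r σ
  ne_zero : outputDirection s ≠ 0
  upper : ∃ σ, Refines r (dirSign p (outputDirection s)) (sg p) Set.univ σ ∧
    total p r σ ≤ s.rreg 4

/-- The time for an event. -/
def price (L : ℕ) (r : Fin n) (e : Fin n × Fin n) : ℕ :=
  if e.1 = r ∨ e.2 = r then (n + 1) * (200 * (L + 1) + 110) + (200 * (L + 1) + 400)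
  else 600 * (L + 1) + 800

open Classical in
/-- The time for the remaining events. -/
noncomputable def budget (L : ℕ) (r : Fin n) (D : Finset (Fin n × Fin n)) : ℕ :=
  ∑ e ∈ Finset.univ.filter (fun e : Fin n × Fin n => IsEvent r e.1 e.2) \ D, price L r e

theorem budget_insert {i j : Fin n} (h : IsNext p r D i j) :
    budget L r (insert (i, j) D) + price L r (i, j) = budget L r D := by
  classical
  unfold budget
  rw [Finset.sdiff_insert, Finset.sum_erase_add]
  simp only [Finset.mem_sdiff, Finset.mem_filter, Finset.mem_univ, true_and]
  exact ⟨h.event, h.notMem⟩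

/-- The sign of `i` against the root is read only when `i` itself is the candidate. -/
theorem item_setEntry_root {σ : Fin n → Fin n → ℝ} {i : Fin n} {v : ℝ} {a q : Fin n}
    (hq : q ≠ i) : item (setEntry σ i r v) r a q = item σ r a q := by
  unfold item
  by_cases hr : q = r
  · rw [hr, choice_root, choice_root]
  · unfold choice setEntry
    simp [hq, hr]

theorem evRank_eq_one {i j : Fin n} (hi : i ≠ r) (hj : j ≠ r) : evRank r i j = 1 := by
  unfold evRank
  rw [if_neg hi, if_neg hj]

/-- There are three kinds of events. An arrival is the first event of its direction, so the least
total restarts from the current total. A reversal adds its gain to the least total if the gain is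
negative. A departure changes the signs for later directions but not the least total. The time
subtracted from the price is left for recording and removal. -/
theorem handle_ends (hp : Function.Injective p) (hg : GeneralPosition p)
    (h : Sweeping p r D s) (hL : 2 * (n * n) ≤ 2 ^ (L + 1)) {i j : Fin n} (hn : IsNext p r D i j)
    (h6 : s.nreg 6 = n * n + cell i j) (h7 : s.nreg 7 = i) (h8 : s.nreg 8 = j) :
    Ends handle s (price L r (i, j) - 200 * (L + 1) - 200) fun s' =>
      Keeps 20 { s with rreg := s'.rreg } s' ∧ s'.rreg 4 = s.rreg 4 ∧
      outputDirection s' = outputDirection s ∧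
      Ready p r s' (curSigns p r (insert (i, j) D)) (item (curSigns p r (insert (i, j) D)) r)
        (evItem r D) ∧
      IsBest p r (evDir p i j) (insert (i, j) D) (s'.rreg 3) := by
  have hc := h.ready.const
  have hT := hc.eventT i j hn.event
  have hrow := hc.row
  have hroot := hc.root
  by_cases hi : i = r
  · subst hi
    have hj : j ≠ i := hn.event.1.symm
    -- The departure of `j` has the same slope as its arrival but a larger rank.
    have hji : (j, i) ∉ D := fun hD => by
      rcases evKey_le.1 (h.pre.down _ hD i j hn.event hn.notMem) with e | ⟨-, e⟩
      · rw [evSlope_swap hp hj] at e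
        exact lt_irrefl _ e
      · simp only [evRank, if_neg hj, if_true] at e
        omega
    have hrank : evRank i i j = 0 := if_pos rfl
    rw [hrank] at hT
    have hcs := curSigns_insert_open (p := p) h.pre.event hj hji
    have hready := h.ready.setSign j i 0
    rw [← hcs] at hready
    refine (Ends.ite_neg ?_ (Ends.ite_pos ?_ (Ends.cons (Ends.putR (Ends.cons (k' := 4)
      ((column_ends (p := p) (r := i) (σ := curSigns p i (insert (i, j) D)) (E := evItem i D)
        (M := item (curSigns p i D) i) ?_ hL (by decide) (q := j) ?_).imp ?_)))))).within ?_
    · simp [Test.Holds, NExp.eval, h6, hT]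
    · simp [Test.Holds, NExp.eval, h6, hT]
    · simpa [pairAt, NExp.eval, RExp.eval, h8, hrow, hroot, cell] using hready
    · simpa using h8
    · rintro s1 ⟨k1, r1⟩
      refine (Ends.cons (Ends.setR (Ends.nil ?_))).within (by simp [RExp.time])
      have hitem : (fun a q' => if q' = j then item (curSigns p i (insert (i, j) D)) i a q'
          else item (curSigns p i D) i a q') = item (curSigns p i (insert (i, j) D)) i := by
        funext a q
        split_ifs with e
        · rfl
        · rw [hcs, item_setEntry_root e]
      rw [hitem] at r1
      refine ⟨⟨fun x hx => k1.nreg x hx, fun _ _ => rfl, fun a ha => k1.narr a ha, fun a ha => ?_⟩,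
        ?_, ?_, ?_, ?_⟩
      · refine (k1.rarr a ha).trans ?_
        simp [ha]
      · simpa using k1.rreg 4 (by decide)
      · unfold outputDirection
        have e0 := k1.rreg 0 (by decide)
        have e1 := k1.rreg 1 (by decide)
        simp only at e0 e1
        simp [e0, e1]
      · exact r1.of_eq (fun _ _ => rfl) (fun _ _ => rfl) rfl (by simp)
      · simp only [RExp.eval, Function.update_self]
        rw [r1.total]
        exact IsBest.of_refines (h.pre.refines_open hp hg hn) (h.pre.tie_notMem_open hp hn)
    · simp only [Test.time, NExp.time, RExp.time, pairAt, price, true_or, if_true]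
      omega
  by_cases hj : j = r
  · subst hj
    have hrank : evRank j i j = 2 := by unfold evRank; rw [if_neg hi, if_pos rfl]
    rw [hrank] at hT
    have hcs := curSigns_insert_close (p := p) (D := D) hi
    have hready := h.ready.setSign i j (curSigns p j D j i)
    rw [← hcs] at hready
    have hsign : s.rarr 4 (j * n + i) = curSigns p j D j i := h.ready.signs j i
    refine (Ends.ite_neg ?_ (Ends.ite_neg ?_ (Ends.cons (Ends.putR (Ends.cons (k' := 1)
      ((column_ends (p := p) (r := j) (σ := curSigns p j (insert (i, j) D)) (E := evItem j D)
        (M := item (curSigns p j D) j) ?_ hL (by decide) (q := i) ?_).imp ?_)))))).within ?_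
    · simp [Test.Holds, NExp.eval, h6, hT]
    · simp [Test.Holds, NExp.eval, h6, hT]
    · simpa [pairAt, NExp.eval, RExp.eval, h7, hrow, hroot, hsign, cell] using hready
    · simpa using h7
    · rintro s1 ⟨k1, r1⟩
      refine Ends.nil ?_
      have hitem : (fun a q' => if q' = i then item (curSigns p j (insert (i, j) D)) j a q'
          else item (curSigns p j D) j a q') = item (curSigns p j (insert (i, j) D)) j := by
        funext a q
        split_ifs with e
        · rfl
        · rw [hcs, item_setEntry_root e]
      rw [hitem] at r1
      refine ⟨⟨fun x hx => k1.nreg x hx, fun _ _ => rfl, fun a ha => k1.narr a ha, fun a ha => ?_⟩,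
        ?_, ?_, r1, ?_⟩
      · refine (k1.rarr a ha).trans ?_
        simp [ha]
      · simpa using k1.rreg 4 (by decide)
      · unfold outputDirection
        rw [k1.rreg 0 (by decide), k1.rreg 1 (by decide)]
      · rw [k1.rreg 3 (by decide)]
        have hA := h.cur i j hn (by rw [hrank]; decide)
        -- A pair that contains the root is never a free tie, so adding it to the processed set does
        -- not change the refinements.
        have hiff : ∀ σ, Refines j (dirSign p (evDir p i j)) (sg p) D σ ↔
            Refines j (dirSign p (evDir p i j)) (sg p) (insert (i, j) D : Finset _) σ := fun σ =>
          ⟨fun hσ => hσ.mono fun a b _ _ _ _ hab => ⟨fun hD => hab (by simpa using Or.inr hD), rfl⟩,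
            fun hσ => hσ.mono fun a b _ hb _ _ hab => ⟨fun hD => hab (by
              rcases Finset.mem_insert.1 (Finset.mem_coe.1 hD) with hD | hD
              · exact absurd (Prod.mk.inj hD).2 hb
              · exact hD), rfl⟩⟩
        obtain ⟨σ, hσ, hσA⟩ := hA.exists_le
        exact ⟨fun σ hσ => hA.le σ ((hiff σ).2 hσ), σ, (hiff σ).1 hσ, hσA⟩
    · simp only [Test.time, NExp.time, RExp.time, pairAt, price, or_true, if_true]
      omega
  · have hrank := evRank_eq_one hi hj
    have hij : i < j := by
      rcases hn.event.2 with e | e | e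
      · exact absurd e hi
      · exact absurd e hj
      · exact e
    have hji : (j, i) ∉ D := fun hD => by
      rcases (h.pre.event _ hD).2 with e | e | e
      · exact hj e
      · exact hi e
      · exact lt_asymm hij e
    rw [hrank] at hT
    have hcs := curSigns_insert_pair (p := p) hi hj hn.notMem hji
    have hW := h.ready.total
    have hbest := (h.cur i j hn (by rw [hrank])).insert_pair hp hg hi hj hij hn.notMem
      (h.pre.refines hp hg hn (by rw [hrank]))
    rw [← hcs] at hbest
    refine (Ends.ite_pos ?_ (Ends.cons (Ends.setR (Ends.cons (k' := 30)
      ((flipProg_ends (x := 7) (y := 8) (p := p) (r := r) (σ := curSigns p r D) (E := evItem r D)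
        ?_ hL (by decide) (by decide)
        (i := i) (j := j) ?_ ?_ hij.ne hi hj).imp ?_))))).within ?_
    · simp [Test.Holds, NExp.eval, h6, hT]
    · exact h.ready.of_eq (fun _ _ => rfl) (fun _ _ => rfl) rfl (by simp)
    · simpa using h7
    · simpa using h8
    · rintro s1 ⟨k1, r1⟩
      rw [← hcs] at r1
      have hW1 := r1.total
      have h5 : s1.rreg 5 = s.rreg 2 := by
        rw [k1.rreg 5 (by decide)]
        simp [RExp.eval]
      have h3 : s1.rreg 3 = s.rreg 3 := by
        rw [k1.rreg 3 (by decide)]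
        simp
      have h4 : s1.rreg 4 = s.rreg 4 := by
        rw [k1.rreg 4 (by decide)]
        simp
      have hd : outputDirection s1 = outputDirection s := by
        unfold outputDirection
        rw [k1.rreg 0 (by decide), k1.rreg 1 (by decide)]
        simp
      refine (Ends.cons (Ends.ite (fun hb => Ends.setR (Ends.nil ?_))
        fun hb => Ends.skip (Ends.nil ?_))).within ?_
      · simp only [Test.Holds, RExp.eval, h5] at hb
        refine ⟨⟨fun x hx => k1.nreg x (by omega), fun _ _ => rfl, fun a ha => k1.narr a ha,
          fun a ha => k1.rarr a ha⟩, by simpa using h4, by simpa [outputDirection] using hd,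
          r1.of_eq (fun _ _ => rfl) (fun _ _ => rfl) rfl (by simp), ?_⟩
        simp only [RExp.eval, Function.update_self, h3, h5]
        rw [hW1, hW] at hb ⊢
        rwa [min_eq_right (by linarith)] at hbest
      · simp only [Test.Holds, RExp.eval, h5] at hb
        refine ⟨⟨fun x hx => k1.nreg x (by omega), fun _ _ => rfl, fun a ha => k1.narr a ha,
          fun a ha => k1.rarr a ha⟩, h4, hd, r1, ?_⟩
        rw [hW1, hW] at hb
        rwa [min_eq_left (by linarith), add_zero, ← h3] at hbest
      · simp [Test.time, RExp.time]
    · simp only [Test.time, NExp.time, RExp.time, price, hi, hj, or_self, if_false]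
      omega

end RealRAM

/-! ### One step of the sweep, and the whole sweep -/

namespace RealRAM

open Geo

variable {n : ℕ} {p : Fin n → Plane} {r : Fin n} {D : Finset (Fin n × Fin n)} {s : State} {L : ℕ}

theorem record_ends {i j : Fin n} (h6 : s.nreg 6 = n * n + cell i j) (hn : IsEvent r i j)
    (hc : Const p r s) : Ends record s 30 fun s' => ∃ rr, s' = { s with rreg := rr } ∧
      rr 2 = s.rreg 2 ∧ rr 3 = s.rreg 3 ∧ rr 4 ≤ s.rreg 3 ∧ rr 4 ≤ s.rreg 4 ∧
      (outputDirection s' = outputDirection s ∧ rr 4 = s.rreg 4 ∨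
        outputDirection s' = evDir p i j ∧ rr 4 = s.rreg 3) := by
  refine (Ends.ite (fun hb => Ends.cons (Ends.setR (Ends.cons (Ends.setR (Ends.cons (Ends.setR
    (Ends.nil ?_))))))) fun hb => Ends.skip ?_).within ?_
  · simp only [Test.Holds, RExp.eval] at hb
    refine ⟨_, rfl, ?_⟩
    simp [RExp.eval, NExp.eval, h6, hc.eventX i j hn, hc.eventY i j hn, outputDirection, evDir,
      hb.le]
  · simp only [Test.Holds, RExp.eval, not_lt] at hb
    exact ⟨s.rreg, rfl, rfl, rfl, hb, le_rfl, Or.inl ⟨rfl, rfl⟩⟩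
  · simp [Test.time, RExp.time, NExp.time]

/-- The cells of the candidate trees are untouched, so the maintained sum needs no correction. -/
theorem Ready.update_queue {σ : Fin n → Fin n → ℝ} {M E : Fin n → Fin n → ℕ} {i j : Fin n} {v : ℕ}
    (h : Ready p r s σ M E) {T nr : ℕ → ℕ} (hnr : ∀ x, x < 3 → nr x = s.nreg x)
    (hT : ∀ x, x < n * n + n * n + 1 ∨ n * n + n * n + n * n ≤ x →
      x ≠ n * n + n * n + (n * n + cell i j) → T x = s.narr 3 x)
    (hv : T (n * n + n * n + (n * n + cell i j)) = v)
    (ht : IsTournament s.Before T (n * n + n * n) (n * n) 0) :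
    Ready p r { s with nreg := nr, narr := Function.update s.narr 3 T } σ M (setEntry E i j v) := by
  have hk : Keeps 3 s { s with nreg := nr, narr := Function.update s.narr 3 T } :=
    ⟨hnr, fun _ _ => rfl, fun a ha => by simp [ha], fun _ _ => rfl⟩
  have hn : 1 ≤ n * n := Nat.mul_pos (by have := i.2; omega) (by have := i.2; omega)
  refine ⟨h.const.of_keeps hk le_rfl, h.signs, ?_, ?_, ?_⟩
  · rw [hk.before]
    simp only [Function.update_self]
    exact h.forest.outside hT le_rfl (by omega)
  · rw [hk.before]
    simp only [Function.update_self]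
    exact h.queue.set hT hv ht
  · have hs := h.sum
    simp only [rootSum, Function.update_self] at hs ⊢
    rw [hs]
    refine Finset.sum_congr rfl fun a _ => ?_
    have := mul_add_le_of_lt n a.2
    have := a.2
    rw [hT _ (by omega) (by omega)]

/-- Only ties in the direction of an event are affected by it. -/
theorem refines_of_insert (hp : Function.Injective p) {i j a b : Fin n} (hij : i ≠ j) (hab : a ≠ b)
    (h : evSlope p a b ≠ evSlope p i j) {σ : Fin n → Fin n → ℝ}
    (hσ : Refines r (dirSign p (evDir p a b)) (sg p) (insert (i, j) D : Finset _) σ) :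
    Refines r (dirSign p (evDir p a b)) (sg p) D σ := by
  refine hσ.mono fun x y _ _ hxy h0 hD => ⟨fun hD' => ?_, rfl⟩
  rcases Finset.mem_insert.1 (Finset.mem_coe.1 hD') with e | e
  · obtain ⟨rfl, rfl⟩ := Prod.mk.inj e
    exact h ((dirSign_evDir_eq_zero hp hab hij).1 h0).symm
  · exact hD e

theorem _root_.Geo.Refines.to_univ {g b b' : Fin n → Fin n → ℝ} {Q : Set (Fin n × Fin n)}
    {σ : Fin n → Fin n → ℝ} (h : Refines r g b Q σ) : Refines r g b' Set.univ σ :=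
  h.mono fun _ _ _ _ _ _ hn => absurd (Set.mem_univ _) hn

/-- If the next event has the same slope, the least total carries over. If its slope is larger and
its rank positive, no tie of the new direction has been reversed, so the current total is the least
one. Rank 0 is excluded because an arrival resets the value itself. -/
theorem advance_ends (hp : Function.Injective p) (hg : GeneralPosition p)
    (hL : 2 * (n * n) ≤ 2 ^ (L + 1)) (hD : IsPrefix p r D) {i j : Fin n} (hn : IsNext p r D i j)
    (h6 : s.nreg 6 = n * n + cell i j)
    (hr : Ready p r s (curSigns p r (insert (i, j) D)) (item (curSigns p r (insert (i, j) D)) r)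
        (evItem r D))
    (hA : IsBest p r (evDir p i j) (insert (i, j) D) (s.rreg 3)) :
    Ends advance s (200 * (L + 1) + 100) fun s' =>
      s'.rreg 4 = s.rreg 4 ∧ outputDirection s' = outputDirection s ∧
      Ready p r s' (curSigns p r (insert (i, j) D)) (item (curSigns p r (insert (i, j) D)) r)
        (evItem r (insert (i, j) D)) ∧
      ∀ a b, IsNext p r (insert (i, j) D) a b → 1 ≤ evRank r a b →
        IsBest p r (evDir p a b) (insert (i, j) D) (s'.rreg 3) := by
  have hc := hr.const
  have hcell := cell_lt i j
  have hD' := hD.extend hn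
  refine (Ends.cons (Ends.setN (Ends.cons (Ends.setN (Ends.cons (Ends.setN (Ends.cons (k' := 50)
    ((update_ends (lt := s.Before) (b := n * n + n * n) (m := n * n) (i := n * n + cell i j)
      (v := n * n + cell r r) (L := L) ?_ ?_ ?_ (by omega) (by omega) (by omega) ?_ ?_ ?_).imp
      ?_)))))))).within ?_
  · simp [NExp.eval, hc.sq]
  · simp [NExp.eval, h6]
  · simp [NExp.eval, pairAt, hc.sq, hc.row, hc.root, cell]
  · simpa using hc.half
  · intro x y
    rfl
  · exact hr.queue.tour
  · rintro s1 ⟨nr, T, rfl, h1, h2, h3, h4⟩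
    have hnr : ∀ x, x < 40 → nr x = s.nreg x := fun x hx => by
      rw [h1 x (by omega)]
      simp [show x ≠ 40 by omega, show x ≠ 41 by omega, show x ≠ 42 by omega]
    have hr1 := hr.update_queue (nr := nr) (fun x hx => hnr x (by omega)) h4 h3 h2
    rw [← evItem_insert] at hr1
    have hitem : (nextItem.eval { s with nreg := nr, narr := Function.update s.narr 3 T }) =
        T (n * n + n * n + 1) := by
      simp [nextItem, NExp.eval, hnr, hc.sq]
    have hnext := hr1.next hp
    simp only [Function.update_self] at hnext
    have hnr6 : nr 6 = n * n + cell i j := by rw [hnr 6 (by decide), h6]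
    -- Next events need not be unique, but they share their slope, so testing the one found by the
    -- machine decides for all of them.
    have hsame : ∀ a b a' b', IsNext p r (insert (i, j) D) a b →
        IsNext p r (insert (i, j) D) a' b' → evSlope p a b = evSlope p a' b' :=
      fun a b a' b' e e' => le_antisymm
        (evSlope_le_of_evKey_le (e.le a' b' e'.event e'.notMem))
        (evSlope_le_of_evKey_le (e'.le a b e.event e.notMem))
    have hres : ∀ a b, IsNext p r (insert (i, j) D) a b → ∃ a' b',
        IsNext p r (insert (i, j) D) a' b' ∧ T (n * n + n * n + 1) = n * n + cell a' b' := by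
      intro a b hab
      rcases hnext with ⟨a', b', e1, e2⟩ | ⟨-, e⟩
      · exact ⟨a', b', e1, e2⟩
      · exact absurd (e a b hab.event) hab.notMem
    have htest : ∀ a b, IsNext p r (insert (i, j) D) a b →
        ((Test.rlt (.mul (.get 2 (.reg 6)) (.get 3 (.reg 9)))
          (.mul (.get 3 (.reg 6)) (.get 2 (.reg 9)))).Holds
          { s with
            nreg := Function.update nr 9 (T (n * n + n * n + 1))
            narr := Function.update s.narr 3 T } ↔ evSlope p i j < evSlope p a b) := by
      intro a b hab
      obtain ⟨a', b', e1, e2⟩ := hres a b hab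
      rw [hsame a b a' b' hab e1, evSlope, evSlope,
        invSlope_lt_invSlope (ev_upper hp hn.event.1) (ev_upper hp e1.event.1)]
      simp [Test.Holds, RExp.eval, NExp.eval, hnr6, e2, hc.eventX _ _ hn.event,
        hc.eventY _ _ hn.event, hc.eventX _ _ e1.event, hc.eventY _ _ e1.event]
    refine (Ends.cons (Ends.setN (Ends.cons (Ends.ite (fun hb => Ends.setR (Ends.nil ?_))
      fun hb => Ends.skip (Ends.nil ?_))))).within ?_
    · simp only [hitem] at hb ⊢
      refine ⟨by simp, by simp [outputDirection], hr1.of_eq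
        (fun x hx => by simp [show x ≠ 9 by omega]) (fun _ _ => rfl) rfl (by simp), ?_⟩
      intro a b hab hrank
      rw [htest a b hab] at hb
      simp only [RExp.eval, Function.update_self]
      rw [hr.total]
      refine IsBest.of_refines (hD'.refines hp hg hab hrank) fun x y hx hy hxy h0 hm => ?_
      rw [dirSign_evDir_eq_zero hp hab.event.1 hxy.ne] at h0
      rcases Finset.mem_insert.1 (Finset.mem_coe.1 hm) with hm | hm
      · obtain ⟨rfl, rfl⟩ := Prod.mk.inj hm
        exact hb.ne h0
      · have := hD.slope_le hn hm
        rw [h0] at this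
        exact absurd hb (not_lt_of_ge this)
    · simp only [hitem] at hb ⊢
      refine ⟨by simp, by simp [outputDirection], hr1.of_eq
        (fun x hx => by simp [show x ≠ 9 by omega]) (fun _ _ => rfl) rfl (by simp), ?_⟩
      intro a b hab hrank
      rw [htest a b hab] at hb
      refine hA.congr (dirSign_evDir_congr hp hn.event.1 hab.event.1 ?_)
      exact le_antisymm (hD'.slope_le hab (Finset.mem_insert_self _ _)) (not_lt.1 hb)
    · simp [nextItem, NExp.time, RExp.time, Test.time]
  · simp [pairAt, NExp.time]
    omega

theorem sweep_step (hp : Function.Injective p) (hg : GeneralPosition p) (h : Sweeping p r D s)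
    (hL : 2 * (n * n) ≤ 2 ^ (L + 1)) {i j : Fin n} (hn : IsNext p r D i j)
    (hroot : s.narr 3 (n * n + n * n + 1) = n * n + cell i j) :
    Ends (.block [
      .setN 6 nextItem,
      .setN 7 (.get 6 (.sub (.reg 6) (.reg 2))),
      .setN 8 (.get 7 (.sub (.reg 6) (.reg 2))),
      handle, record, advance]) s (price L r (i, j) - 20)
      (Sweeping p r (insert (i, j) D)) := by
  have hc := h.ready.const
  have hitem : nextItem.eval s = n * n + cell i j := by
    simp [nextItem, NExp.eval, hc.sq, hroot]
  have hnr : ∀ x, x < 3 → Function.update (Function.update (Function.update s.nreg 6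
      (n * n + cell i j)) 7 (i : ℕ)) 8 (j : ℕ) x = s.nreg x := fun x hx => by
    simp [show x ≠ 6 by omega, show x ≠ 7 by omega, show x ≠ 8 by omega]
  have h1 : Sweeping p r D { s with nreg := Function.update (Function.update (Function.update
      s.nreg 6 (n * n + cell i j)) 7 (i : ℕ)) 8 (j : ℕ) } :=
    ⟨h.pre, h.ready.of_eq hnr (fun _ _ => rfl) rfl rfl, h.cur, h.lower, h.ne_zero, h.upper⟩
  refine (Ends.cons (Ends.setN (Ends.cons (Ends.setN (Ends.cons (Ends.setN
    (Ends.cons (k := price L r (i, j) - 200 * (L + 1) - 200)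
      (k' := 200 * (L + 1) + 140) ?_))))))).within ?_
  · simp only [hitem, NExp.eval, Function.update_self, hc.sq, hc.fst, hc.snd,
      Function.update_of_ne (show (6 : ℕ) ≠ 7 by decide), Nat.add_sub_cancel_left,
      Function.update_of_ne (show (2 : ℕ) ≠ 7 by decide),
      Function.update_of_ne (show (2 : ℕ) ≠ 6 by decide)]
    refine (handle_ends hp hg h1 hL hn (by simp) (by simp) (by simp)).imp ?_
    rintro s1 ⟨k1, h4, hd, hr, hA⟩
    have h6 : s1.nreg 6 = n * n + cell i j := by
      rw [k1.nreg 6 (by decide)]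
      simp
    refine (Ends.cons (k' := 200 * (L + 1) + 110) ((record_ends h6 hn.event hr.const).imp
      ?_)).within (by omega)
    rintro s2 ⟨rr, rfl, e2, e3, le3, le4, hbest⟩
    refine (Ends.cons (k := 200 * (L + 1) + 100) (k' := 1)
      ((advance_ends (s := { s1 with rreg := rr }) hp hg hL h.pre hn h6
        (hr.of_eq (fun _ _ => rfl) (fun _ _ => rfl) rfl e2) (by simpa only [e3] using hA)).imp
        ?_)).within (by omega)
    rintro s3 ⟨f4, fd, fr, fcur⟩
    replace f4 : s3.rreg 4 = rr 4 := f4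
    refine Ends.nil ⟨h.pre.extend hn, fr, fcur, ?_, ?_, ?_⟩
    · intro e he σ hσ
      rw [f4]
      have hold : e ∈ D → e.1 ≠ e.2 := fun he => (h.pre.event e he).1
      -- In the current direction the new least total covers the larger free set. In any other
      -- direction the new pair is not a tie, so the earlier bound still applies.
      by_cases hs : evSlope p e.1 e.2 = evSlope p i j
      · have hne : e.1 ≠ e.2 := ((h.pre.extend hn).event e he).1
        rw [dirSign_evDir_congr hp hne hn.event.1 hs] at hσ
        exact le3.trans (hA.le σ hσ)
      · rcases Finset.mem_insert.1 he with rfl | he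
        · exact absurd rfl hs
        · refine le4.trans ?_
          rw [h4]
          exact h.lower e he σ (refines_of_insert hp hn.event.1 (hold he) hs hσ)
    · rw [fd]
      rcases hbest with ⟨e, -⟩ | ⟨e, -⟩
      · rw [e, hd]
        exact h.ne_zero
      · rw [e]
        exact (evDir_upper hp hn.event.1).ne_zero
    · rw [fd, f4]
      rcases hbest with ⟨e, e'⟩ | ⟨e, e'⟩
      · rw [e, hd]
        obtain ⟨σ, hσ, hσ'⟩ := h.upper
        exact ⟨σ, hσ, hσ'.trans (by rw [e', h4])⟩
      · rw [e]
        obtain ⟨σ, hσ, hσ'⟩ := hA.exists_le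
        exact ⟨σ, hσ.to_univ, hσ'.trans (by rw [e'])⟩
  · have : 200 * (L + 1) + 400 ≤ price L r (i, j) := by
      unfold price
      split_ifs <;> omega
    generalize price L r (i, j) = P at this ⊢
    simp only [nextItem, NExp.time]
    generalize 200 * (L + 1) = X at this ⊢
    clear hL hnr h1 hitem
    omega

/-- The budget of the unprocessed events bounds the remaining time, and the loop stops just when the
root of the event tree is a dead item. -/
theorem sweep_ends (hp : Function.Injective p) (hg : GeneralPosition p) (h : Sweeping p r ∅ s)
    (hL : 2 * (n * n) ≤ 2 ^ (L + 1)) :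
    Ends sweep s (budget L r ∅ + 10) fun s' => ∃ D, Sweeping p r D s' ∧
      ∀ i j, IsEvent r i j → (i, j) ∈ D := by
  refine (Ends.while (fun k s => ∃ D, Sweeping p r D s ∧ k = budget L r D) ?_ _ s
    ⟨∅, h, rfl⟩).mono (by simp [Test.time, nextItem, NExp.time]) ?_
  · rintro k s ⟨D, hD, rfl⟩ hb
    have hc := hD.ready.const
    rcases hD.ready.next hp with ⟨i, j, hn, hroot⟩ | ⟨e, -⟩
    · refine ⟨_, budget L r (insert (i, j) D), ?_, (sweep_step hp hg hD hL hn hroot).imp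
        fun s' hs' => ⟨_, hs', rfl⟩⟩
      have := budget_insert (L := L) hn
      have : 200 * (L + 1) + 400 ≤ price L r (i, j) := by
        unfold price
        split_ifs <;> omega
      simp only [Test.time, nextItem, NExp.time]
      omega
    · simp only [Test.Holds, nextItem, NExp.eval, hc.sq] at hb
      exact absurd hb e
  · rintro s' ⟨⟨k, D, hD, -⟩, hb⟩
    have hc := hD.ready.const
    rcases hD.ready.next hp with ⟨i, j, hn, hroot⟩ | ⟨-, e⟩
    · simp only [Test.Holds, nextItem, NExp.eval, hc.sq, hroot, hc.eventT i j hn.event] at hb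
      have := evRank_le r i j
      omega
    · exact ⟨D, hD, e⟩

end RealRAM

/-! ### Preparation: tables, trees and the initial candidate -/

namespace RealRAM

open Geo

variable {n : ℕ} {p : Fin n → Plane} {r : Fin n} {s : State} {L : ℕ}

/-- A loop over all pairs of points. -/
def Prog.forPairs (x y : ℕ) (body : Prog) : Prog := .forN x (.reg 0) (.forN y (.reg 0) body)

/-- A loop over all pairs of points, with an invariant for the number of the pairs done. -/
theorem Ends.forPairs {x y : ℕ} {body : Prog} {s : State} {tb : ℕ} (Inv : ℕ → State → Prop)
    (hxy : x ≠ y) (h0 : Inv 0 s) (hsize : ∀ k s, Inv k s → s.nreg 0 = n)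
    (hset : ∀ k s z v, z = x ∨ z = y → Inv k s →
      Inv k { s with nreg := Function.update s.nreg z v })
    (step : ∀ (i j : Fin n) s, Inv (cell i j) s → s.nreg x = i → s.nreg y = j →
      Ends body s tb fun s' => s'.nreg x = i ∧ s'.nreg y = j ∧ Inv (cell i j + 1) s') :
    Ends (.forPairs x y body) s ((n + 1) * ((n + 1) * (tb + 9) + 9)) (Inv (n * n)) := by
  refine Ends.forN (m := n) (tb := (n + 1) * (tb + 9)) (fun k s => Inv (k * n) s) ?_
    (fun k s h => hsize _ s h) fun k s hk hI hx => ?_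
  · simp only [zero_mul]
    exact hset _ _ _ _ (Or.inl rfl) h0
  · refine (Ends.forN (m := n) (bound := .reg 0) (tb := tb)
      (fun l s => s.nreg x = k ∧ Inv (k * n + l) s) ?_
      (fun l s h => hsize _ s h.2) fun l s hl hI hy => ?_).imp fun s' h => ⟨h.1, ?_⟩
    · exact ⟨by simpa [hxy] using hx, hset _ _ _ _ (Or.inr rfl) hI⟩
    · refine (step ⟨k, hk⟩ ⟨l, hl⟩ s hI.2 hI.1 hy).imp fun s' h => ⟨h.2.1, ?_, ?_⟩
      · simpa [hxy] using h.1
      · exact hset _ _ _ _ (Or.inr rfl) h.2.2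
    · rw [Nat.succ_mul]
      exact hset _ _ _ _ (Or.inl rfl) h.2

/-- The offsets of the rows of the arrays of pairs, and the number of the pairs. -/
def rows : Prog := .forN 9 (.reg 0) (.block [
  .putN 2 (.reg 9) (.reg 2),
  .setN 2 (.add (.reg 2) (.reg 0))])

/-- The halves of the indices below twice the number of pairs. -/
def halves : Prog := .forN 9 (.reg 2) (.block [
  .putN 1 (.add (.reg 9) (.reg 9)) (.reg 9),
  .putN 1 (.add (.add (.reg 9) (.reg 9)) (.lit 1)) (.reg 9)])

/-- The state before the tables of pairs are filled. -/
structure Indexed (p : Fin n → Plane) (r : Fin n) (s : State) : Prop where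
  size : s.nreg 0 = n
  root : s.nreg 1 = r
  sq : s.nreg 2 = n * n
  row : ∀ i : Fin n, s.narr 2 i = i * n
  half : ∀ k < 2 * (n * n), s.narr 1 k = k / 2
  tree : s.narr 3 = fun _ => 0
  total : s.rreg 2 = 0
  x : ∀ i : Fin n, s.rarr 0 i = p i 0
  y : ∀ i : Fin n, s.rarr 1 i = p i 1

theorem rows_ends : Ends rows (input p r) ((n + 1) * 20) fun s =>
    s.nreg 0 = n ∧ s.nreg 1 = r ∧ s.nreg 2 = n * n ∧ (∀ i : Fin n, s.narr 2 i = i * n) ∧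
      s.narr 3 = (fun _ => 0) ∧ s.rreg = (input p r).rreg ∧ s.rarr = (input p r).rarr := by
  refine (Ends.forN (m := n) (tb := 9) (fun k s =>
    s.nreg 0 = n ∧ s.nreg 1 = r ∧ s.nreg 2 = k * n ∧ (∀ i < k, s.narr 2 i = i * n) ∧
      s.narr 3 = (fun _ => 0) ∧ s.rreg = (input p r).rreg ∧ s.rarr = (input p r).rarr)
    ?_ ?_ ?_).mono ?_ ?_
  · simp [input]
  · exact fun k s h => h.1
  · rintro k s hk ⟨h0, h1, h2, h3, h4, h5, h6⟩ h9
    refine (Ends.cons (Ends.putN (Ends.cons (Ends.setN (Ends.nil ?_))))).within ?_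
    rotate_left
    · simp [NExp.time]
    refine ⟨?_, ?_, ?_, ?_, ?_, ?_, h5, h6⟩
    · simpa [NExp.eval] using h9
    · simpa [NExp.eval] using h0
    · simpa [NExp.eval] using h1
    · simp [NExp.eval, h0, h2, Nat.succ_mul]
    · intro i hi
      simp only [NExp.eval, h9, h2, Function.update_self, Function.update_apply]
      split_ifs with e
      · rw [e]
      · exact h3 i (by omega)
    · simpa using h4
  · simp only [NExp.time]
    exact Nat.mul_le_mul_left _ (by omega)
  · rintro s ⟨h0, h1, h2, h3, h⟩
    exact ⟨h0, h1, h2, fun i => h3 i i.2, h⟩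

theorem halves_ends : Ends (.block [rows, halves]) (input p r) ((n + 1) * 20 + (n * n + 1) * 30 + 1)
    (Indexed p r) := by
  refine (Ends.cons (k' := (n * n + 1) * 30 + 1) (rows_ends.imp ?_)).within (by omega)
  rintro s ⟨h0, h1, h2, h3, h4, h5, h6⟩
  refine (Ends.cons (k' := 1) ((Ends.forN (m := n * n) (tb := 15) (fun k s =>
    s.nreg 0 = n ∧ s.nreg 1 = r ∧ s.nreg 2 = n * n ∧ (∀ i : Fin n, s.narr 2 i = i * n) ∧
      (∀ i < 2 * k, s.narr 1 i = i / 2) ∧ s.narr 3 = (fun _ => 0) ∧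
      s.rreg = (input p r).rreg ∧ s.rarr = (input p r).rarr)
    ?_ ?_ ?_).imp ?_)).within ?_
  · refine ⟨?_, ?_, ?_, h3, ?_, h4, h5, h6⟩
    · simpa using h0
    · simpa using h1
    · simpa using h2
    · intro i hi
      omega
  · exact fun k s h => h.2.2.1
  · rintro k s hk ⟨h0, h1, h2, h3, h7, h4, h5, h6⟩ h9
    refine (Ends.cons (Ends.putN (Ends.cons (Ends.putN (Ends.nil ?_))))).within ?_
    rotate_left
    · simp [NExp.time]
    refine ⟨?_, ?_, ?_, ?_, ?_, ?_, ?_, h5, h6⟩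
    · simpa [NExp.eval] using h9
    · simpa [NExp.eval] using h0
    · simpa [NExp.eval] using h1
    · simpa [NExp.eval] using h2
    · simpa [NExp.eval] using h3
    · intro i hi
      simp only [NExp.eval, h9, Function.update_self, Function.update_apply]
      split_ifs with e e
      · omega
      · omega
      · exact h7 i (by omega)
    · simpa using h4
  · rintro s ⟨h0, h1, h2, h3, h7, h4, h5, h6⟩
    refine Ends.nil ⟨h0, h1, h2, h3, h7, h4, ?_, ?_, ?_⟩
    · simp [h5, input]
    · simp [h6, input]
    · simp [h6, input]
  · simp only [NExp.time]
    omega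

/-- Equality of indices. -/
def Test.neq (e f : NExp) : Test := .conj (.neg (.nlt e f)) (.neg (.nlt f e))

/-- Disjunction of tests. -/
def Test.disj (b c : Test) : Test := .neg (.conj (.neg b) (.neg c))

theorem Test.holds_neq {e f : NExp} : (Test.neq e f).Holds s ↔ e.eval s = f.eval s := by
  simp only [Test.neq, Test.Holds]
  omega

theorem Test.holds_disj {b c : Test} : (Test.disj b c).Holds s ↔ b.Holds s ∨ c.Holds s := by
  simp only [Test.disj, Test.Holds]
  tauto

/-- The entries for the pair in the registers 9 and 10 that do not depend on the root. -/
def fillPair : Prog := .block [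
  .setN 11 (pairAt 9 10),
  .setN 12 (.add (.reg 2) (.reg 11)),
  .setR 6 (.sub (.get 0 (.reg 10)) (.get 0 (.reg 9))),
  .setR 7 (.sub (.get 1 (.reg 9)) (.get 1 (.reg 10))),
  .putR 2 (.reg 11) (.sqrt (.add (.mul (.reg 6) (.reg 6)) (.mul (.reg 7) (.reg 7)))),
  .putR 3 (.reg 11) (.lit 1),
  .putN 5 (.reg 11) (.lit 0),
  .putN 6 (.reg 11) (.reg 9),
  .putN 7 (.reg 11) (.reg 10),
  .ite (.disj (.rlt (.get 0 (.reg 9)) (.get 0 (.reg 10)))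
      (.conj (.neg (.rlt (.get 0 (.reg 10)) (.get 0 (.reg 9))))
        (.rlt (.get 1 (.reg 10)) (.get 1 (.reg 9)))))
    (.putR 4 (.reg 11) (.lit 1)) (.putR 4 (.reg 11) (.lit (-1)))]

/-- The test whether the pair in the registers 9 and 10 is an event. -/
def eventTest : Test := .conj (.neg (.neq (.reg 9) (.reg 10)))
  (.disj (.neq (.reg 9) (.reg 1)) (.disj (.neq (.reg 10) (.reg 1)) (.nlt (.reg 9) (.reg 10))))

/-- The entries for the pair in the registers 9 and 10 as an event. -/
def fillEvent : Prog := .ite eventTest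
  (.block [
    .putR 2 (.reg 12) (.mul (.get 4 (.reg 11)) (.reg 7)),
    .putR 3 (.reg 12) (.mul (.get 4 (.reg 11)) (.reg 6)),
    .ite (.neq (.reg 9) (.reg 1)) (.putN 5 (.reg 12) (.lit 0))
      (.ite (.neq (.reg 10) (.reg 1)) (.putN 5 (.reg 12) (.lit 2)) (.putN 5 (.reg 12) (.lit 1)))])
  (.block [
    .putR 2 (.reg 12) (.lit 1),
    .putR 3 (.reg 12) (.lit 0),
    .putN 5 (.reg 12) (.lit 3)])

/-- The tables of pairs. -/
def tables : Prog := .forPairs 9 10 (.block [fillPair, fillEvent])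

/-- The entries of the tables for a pair. -/
structure HasEntries (p : Fin n → Plane) (r : Fin n) (s : State) (i j : Fin n) : Prop where
  distX : s.rarr 2 (cell i j) = dist (p i) (p j)
  distY : s.rarr 3 (cell i j) = 1
  distT : s.narr 5 (cell i j) = 0
  fst : s.narr 6 (cell i j) = i
  snd : s.narr 7 (cell i j) = j
  sign : s.rarr 4 (cell i j) = sg p i j
  eventX : IsEvent r i j → s.rarr 2 (n * n + cell i j) = evX p i j
  eventY : IsEvent r i j → s.rarr 3 (n * n + cell i j) = evY p i j
  eventT : IsEvent r i j → s.narr 5 (n * n + cell i j) = evRank r i j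
  deadX : ¬ IsEvent r i j → s.rarr 2 (n * n + cell i j) = 1
  deadY : ¬ IsEvent r i j → s.rarr 3 (n * n + cell i j) = 0
  deadT : ¬ IsEvent r i j → s.narr 5 (n * n + cell i j) = 3

theorem sqrt_eq_dist (p : Fin n → Plane) (i j : Fin n) :
    Real.sqrt ((p j 0 - p i 0) * (p j 0 - p i 0) + (p i 1 - p j 1) * (p i 1 - p j 1)) =
      dist (p i) (p j) := by
  rw [EuclideanSpace.dist_eq, Fin.sum_univ_two, Real.dist_eq, Real.dist_eq, sq_abs, sq_abs]
  congr 1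
  ring

/-- The effect of the assignments for one pair. -/
theorem fill_ends {i j : Fin n} (h : Indexed p r s) (h9 : s.nreg 9 = i) (h10 : s.nreg 10 = j) :
    Ends (.block [fillPair, fillEvent]) s 250 fun s' =>
      s'.nreg 9 = i ∧ s'.nreg 10 = j ∧ Indexed p r s' ∧ HasEntries p r s' i j ∧
      ∀ a b, ¬ (a = i ∧ b = j) → HasEntries p r s a b → HasEntries p r s' a b := by
  classical
  -- One final memory, with the three event entries as parameters, describes the results of all four
  -- branches of the program.
  have hk : ∀ ex ey : ℝ, ∀ et : ℕ, (IsEvent r i j → ex = evX p i j ∧ ey = evY p i j ∧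
      et = evRank r i j) → (¬ IsEvent r i j → ex = 1 ∧ ey = 0 ∧ et = 3) → ∀ s', s' =
      { nreg := Function.update (Function.update s.nreg 11 (cell i j)) 12 (n * n + cell i j)
        rreg := Function.update (Function.update s.rreg 6 (p j 0 - p i 0)) 7 (p i 1 - p j 1)
        narr := Function.update (Function.update (Function.update (Function.update s.narr
          5 (Function.update (s.narr 5) (cell i j) 0))
          6 (Function.update (s.narr 6) (cell i j) i))
          7 (Function.update (s.narr 7) (cell i j) j))
          5 (Function.update (Function.update (s.narr 5) (cell i j) 0) (n * n + cell i j) et)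
        rarr := Function.update (Function.update (Function.update (Function.update (Function.update
          s.rarr 2 (Function.update (s.rarr 2) (cell i j) (dist (p i) (p j))))
          3 (Function.update (s.rarr 3) (cell i j) 1))
          4 (Function.update (s.rarr 4) (cell i j) (sg p i j)))
          2 (Function.update (Function.update (s.rarr 2) (cell i j) (dist (p i) (p j)))
            (n * n + cell i j) ex))
          3 (Function.update (Function.update (s.rarr 3) (cell i j) 1) (n * n + cell i j) ey)
          : State } →
      s'.nreg 9 = i ∧ s'.nreg 10 = j ∧ Indexed p r s' ∧ HasEntries p r s' i j ∧
      ∀ a b, ¬ (a = i ∧ b = j) → HasEntries p r s a b → HasEntries p r s' a b := by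
    rintro ex ey et hev hdead s' rfl
    have hlt := cell_lt i j
    refine ⟨by simpa using h9, by simpa using h10, ?_, ?_, ?_⟩
    · obtain ⟨e0, e1, e2, e3, e4, e5, e6, e7, e8⟩ := h
      constructor <;> simpa
    · have hn : n ≠ 0 := by have := i.2; omega
      constructor <;> (try intro hE) <;> simp [hn]
      · exact (hev hE).1
      · exact (hev hE).2.1
      · exact (hev hE).2.2
      · exact (hdead hE).1
      · exact (hdead hE).2.1
      · exact (hdead hE).2.2
    · intro a b hab hE
      have hlt' := cell_lt a b
      have e1 : cell a b ≠ cell i j := fun e => hab (cell_inj.1 e)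
      have e2 : cell a b ≠ n * n + cell i j := by omega
      have e3 : n * n + cell a b ≠ cell i j := by omega
      obtain ⟨f1, f2, f3, f4, f5, f6, f7, f8, f9, f10, f11, f12⟩ := hE
      constructor <;> simpa [e1, e2, e3]
  have hpair : (pairAt 9 10).eval s = cell i j := by
    simp [pairAt, NExp.eval, h9, h10, h.row, cell]
  refine (Ends.cons (k := 100) (k' := 140) ((Ends.cons (Ends.setN (Ends.cons (Ends.setN (Ends.cons
    (Ends.setR (Ends.cons (Ends.setR (Ends.cons (Ends.putR (Ends.cons (Ends.putR (Ends.cons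
    (Ends.putN (Ends.cons (Ends.putN (Ends.cons (Ends.putN (Ends.cons (k' := 1)
    (Q := fun s' => s' =
      { nreg := Function.update (Function.update s.nreg 11 (cell i j)) 12 (n * n + cell i j)
        rreg := Function.update (Function.update s.rreg 6 (p j 0 - p i 0)) 7 (p i 1 - p j 1)
        narr := Function.update (Function.update (Function.update s.narr
          5 (Function.update (s.narr 5) (cell i j) 0))
          6 (Function.update (s.narr 6) (cell i j) i))
          7 (Function.update (s.narr 7) (cell i j) j)
        rarr := Function.update (Function.update (Function.update s.rarr
          2 (Function.update (s.rarr 2) (cell i j) (dist (p i) (p j))))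
          3 (Function.update (s.rarr 3) (cell i j) 1))
          4 (Function.update (s.rarr 4) (cell i j) (sg p i j)) : State })
    (Ends.ite (fun hb => Ends.putR (Ends.nil ?_)) fun hb => Ends.putR (Ends.nil ?_))
    ))))))))))))))))))).mono ?_ ?_)).within (by omega)
  · simp [Test.holds_disj, Test.Holds, RExp.eval, NExp.eval, hpair, h9, h10, h.x, h.y] at hb
    simp [RExp.eval, NExp.eval, hpair, h9, h10, h.sq, h.x, h.y, sqrt_eq_dist]
    rw [sg, if_pos (by simpa using hb)]
  · simp [Test.holds_disj, Test.Holds, RExp.eval, NExp.eval, hpair, h9, h10, h.x, h.y] at hb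
    simp [RExp.eval, NExp.eval, hpair, h9, h10, h.sq, h.x, h.y, sqrt_eq_dist]
    rw [sg, if_neg (by simpa using hb)]
  · simp [RExp.time, NExp.time, Test.time, Test.disj, pairAt]
  · rintro s' rfl
    refine (Ends.cons (k' := 1) (Ends.ite (fun hb => Ends.cons (Ends.putR (Ends.cons (Ends.putR
      (Ends.cons (k' := 1) (Ends.ite (fun hi => Ends.putN (Ends.nil (Ends.nil ?_))) fun hi =>
        Ends.ite (fun hj => Ends.putN (Ends.nil (Ends.nil ?_))) fun hj =>
          Ends.putN (Ends.nil (Ends.nil ?_)))))))) fun hb =>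
      Ends.cons (Ends.putR (Ends.cons (Ends.putR (Ends.cons
        (Ends.putN (Ends.nil (Ends.nil ?_))))))))).within ?_
    rotate_left 4
    · simp [eventTest, RExp.time, NExp.time, Test.time, Test.disj, Test.neq]
    · have hE : IsEvent r i j := by
        simpa [eventTest, IsEvent, Test.holds_neq, Test.holds_disj, Test.Holds, NExp.eval, h9, h10,
          h.root, Fin.val_inj] using hb
      simp [Test.holds_neq, NExp.eval, h9, h.root, Fin.val_inj] at hi
      refine hk (evX p i j) (evY p i j) 0 (fun _ => ⟨rfl, rfl, ?_⟩) (fun e => absurd hE e) _ ?_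
      · rw [evRank, if_pos hi]
      · simp [RExp.eval, NExp.eval, evX, evY]
    · have hE : IsEvent r i j := by
        simpa [eventTest, IsEvent, Test.holds_neq, Test.holds_disj, Test.Holds, NExp.eval, h9, h10,
          h.root, Fin.val_inj] using hb
      simp [Test.holds_neq, NExp.eval, h9, h10, h.root, Fin.val_inj] at hi hj
      refine hk (evX p i j) (evY p i j) 2 (fun _ => ⟨rfl, rfl, ?_⟩) (fun e => absurd hE e) _ ?_
      · rw [evRank, if_neg hi, if_pos hj]
      · simp [RExp.eval, NExp.eval, evX, evY]
    · have hE : IsEvent r i j := by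
        simpa [eventTest, IsEvent, Test.holds_neq, Test.holds_disj, Test.Holds, NExp.eval, h9, h10,
          h.root, Fin.val_inj] using hb
      simp [Test.holds_neq, NExp.eval, h9, h10, h.root, Fin.val_inj] at hi hj
      refine hk (evX p i j) (evY p i j) 1 (fun _ => ⟨rfl, rfl, ?_⟩) (fun e => absurd hE e) _ ?_
      · rw [evRank, if_neg hi, if_neg hj]
      · simp [RExp.eval, NExp.eval, evX, evY]
    · have hE : ¬ IsEvent r i j := by
        simpa [eventTest, IsEvent, Test.holds_neq, Test.holds_disj, Test.Holds, NExp.eval, h9, h10,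
          h.root, Fin.val_inj] using hb
      refine hk 1 0 3 (fun e => absurd e hE) (fun _ => ⟨rfl, rfl, rfl⟩) _ ?_
      simp [RExp.eval, NExp.eval]

theorem tables_ends (h : Indexed p r s) : Ends tables s ((n + 1) * ((n + 1) * 259 + 9)) fun s' =>
    Indexed p r s' ∧ ∀ i j, HasEntries p r s' i j := by
  refine (Ends.forPairs (n := n) (tb := 250) (fun k s => Indexed p r s ∧
    ∀ i j, cell i j < k → HasEntries p r s i j) (by decide) ⟨h, fun _ _ h => absurd h (by omega)⟩
    (fun k s h => h.1.size) ?_ ?_).imp fun s' h => ⟨h.1, fun i j => h.2 i j (cell_lt i j)⟩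
  · rintro k s z v hz ⟨⟨e0, e1, e2, e3, e4, e5, e6, e7, e8⟩, hE⟩
    refine ⟨⟨?_, ?_, ?_, e3, e4, e5, e6, e7, e8⟩, fun i j hij => ?_⟩
    · rcases hz with rfl | rfl <;> simpa
    · rcases hz with rfl | rfl <;> simpa
    · rcases hz with rfl | rfl <;> simpa
    · obtain ⟨f1, f2, f3, f4, f5, f6, f7, f8, f9, f10, f11, f12⟩ := hE i j hij
      exact ⟨f1, f2, f3, f4, f5, f6, f7, f8, f9, f10, f11, f12⟩
  · rintro i j s ⟨hI, hE⟩ h9 h10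
    refine (fill_ends hI h9 h10).imp ?_
    rintro s' ⟨g9, g10, hI', hij, hkeep⟩
    refine ⟨g9, g10, hI', fun a b hab => ?_⟩
    by_cases e : a = i ∧ b = j
    · rw [e.1, e.2]
      exact hij
    · refine hkeep a b e (hE a b ?_)
      have : cell a b ≠ cell i j := fun e' => e (cell_inj.1 e')
      omega

/-- All tree cells hold item 0. Equal items satisfy the tournament condition whichever way they
compare, and item 0 is the pair of the first point with itself, at distance 0, so the initial sum 0
is right. -/
theorem Indexed.ready (h : Indexed p r s) (hE : ∀ i j, HasEntries p r s i j) :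
    Ready p r s (sg p) (fun _ _ => 0) (fun _ _ => 0) where
  const := ⟨h.size, h.root, h.sq, h.row, h.half, fun i j => (hE i j).distX,
    fun i j => (hE i j).distY, fun i j => (hE i j).distT, fun i j => (hE i j).eventX,
    fun i j => (hE i j).eventY, fun i j => (hE i j).eventT, fun i j => (hE i j).deadX,
    fun i j => (hE i j).deadY, fun i j => (hE i j).deadT, fun i j => (hE i j).fst,
    fun i j => (hE i j).snd, h.x, h.y⟩
  signs i j := (hE i j).sign
  forest := by
    rw [h.tree]
    exact ⟨fun _ _ => rfl, fun _ _ _ _ _ => by simp only [and_true]; exact em _⟩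
  queue := by
    rw [h.tree]
    exact ⟨fun _ _ => rfl, fun _ _ _ _ => by simp only [and_true]; exact em _⟩
  sum := by
    rw [h.total, rootSum, h.tree]
    have hn : 0 < n := by have := r.2; omega
    have := (hE ⟨0, hn⟩ ⟨0, hn⟩).distX
    rw [dist_self] at this
    simp only [cell, zero_mul, zero_add] at this
    simp [this]

/-- All events enter the tournament tree of the events. -/
def enqueue : Prog := .forPairs 9 10 (.block [
  .setN 40 (.add (.reg 2) (.reg 2)),
  .setN 41 (.add (.reg 2) (pairAt 9 10)),
  .setN 42 (.reg 41),
  update])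

theorem enqueue_ends (h : Ready p r s (sg p) (fun _ _ => 0) (fun _ _ => 0))
    (hL : 2 * (n * n) ≤ 2 ^ (L + 1)) :
    Ends enqueue s ((n + 1) * ((n + 1) * (200 * (L + 1) + 59) + 9)) fun s' =>
      Ready p r s' (sg p) (fun _ _ => 0) (evItem r ∅) := by
  refine (Ends.forPairs (n := n) (tb := 200 * (L + 1) + 50) (fun k s => Ready p r s (sg p)
    (fun _ _ => 0) (fun i j => if cell i j < k then n * n + cell i j else 0)) (by decide) ?_
    (fun k s h => h.const.size) ?_ ?_).imp ?_
  · simpa only [Nat.not_lt_zero, if_false] using h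
  · rintro k s z v hz h
    refine h.of_eq (fun x hx => ?_) (fun _ _ => rfl) rfl rfl
    exact Function.update_of_ne (by omega) _ _
  · rintro i j s h h9 h10
    have hc := h.const
    have hlt := cell_lt i j
    refine (Ends.cons (Ends.setN (Ends.cons (Ends.setN (Ends.cons (Ends.setN (Ends.cons (k' := 1)
      ((update_ends (lt := s.Before) (b := n * n + n * n) (m := n * n) (i := n * n + cell i j)
        (v := n * n + cell i j) (L := L) ?_ ?_ ?_ (by omega) (by omega) (by omega) ?_ ?_ ?_).imp
        ?_)))))))).within ?_
    · simp [NExp.eval, hc.sq]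
    · simp [NExp.eval, pairAt, hc.sq, hc.row, h9, h10, cell]
    · simp [NExp.eval, pairAt, hc.sq, hc.row, h9, h10, cell]
    · simpa using hc.half
    · intro x y
      rfl
    · exact h.queue.tour
    · rintro s1 ⟨nr, T, rfl, h1, h2, h3, h4⟩
      have hnr : ∀ x, x < 40 → nr x = s.nreg x := fun x hx => by
        rw [h1 x (by omega)]
        simp [show x ≠ 40 by omega, show x ≠ 41 by omega, show x ≠ 42 by omega]
      have hr1 := h.update_queue (nr := nr) (fun x hx => hnr x (by omega)) h4 h3 h2
      refine Ends.nil ⟨(hnr 9 (by decide)).trans h9, (hnr 10 (by decide)).trans h10, ?_⟩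
      convert hr1 using 1
      funext a b
      unfold setEntry
      by_cases e : a = i ∧ b = j
      · rw [if_pos e, e.1, e.2, if_pos (by omega)]
      · rw [if_neg e]
        have : cell a b ≠ cell i j := fun e' => e (cell_inj.1 e')
        exact if_congr (by omega) rfl rfl
    · simp [pairAt, NExp.time]
      omega
  · intro s' h
    convert h using 1
    funext i j
    simp [evItem, cell_lt]

theorem curSigns_empty : curSigns p r ∅ = sg p := by
  funext i j
  unfold curSigns
  by_cases e : j = r <;> simp [e]

/-- The first candidate: the star with an arbitrary direction. -/
def star : Prog := .block [
  .setR 4 (.lit 0),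
  .forN 9 (.reg 0) (.setR 4 (.add (.reg 4) (.get 2 (pairAt 9 1)))),
  .setR 3 (.reg 2),
  .setR 0 (.lit 1),
  .setR 1 (.lit 0)]

theorem _root_.Geo.exists_refines (hp : Function.Injective p) (u : Plane) :
    ∃ σ, Refines r (dirSign p u) (sg p) Set.univ σ := by
  classical
  refine ⟨fun i j => if i ≠ r ∧ j ≠ r ∧ dirSign p u i j = 0 then sg p i j else dirSign p u i j,
    fun i hi => by simp, fun i j hi hj hij => by simp [hij], fun i j hi hj hij h0 => ?_,
    fun i j hi hj hij h0 h => absurd (Set.mem_univ _) h⟩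
  have h0' : dirSign p u j i = 0 := by rw [dirSign_swap, h0, neg_zero]
  rw [if_pos ⟨hi, hj, h0⟩, if_pos ⟨hj, hi, h0'⟩]
  exact ⟨sg_eq p i j, sg_swap hp hij.ne⟩

/-- The star bounds the total of every refinement in any direction, so any nonzero direction is a
valid first record. It is needed for a single point, which has no events. -/
theorem star_ends (hp : Function.Injective p) (hg : GeneralPosition p)
    (h : Ready p r s (curSigns p r ∅) (item (curSigns p r ∅) r) (evItem r ∅)) :
    Ends star s ((n + 1) * 17 + 20) (Sweeping p r ∅) := by
  refine (Ends.cons (Ends.setR (Ends.cons (k' := 10) ((Ends.forN (m := n) (tb := 8) (fun k s =>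
    Ready p r s (curSigns p r ∅) (item (curSigns p r ∅) r) (evItem r ∅) ∧
    s.rreg 4 = ∑ a ∈ Finset.univ.filter fun a : Fin n => (a : ℕ) < k,
      dist (p a) (p r)) ?_ ?_ ?_).imp ?_)))).within ?_
  · refine ⟨h.of_eq (fun x hx => ?_) (fun _ _ => rfl) rfl (by simp), by simp [RExp.eval]⟩
    simp [show x ≠ 9 by omega]
  · exact fun k s h => h.1.const.size
  · rintro k s hk ⟨hr, h4⟩ h9
    have hc := hr.const
    refine (Ends.setR ⟨?_, ?_, ?_⟩).within (by simp [RExp.time, NExp.time, pairAt])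
    · exact h9
    · refine hr.of_eq (fun x hx => ?_) (fun _ _ => rfl) rfl (by simp)
      simp [show x ≠ 9 by omega]
    · have hrow := hc.row ⟨k, hk⟩
      have hd := hc.distX ⟨k, hk⟩ r
      simp only [cell] at hrow hd
      simp [RExp.eval, NExp.eval, pairAt, h9, hrow, hc.root, hd, h4]
      rw [add_comm, ← Finset.sum_insert (a := (⟨k, hk⟩ : Fin n))
        (f := fun a => dist (p a) (p r)) (by simp)]
      congr 1
      ext a
      simp [Fin.ext_iff]
      omega
  · rintro s ⟨hr, h4⟩
    refine (Ends.cons (Ends.setR (Ends.cons (Ends.setR (Ends.cons (Ends.setR (Ends.nil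
      ?_))))))).within (by simp [RExp.time])
    refine ⟨⟨by simp, by simp⟩, hr.of_eq (fun _ _ => rfl) (fun _ _ => rfl) rfl (by simp), ?_,
      by simp, ?_, ?_⟩
    · intro i j hn hrank
      simp [RExp.eval]
      rw [hr.total]
      have := IsPrefix.refines (D := ∅) hp hg ⟨by simp, by simp⟩ hn hrank
      exact IsBest.of_refines this (by simp)
    · intro e
      have := congrArg (fun u : Plane => u 0) e
      simp [outputDirection, RExp.eval] at this
    · obtain ⟨σ, hσ⟩ := exists_refines (r := r) hp (outputDirection _)
      refine ⟨σ, hσ, ?_⟩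
      simp [RExp.eval, h4]
      exact Finset.sum_le_sum fun a _ => near_le_star p r σ a
  · simp [RExp.time, NExp.time]
    omega

/-- Everything before the sweep. -/
def prepare : Prog := .block [.block [rows, halves], tables, enqueue, refreshAll, star]

theorem prepare_ends (hp : Function.Injective p) (hg : GeneralPosition p)
    (hL : 2 * (n * n) ≤ 2 ^ (L + 1)) :
    Ends prepare (input p r) ((n + 1) * (n + 1) * (400 * (L + 1) + 600)) (Sweeping p r ∅) := by
  refine (Ends.cons (halves_ends.imp fun s h => Ends.cons ((tables_ends h).imp fun s h =>
    Ends.cons ((enqueue_ends (h.1.ready h.2) hL).imp fun s h => Ends.cons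
      ((refreshAll_ends h hL).imp fun s h => Ends.cons (k' := 1)
        ((star_ends hp hg ?_).imp fun s h => Ends.nil h)))))).within ?_
  · rw [curSigns_empty]
    exact h.2
  · nlinarith [Nat.zero_le n, Nat.zero_le L]

end RealRAM

/-! ### Reconstruction of the optimal tree, and the final bounds -/

namespace RealRAM

open Geo

variable {n : ℕ} {p : Fin n → Plane} {r : Fin n} {s : State} {L : ℕ}
  {σ : Fin n → Fin n → ℝ} {M E : Fin n → Fin n → ℕ} {u : Plane}

theorem _root_.Geo.coord_sub (u a b : Plane) :
    coord u a - coord u b = u 0 * (a 0 - b 0) + u 1 * (a 1 - b 1) := by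
  rw [coord_eq, coord_eq]
  ring

/-- The signs of the direction `u`, with ties broken by the numbers of the points. -/
noncomputable def baseSigns (p : Fin n → Plane) (r : Fin n) (u : Plane) : Fin n → Fin n → ℝ :=
  fun i j =>
    if 0 < coord u (p i) - coord u (p j) then 1
    else if coord u (p i) - coord u (p j) < 0 then -1
    else if i = r ∨ j = r then 0 else if i < j then 1 else -1

/-- The free set is empty, written as the pairs with cell number below 0, to start an induction over
the pairs in the order of their cells. -/
theorem baseSigns_refines (p : Fin n → Plane) (r : Fin n) (u : Plane) :
    Refines r (dirSign p u) (fun _ _ => 1) {e | cell e.1 e.2 < 0} (baseSigns p r u) := by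
  have h0 : ∀ i j, dirSign p u i j = 0 → ¬ 0 < coord u (p i) - coord u (p j) ∧
      ¬ coord u (p i) - coord u (p j) < 0 := fun i j h => by
    rw [dirSign_eq_zero.1 h, sub_self]
    simp
  have hsep : ∀ i j, dirSign p u i j ≠ 0 ∨ j = r → baseSigns p r u i j = dirSign p u i j :=
    fun i j h => by
      unfold baseSigns
      rcases lt_trichotomy (coord u (p i) - coord u (p j)) 0 with e | e | e
      · rw [if_neg (not_lt_of_gt e), if_pos e, dirSign, Real.sign_of_neg e]
      · have e0 : dirSign p u i j = 0 := by rw [dirSign, e, Real.sign_zero]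
        rw [e, if_neg (lt_irrefl _), if_neg (lt_irrefl _), e0,
          if_pos (Or.inr (h.resolve_left fun h' => h' e0))]
      · rw [if_pos e, dirSign, Real.sign_of_pos e]
  refine ⟨fun i _ => hsep i r (Or.inr rfl), fun i j _ _ h => hsep i j (Or.inl h),
    fun i j hi hj hij h => ?_, fun i j hi hj hij h _ => ?_⟩
  · have h' : dirSign p u j i = 0 := by rw [dirSign_swap, h, neg_zero]
    unfold baseSigns
    rw [if_neg (h0 i j h).1, if_neg (h0 i j h).2, if_neg (h0 j i h').1, if_neg (h0 j i h').2,
      if_neg (not_or.2 ⟨hi, hj⟩), if_neg (not_or.2 ⟨hj, hi⟩), if_pos hij,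
      if_neg (not_lt_of_gt hij)]
    exact ⟨Or.inl rfl, rfl⟩
  · unfold baseSigns
    rw [if_neg (h0 i j h).1, if_neg (h0 i j h).2, if_neg (not_or.2 ⟨hi, hj⟩), if_pos hij]

/-- The difference of the coordinates of the points in the registers 9 and 10 in the direction
found. -/
def gap : RExp := .add
  (.mul (.reg 0) (.sub (.get 0 (.reg 9)) (.get 0 (.reg 10))))
  (.mul (.reg 1) (.sub (.get 1 (.reg 9)) (.get 1 (.reg 10))))

theorem Const.eval_gap (h : Const p r s) {i j : Fin n} (h9 : s.nreg 9 = i) (h10 : s.nreg 10 = j) :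
    gap.eval s = coord (outputDirection s) (p i) - coord (outputDirection s) (p j) := by
  rw [coord_sub]
  simp [gap, RExp.eval, NExp.eval, h9, h10, h.x, h.y, outputDirection]

/-- The signs for the direction found. -/
def settle : Prog := .forPairs 9 10
  (.ite (.rlt (.lit 0) gap) (.putR 4 (pairAt 9 10) (.lit 1))
    (.ite (.rlt gap (.lit 0)) (.putR 4 (pairAt 9 10) (.lit (-1)))
      (.ite (.disj (.neq (.reg 9) (.reg 1)) (.neq (.reg 10) (.reg 1)))
        (.putR 4 (pairAt 9 10) (.lit 0))
        (.ite (.nlt (.reg 9) (.reg 10)) (.putR 4 (pairAt 9 10) (.lit 1))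
          (.putR 4 (pairAt 9 10) (.lit (-1)))))))

theorem settle_ends (h : Ready p r s σ M E) : Ends settle s ((n + 1) * ((n + 1) * 209 + 9))
    fun s' => outputDirection s' = outputDirection s ∧
      Ready p r s' (baseSigns p r (outputDirection s)) M E := by
  refine (Ends.forPairs (n := n) (tb := 200) (fun k s' => outputDirection s' = outputDirection s ∧
    Ready p r s' (fun a b => if cell a b < k then baseSigns p r (outputDirection s) a b else σ a b)
      M E) (by decide) ?_ (fun k s h => h.2.const.size) ?_ ?_).imp ?_
  · simpa only [Nat.not_lt_zero, if_false, true_and] using h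
  · rintro k s' z v hz ⟨hd, h⟩
    exact ⟨hd, h.of_eq (fun x hx => Function.update_of_ne (by omega) _ _) (fun _ _ => rfl) rfl rfl⟩
  · rintro i j s' ⟨hd, h'⟩ h9 h10
    have hgap := h'.const.eval_gap h9 h10
    rw [hd] at hgap
    have hput : ∀ c : ℤ, (c : ℝ) = baseSigns p r (outputDirection s) i j →
        Ends (.putR 4 (pairAt 9 10) (.lit c)) s' 10 fun s' => s'.nreg 9 = i ∧ s'.nreg 10 = j ∧
          outputDirection s' = outputDirection s ∧ Ready p r s' (fun a b => if cell a b <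
            cell i j + 1 then baseSigns p r (outputDirection s) a b else σ a b) M E := by
      intro c hc
      refine (Ends.putR ⟨h9, h10, hd, ?_⟩).within (by simp [pairAt, NExp.time, RExp.time])
      have hs := h'.setSign i j c
      convert hs using 1
      · simp [pairAt, NExp.eval, RExp.eval, h9, h10, h'.const.row, cell]
      · funext a b
        unfold setEntry
        by_cases e : a = i ∧ b = j
        · rw [if_pos e, e.1, e.2, if_pos (by omega), hc]
        · rw [if_neg e]
          have : cell a b ≠ cell i j := fun e' => e (cell_inj.1 e')
          exact if_congr (by omega) rfl rfl
    unfold baseSigns at hput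
    refine (Ends.ite (fun h1 => hput _ ?_) fun h1 => Ends.ite (fun h2 => hput _ ?_) fun h2 =>
      Ends.ite (fun h3 => hput _ ?_) fun h3 => Ends.ite (fun h4 => hput _ ?_)
      fun h4 => hput _ ?_).within ?_
    rotate_left 5
    · simp [Test.time, RExp.time, NExp.time, gap, Test.disj, Test.neq]
    all_goals
      simp only [Test.Holds, RExp.eval, hgap, Int.cast_zero] at h1
    · rw [if_pos h1, Int.cast_one]
    all_goals
      simp only [Test.Holds, RExp.eval, hgap, Int.cast_zero] at h2
      rw [if_neg h1]
    · rw [if_pos h2, Int.cast_neg, Int.cast_one]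
    all_goals
      simp only [Test.holds_disj, Test.holds_neq, NExp.eval, h9, h10, h'.const.root,
        Fin.val_inj] at h3
      rw [if_neg h2]
    · rw [if_pos h3, Int.cast_zero]
    all_goals
      simp only [Test.Holds, NExp.eval, h9, h10, Fin.val_fin_lt] at h4
      rw [if_neg h3]
    · rw [if_pos h4, Int.cast_one]
    · rw [if_neg h4, Int.cast_neg, Int.cast_one]
  · rintro s' ⟨hd, h'⟩
    refine ⟨hd, ?_⟩
    convert h' using 1
    funext a b
    rw [if_pos (cell_lt a b)]

/-- The test whether the points in the registers 9 and 10 are tied in the direction found. -/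
def tieTest : Test := .conj (.nlt (.reg 9) (.reg 10))
  (.conj (.neg (.disj (.neq (.reg 9) (.reg 1)) (.neq (.reg 10) (.reg 1))))
    (.conj (.neg (.rlt (.lit 0) gap)) (.neg (.rlt gap (.lit 0)))))

/-- Reversal of the ties where this improves the total. -/
def improve : Prog := .forPairs 9 10 (.ite tieTest
  (.block [
    .setR 5 (.reg 2),
    flipProg 9 10,
    .ite (.rlt (.reg 5) (.reg 2)) (flipProg 9 10) .skip]) .skip)

/-- The signs are the best ones when the ties before the `k`-th pair are free. -/
structure Improved (p : Fin n → Plane) (r : Fin n) (u : Plane) (k : ℕ) (σ : Fin n → Fin n → ℝ) :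
    Prop where
  refines : Refines r (dirSign p u) (fun _ _ => 1) {e | cell e.1 e.2 < k} σ
  le : ∀ σ', Refines r (dirSign p u) (fun _ _ => 1) {e | cell e.1 e.2 < k} σ' →
    total p r σ ≤ total p r σ'

theorem setOf_cell_lt_succ (i j : Fin n) : {e : Fin n × Fin n | cell e.1 e.2 < cell i j + 1} =
    insert (i, j) {e | cell e.1 e.2 < cell i j} := by
  ext ⟨a, b⟩
  rw [Set.mem_insert_iff, Prod.mk.injEq, ← cell_inj]
  simp only [Set.mem_ofPred_eq]
  omega

/-- Freeing a pair that is not a tie of two non-root points does not enlarge the set of refinements.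
-/
theorem Improved.keep {i j : Fin n} (h : Improved p r u (cell i j) σ)
    (hij : ¬ (i < j ∧ ¬ (i = r ∨ j = r) ∧ dirSign p u i j = 0)) :
    Improved p r u (cell i j + 1) σ := by
  have key : ∀ Q Q' : Set (Fin n × Fin n), (∀ e, e ≠ (i, j) → e ∈ Q → e ∈ Q') → ∀ σ',
      Refines r (dirSign p u) (fun _ _ => 1) Q σ' → Refines r (dirSign p u) (fun _ _ => 1) Q' σ' :=
    fun Q Q' hQ σ' hσ' => hσ'.mono fun a b ha hb hab h0 hn => ⟨fun hm => hn (hQ _ (fun e => by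
      obtain ⟨rfl, rfl⟩ := Prod.mk.inj e
      exact hij ⟨hab, by tauto, h0⟩) hm), rfl⟩
  refine ⟨key _ _ (fun e _ he => ?_) σ h.refines, fun σ' hσ' => h.le σ' (key _ _
    (fun e hne he => ?_) σ' hσ')⟩
  · simp only [Set.mem_ofPred_eq] at he ⊢
    omega
  · rw [setOf_cell_lt_succ] at he
    exact he.resolve_left hne

/-- By `Refines.total_insert_ge`, the better of the two states of the new tie is optimal; earlier
choices need no revision. -/
theorem Improved.step (hg : GeneralPosition p) (hu : u ≠ 0) {i j : Fin n}
    (h : Improved p r u (cell i j) σ) (hij : i < j) (hi : i ≠ r) (hj : j ≠ r)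
    (h0 : dirSign p u i j = 0) :
    (total p r σ ≤ total p r (flipTie σ i j) → Improved p r u (cell i j + 1) σ) ∧
      (total p r (flipTie σ i j) ≤ total p r σ → Improved p r u (cell i j + 1) (flipTie σ i j)) := by
  have h0' : dirSign p u j i = 0 := by rw [dirSign_swap, h0, neg_zero]
  have h1 := fun q (hq : q ≠ i) (hq' : q ≠ j) => hg.dirSign_ne_zero hu h0 hij.ne q hq hq'
  have h2 := fun q (hq : q ≠ i) (hq' : q ≠ j) => hg.dirSign_ne_zero hu h0' hij.ne' q hq' hq
  have hsw := dirSign_swap p u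
  have hle := h.refines.total_insert_ge h.le hsw hi hj hij h0 (by simp) (Or.inl rfl) h1 h2
  rw [← setOf_cell_lt_succ] at hle
  have hσ : Refines r (dirSign p u) (fun _ _ => 1) {e | cell e.1 e.2 < cell i j + 1} σ :=
    h.refines.mono fun a b _ _ _ _ hn => ⟨fun hm => hn (Nat.lt_succ_of_lt hm), rfl⟩
  refine ⟨fun e => ⟨hσ, fun σ' hσ' => ?_⟩, fun e => ⟨hσ.flip hsw hi hj hij h0 (by simp),
    fun σ' hσ' => ?_⟩⟩
  · have := hle σ' hσ'
    rwa [min_eq_left (by linarith), add_zero] at this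
  · have := hle σ' hσ'
    rwa [min_eq_right (by linarith), add_sub_cancel] at this

theorem improve_ends (hg : GeneralPosition p) (hL : 2 * (n * n) ≤ 2 ^ (L + 1))
    (hu : outputDirection s ≠ 0) (hσ : Improved p r (outputDirection s) 0 σ)
    (h : Ready p r s σ (item σ r) E) :
    Ends improve s ((n + 1) * ((n + 1) * (800 * (L + 1) + 809) + 9)) fun s' =>
      outputDirection s' = outputDirection s ∧ ∃ σ, Ready p r s' σ (item σ r) E ∧
        Improved p r (outputDirection s) (n * n) σ := by
  refine Ends.forPairs (n := n) (tb := 800 * (L + 1) + 800) (fun k s' =>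
    outputDirection s' = outputDirection s ∧ ∃ σ, Ready p r s' σ (item σ r) E ∧
        Improved p r (outputDirection s) k σ) (by decide) ⟨rfl, σ, h, hσ⟩ ?_ ?_ ?_
  · rintro k s ⟨-, σ, h, -⟩
    exact h.const.size
  · rintro k s' z v hz ⟨hd, σ, h, hσ⟩
    exact ⟨hd, σ, h.of_eq (fun x hx => Function.update_of_ne (by omega) _ _) (fun _ _ => rfl) rfl
      rfl, hσ⟩
  · clear h hσ
    rintro i j s' ⟨hd, σ, h, hσ⟩ h9 h10
    have hgap := h.const.eval_gap h9 h10
    rw [hd] at hgap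
    have htest : tieTest.Holds s' ↔ i < j ∧ ¬ (i = r ∨ j = r) ∧
        dirSign p (outputDirection s) i j = 0 := by
      simp only [tieTest, Test.Holds, Test.holds_disj, Test.holds_neq, NExp.eval, h9, h10,
        h.const.root, Fin.val_inj, Fin.val_fin_lt, RExp.eval, hgap, dirSign_eq_zero, Int.cast_zero,
        not_lt]
      refine and_congr_right fun _ => and_congr_right fun _ => ?_
      rw [← sub_eq_zero (a := coord (outputDirection s) (p i)), le_antisymm_iff]
    refine (Ends.ite (k := 800 * (L + 1) + 700) (k' := 1) (fun hb => ?_) fun hb =>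
      Ends.skip ⟨h9, h10, hd, σ, h, hσ.keep (htest.not.1 hb)⟩).within ?_
    · obtain ⟨hij, hr, h0⟩ := htest.1 hb
      rw [not_or] at hr
      have hstep := hσ.step hg hu hij hr.1 hr.2 h0
      refine (Ends.cons (Ends.setR (Ends.cons (k' := 400 * (L + 1) + 320) ((flipProg_ends (x := 9)
        (y := 10) (p := p) (r := r)
        (σ := σ) (E := E) ?_ hL (by decide)
        (by decide) (i := i) (j := j) ?_ ?_ hij.ne hr.1 hr.2).imp ?_)))).within ?_
      · exact h.of_eq (fun _ _ => rfl) (fun _ _ => rfl) rfl (by simp)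
      · exact h9
      · exact h10
      · rintro s1 ⟨k1, r1⟩
        have g9 : s1.nreg 9 = i := (k1.nreg 9 (by decide)).trans h9
        have g10 : s1.nreg 10 = j := (k1.nreg 10 (by decide)).trans h10
        have h5 : s1.rreg 5 = total p r σ := by
          rw [k1.rreg 5 (by decide), ← h.total]
          simp [RExp.eval]
        have hd1 : outputDirection s1 = outputDirection s := by
          rw [← hd]
          unfold outputDirection
          rw [k1.rreg 0 (by decide), k1.rreg 1 (by decide)]
          simp
        refine (Ends.cons (k' := 1) (Ends.ite (k := 400 * (L + 1) + 300) (k' := 1) (fun hc => ?_)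
          fun hc => Ends.skip (Ends.nil ⟨g9, g10, hd1, _, r1, hstep.2 ?_⟩))).within
          (k' := 400 * (L + 1) + 320) ?_
        · refine (flipProg_ends (p := p) (r := r) r1 hL (by decide) (by decide) g9 g10 hij.ne hr.1
            hr.2).imp ?_
          rintro s2 ⟨k2, r2⟩
          rw [Geo.flip_flip] at r2
          refine Ends.nil ⟨(k2.nreg 9 (by decide)).trans g9, (k2.nreg 10 (by decide)).trans g10, ?_,
            σ, r2, hstep.1 ?_⟩
          · rw [← hd1]
            unfold outputDirection
            rw [k2.rreg 0 (by decide), k2.rreg 1 (by decide)]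
          · simp only [Test.Holds, RExp.eval, h5, r1.total] at hc
            exact hc.le
        · simp only [Test.time, RExp.time]
          omega
        · simp only [Test.Holds, RExp.eval, h5, r1.total, not_lt] at hc
          exact hc
      · simp only [RExp.time]
        omega
    · simp [tieTest, Test.time, RExp.time, NExp.time, gap, Test.disj, Test.neq]
      omega

/-- The parents. -/
def output : Prog := .forN 9 (.reg 0) (.putN 0 (.reg 9)
  (.get 7 (.get 3 (.add (.add (.get 2 (.reg 9)) (.get 2 (.reg 9))) (.lit 1)))))

theorem output_ends (h : Ready p r s σ (item σ r) E) : Ends output s ((n + 1) * 29) fun s' =>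
    outputDirection s' = outputDirection s ∧ ∀ a : Fin n, ∃ q,
      s'.narr 0 a = choice σ r a q ∧ near p r σ a = dist (p a) (p (choice σ r a q)) := by
  refine (Ends.forN (m := n) (tb := 20) (fun k s' => outputDirection s' = outputDirection s ∧
    Ready p r s' σ (item σ r) E ∧ ∀ a : Fin n, (a : ℕ) < k → ∃ q,
      s'.narr 0 a = choice σ r a q ∧ near p r σ a = dist (p a) (p (choice σ r a q))) ?_ ?_ ?_).imp ?_
  · exact ⟨rfl, h.of_eq (fun x hx => Function.update_of_ne (by omega) _ _) (fun _ _ => rfl) rfl rfl,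
      fun a ha => absurd ha (by omega)⟩
  · exact fun k s h => h.2.1.const.size
  · rintro k s' hk ⟨hd, h', hpar⟩ h9
    refine (Ends.putN ?_).within (by simp [NExp.time])
    refine ⟨h9, hd, h'.of_eq (fun x hx => Function.update_of_ne (by omega) _ _)
      (fun a ha => Function.update_of_ne ha _ _) rfl rfl, fun a ha => ?_⟩
    simp only [NExp.eval, h9, Function.update_self, Function.update_apply]
    by_cases e : (a : ℕ) = k
    · obtain ⟨q, h1, h2⟩ := h'.root a
      refine ⟨q, ?_, h2⟩
      rw [if_pos e, ← e, h'.const.row, h1, h'.const.snd]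
    · rw [if_neg e]
      exact hpar a (by omega)
  · rintro s' ⟨hd, -, hpar⟩
    exact ⟨hd, fun a => hpar a a.2⟩

/-- The program. -/
def program : Prog := .block [prepare, sweep, settle, refreshAll, improve, output]

/-- Each of the two conditions on the root holds for only `n` of the `n²` pairs, so the expensive
events contribute as much as the cheap ones up to a constant. -/
theorem budget_le (L : ℕ) (r : Fin n) : budget L r ∅ ≤
    (n + 1) * (n + 1) * (4000 * (L + 1)) := by
  classical
  have h1 : budget L r ∅ ≤ ∑ e : Fin n × Fin n,
      ((if e.1 = r then (n + 1) * (200 * (L + 1) + 110) else 0) +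
        (if e.2 = r then (n + 1) * (200 * (L + 1) + 110) else 0) + (600 * (L + 1) + 800)) := by
    unfold budget
    refine (Finset.sum_le_sum_of_subset (Finset.subset_univ _)).trans
      (Finset.sum_le_sum fun e _ => ?_)
    unfold price
    split_ifs <;> omega
  refine h1.trans ?_
  rw [Finset.sum_add_distrib, Finset.sum_add_distrib, Fintype.sum_prod_type_right,
    Fintype.sum_prod_type]
  simp only [Finset.sum_ite_eq', Finset.mem_univ, if_true, Finset.sum_const, Finset.card_univ,
    Fintype.card_prod, Fintype.card_fin, smul_eq_mul]
  nlinarith [Nat.zero_le n, Nat.zero_le L]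

theorem isRootedUMMST_outputGraph (hp : Function.Injective p) (hg : GeneralPosition p)
    {D : Finset (Fin n × Fin n)} {s' : State} (h : Sweeping p r D s)
    (hD : ∀ i j, IsEvent r i j → (i, j) ∈ D)
    (hσ : Improved p r (outputDirection s) (n * n) σ)
    (hd : outputDirection s' = outputDirection s)
    (hpar : ∀ a : Fin n, ∃ q, s'.narr 0 a = choice σ r a q ∧
      near p r σ a = dist (p a) (p (choice σ r a q))) :
    IsRootedUMMST p r (outputDirection s') (outputGraph r s') := by
  choose q hq hnear using hpar
  have hgraph : outputGraph r s' = parentGraph r fun a => choice σ r a (q a) := by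
    unfold outputGraph parentGraph
    simp only [hq, Fin.val_inj]
  have hparent := hσ.refines.isParent hg h.ne_zero (par := fun a => choice σ r a (q a))
    fun v _ => ⟨q v, rfl⟩
  rw [hgraph, hd]
  refine ⟨hparent.isTree, h.ne_zero, hparent.rootedMonotone, ?_⟩
  rintro G ⟨v, hv, hG⟩
  obtain ⟨par, h1, h2⟩ := exists_isParent_of_rootedMonotone hG
  rw [hparent.cost_eq]
  refine le_trans ?_ h2
  by_cases hone : ∃ a, a ≠ r
  · obtain ⟨a, ha⟩ := hone
    have hev : ∃ i j, IsEvent r i j ∧ IsParent p r (evDir p i j) par := by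
      obtain ⟨i, j, hij, h3⟩ := h1.exists_evDir hp hv ha
      -- A pair of other points is an event only in increasing order; swapping it does not change
      -- its direction.
      by_cases hi : IsEvent r i j
      · exact ⟨i, j, hi, h3⟩
      · refine ⟨j, i, ⟨hij.symm, Or.inr (Or.inr ?_)⟩, ?_⟩
        · simp only [IsEvent, not_and, not_or, not_lt] at hi
          exact lt_of_le_of_ne (hi hij).2.2 hij.symm
        · rwa [evDir, (ev_swap hp hij).1, (ev_swap hp hij).2]
    obtain ⟨i, j, hij, h3⟩ := hev
    obtain ⟨τ, hτ, hle⟩ := h3.exists_refines hg (evDir_upper hp hij.1).ne_zero (sg p)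
    have hlow := h.lower (i, j) (hD i j hij) τ (hτ.mono fun a b ha hb hab _ hn =>
      absurd (Finset.mem_coe.2 (hD a b ⟨hab.ne, Or.inr (Or.inr hab)⟩)) hn)
    obtain ⟨ρ, hρ, hup⟩ := h.upper
    have hbest := hσ.le ρ (hρ.mono fun a b _ _ _ _ hn => absurd (cell_lt a b) hn)
    rw [total_eq_erase] at hbest
    simp only [hnear] at hbest
    -- The cost of the output is the total of `σ`. It is at most the total of `ρ`, by optimality
    -- within the direction found; then at most the recorded value, and at most the total of `τ`, by
    -- the lower bound of the sweep. The last is at most the sum for the competitor's parents.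
    linarith
  -- A single point gives no event, and both costs are empty sums.
  · have : (Finset.univ : Finset (Fin n)).erase r = ∅ := by
      ext a
      simp only [Finset.mem_erase, Finset.mem_univ, and_true, Finset.notMem_empty, iff_false]
      exact fun ha => hone ⟨a, ha⟩
    rw [this, Finset.sum_empty, Finset.sum_empty]

theorem program_ends (hp : Function.Injective p) (hg : GeneralPosition p) (r : Fin n)
    (hL : 2 * (n * n) ≤ 2 ^ (L + 1)) :
    Ends program (input p r) ((n + 1) * (n + 1) * (8000 * (L + 1))) fun s =>
      IsRootedUMMST p r (outputDirection s) (outputGraph r s) := by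
  refine (Ends.cons ((prepare_ends hp hg hL).imp fun s0 h0 => Ends.cons
    (k' := (n + 1) * ((n + 1) * 209 + 9) + ((n + 1) * ((n + 1) * (200 * (L + 1) + 110) + 9) +
      ((n + 1) * ((n + 1) * (800 * (L + 1) + 809) + 9) + ((n + 1) * 29 + 1))))
    ((sweep_ends hp hg h0 hL).imp ?_))).within ?_
  · rintro s1 ⟨D, hs, hD⟩
    refine Ends.cons ((settle_ends hs.ready).imp ?_)
    rintro s2 ⟨d2, r2⟩
    refine Ends.cons ((refreshAll_ends r2 hL).imp ?_)
    rintro s3 ⟨k3, r3⟩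
    have d3 : outputDirection s3 = outputDirection s1 := by
      rw [← d2]
      unfold outputDirection
      rw [k3.rreg 0 (by decide), k3.rreg 1 (by decide)]
    rw [← d3] at r3
    have hbase := baseSigns_refines p r (outputDirection s3)
    refine Ends.cons ((improve_ends hg hL (by rw [d3]; exact hs.ne_zero) ⟨hbase, fun σ' hσ' =>
      (hbase.total_eq hσ' (dirSign_swap p _) (by simp)).le⟩ r3).imp ?_)
    rintro s4 ⟨d4, σ, r4, hσ⟩
    refine Ends.cons (k' := 1) ((output_ends r4).imp ?_)
    rintro s5 ⟨d5, hpar⟩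
    rw [d3] at hσ
    exact Ends.nil (isRootedUMMST_outputGraph hp hg hs hD hσ (d5.trans (d4.trans d3)) hpar)
  · have := budget_le L r
    nlinarith [Nat.zero_le n, Nat.zero_le L]

/-- This choice of `L` covers the node numbers of the event tree, the largest of the trees, with
`2n²` as bound. -/
theorem two_mul_sq_le_two_pow (n : ℕ) : 2 * (n * n) ≤ 2 ^ (2 * Nat.log 2 n + 2 + 1) := by
  have h := (Nat.lt_pow_succ_log_self (b := 2) (by decide) n).le
  calc 2 * (n * n) ≤ 2 * (2 ^ (Nat.log 2 n + 1) * 2 ^ (Nat.log 2 n + 1)) := by gcongr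
    _ = _ := by ring

theorem log_bound (hn : 2 ≤ n) :
    ((n + 1) * (n + 1) * (8000 * (2 * Nat.log 2 n + 2 + 1)) : ℝ) ≤
      320000 * ((n : ℝ) ^ 2 * Real.log n) := by
  have h1 : (1 : ℝ) ≤ Nat.log 2 n := by
    exact_mod_cast Nat.log_pos (by decide) hn
  have h2 : (Nat.log 2 n : ℝ) ≤ 2 * Real.log n := by
    have h3 : (2 : ℝ) ^ Nat.log 2 n ≤ n := by
      exact_mod_cast Nat.pow_log_le_self 2 (by omega)
    have h4 := Real.log_le_log (by positivity) h3
    rw [Real.log_pow] at h4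
    -- Since `log 2 > 1/2`, the binary logarithm is at most twice the natural one. It is also at
    -- least 1, so `2 * Nat.log 2 n + 3` is at most five times it, hence at most `10 * Real.log n`.
    nlinarith [Real.log_two_gt_d9]
  have hn' : (2 : ℝ) ≤ n := by exact_mod_cast hn
  have h5 : ((n : ℝ) + 1) * (n + 1) ≤ 4 * n ^ 2 := by nlinarith
  calc ((n + 1) * (n + 1) * (8000 * (2 * Nat.log 2 n + 2 + 1)) : ℝ)
      ≤ 4 * (n : ℝ) ^ 2 * (8000 * (10 * Real.log n)) := by
        gcongr
        linarith
    _ = _ := by ring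

end RealRAM

theorem mainTheorem2 :
    ∃ (P : RealRAM.Prog) (C : ℝ), ∀ (n : ℕ) (p : Fin n → Geo.Plane) (r : Fin n),
      Function.Injective p → Geo.GeneralPosition p →
        ∃ (t : ℕ) (s : RealRAM.State),
          RealRAM.Exec P (RealRAM.input p r) t s ∧
          (2 ≤ n → (t : ℝ) ≤ C * ((n : ℝ) ^ 2 * Real.log n)) ∧
          Geo.IsRootedUMMST p r (RealRAM.outputDirection s) (RealRAM.outputGraph r s) := by
  refine ⟨RealRAM.program, 320000, fun n p r hp hg => ?_⟩
  obtain ⟨t, s, h1, h2, h3⟩ :=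
    RealRAM.program_ends hp hg r (RealRAM.two_mul_sq_le_two_pow n)
  refine ⟨t, s, h1, fun hn => le_trans ?_ (RealRAM.log_bound hn), h3⟩
  exact_mod_cast h2
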